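/- Let $n\ge2$, $G=\mathrm{GL}_n(\mathbb C)$, $K=\mathrm U(n)$. Let $\mathfrak a=\{X\in\mathbb R^n:\sum_i X_i=0\}$; identify $\mathfrak a^*$ with the same space through $\lambda(X)=\sum_i\lambda_iX_i$, and write $\mathfrak a_{\mathbb C},\mathfrak a^*_{\mathbb C}$ for the complexifications. Let $\langle\lambda,\mu\rangle=\frac1{2n}\sum_i\lambda_i\mu_i$ on $\mathfrak a_{\mathbb C}^*$ (bilinear) and $\|\lambda\|^2=\langle\Re\lambda,\Re\lambda\rangle+\langle\Im\lambda,\Im\lambda\rangle$. Let $\Phi^+=\{e_i-e_j:i<j\}$, let $\Delta_0$ be the set of simple roots, $W=S_n$ acting by permutation of coordinates, $d=n^2-1$, $r=n-1$. For $X\in\mathbb C^n$ put $e^X=\mathrm{diag}(e^{X_1},\dots,e^{X_n})$. Let $H_0:G\to\mathbb R^n$ be the Iwasawa projection, $H_0(u\,e^X k)=X$ for $u$ unipotent upper triangular, $X\in\mathbb R^n$, $k\in K$. Fix a subset $\tilde\Delta\subseteq\Delta_0$, with its positive roots $\tilde\Phi^+\subseteq\Phi^+$ (those in the span of $\tilde\Delta$),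 standard (block diagonal) Levi subgroup $\tilde G$, Weyl group $\tilde W\subseteq W$, and $\tilde K=K\cap\tilde G$. Put $\Phi_1^+=\Phi^+\setminus\tilde\Phi^+$. Let $\tilde{\mathfrak a}^*$ be the span of $\tilde\Delta$ and $\tilde{\mathfrak a}$ the span of the corresponding coroots; write $X=\tilde X+X_1$ and $\lambda=\tilde\lambda+\lambda_1$ for the orthogonal decompositions of $X\in\mathfrak a_{\mathbb C}$, $\lambda\in\mathfrak a_{\mathbb C}^*$ along $\tilde{\mathfrak a}_{\mathbb C}$, $\tilde{\mathfrak a}^*_{\mathbb C}$. Let $\rho$ and $\tilde\rho$ be the half-sums of the roots in $\Phi^+$, $\tilde\Phi^+$ counted with multiplicity $2$ (so $\rho=\sum_{\alpha\in\Phi^+}\alpha$, $\tilde\rho=\sum_{\alpha\in\tilde\Phi^+}\alpha$). Put $$\pi(\lambda)=\prod_{\alpha\in\Phi^+}\langle\alpha,\lambda\rangle,\quad \mathbf c(\lambda)=\frac{\pi(\rho)}{\pi(\lambda)},\quad \tilde\pi(\lambda)=\prod_{\alpha\in\tilde\Phi^+}\langle\alpha,\lambda\rangle,\quad \tilde{\mathbf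 c}(\lambda)=\frac{\tilde\pi(\rho)}{\tilde\pi(\lambda)}$$ (so $\mathbf c^{-1}$ and $\tilde{\mathbf c}^{-1}$ are polynomials). The spherical functions are $$\phi_\lambda(x)=\int_K e^{(\lambda+\rho)(H_0(kx))}\,dk\ \ (x\in G),\qquad \phi^{\tilde G}_{\mu}(x)=\int_{\tilde K}e^{(\mu+\tilde\rho)(H_0(kx))}\,dk\ \ (x\in\tilde G),$$ for $\lambda\in\mathfrak a^*_{\mathbb C}$, $\mu\in\tilde{\mathfrak a}^*_{\mathbb C}$, with Haar probability measures. The function $X\mapsto\phi_\lambda(e^X)$ on $\mathfrak a$ extends uniquely to a holomorphic function on $\Omega=\{X\in\mathfrak a_{\mathbb C}:\alpha(X)\notin\pi i(\mathbb Z\setminus\{0\})\ \forall\alpha\in\Phi^+\}$, and likewise $\phi^{\tilde G}_\mu(e^{X})$ extends uniquely from $\tilde{\mathfrak a}$ to the analogous set $\tilde\Omega\subseteq\tilde{\mathfrak a}_{\mathbb C}$ defined by $\tilde\Phi^+$; for complex $X$ in these sets the same notation denotes these extensions. Then: (i) If $X\in\Omega$ (for instance $X\in\mathfrak a$) and $\alpha(X)\ne0$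 for all $\alpha\in\Phi_1^+$, then for every $\lambda\in\mathfrak a_{\mathbb C}^*$ $$\mathbf c(\lambda)^{-1}\phi_\lambda(e^X)=\frac{2^{-|\Phi_1^+|}}{|\tilde W|}\Big(\prod_{\alpha\in\Phi_1^+}\frac1{\sinh\alpha(X)}\Big)\sum_{\sigma\in W}\det(\sigma)\,e^{(\sigma\lambda)_1(X_1)}\,\phi^{\tilde G}_{\widetilde{\sigma\lambda}}(e^{\tilde X})\,\tilde{\mathbf c}(\sigma\lambda)^{-1}.$$ (ii) If in addition $\alpha(X)=0$ for all $\alpha\in\tilde\Phi^+$, then for every $\lambda\in\mathfrak a_{\mathbb C}^*$ $$\mathbf c(\lambda)^{-1}\phi_\lambda(e^X)=\frac{2^{-|\Phi_1^+|}}{|\tilde W|}\Big(\prod_{\alpha\in\Phi_1^+}\frac1{\sinh\alpha(X)}\Big)\sum_{\sigma\in W}\det(\sigma)\,e^{(\sigma\lambda)_1(X_1)}\,\tilde{\mathbf c}(\sigma\lambda)^{-1}.$$ (iii) There is a constant $C>0$ depending only on $n$ such that for all $\tilde\Delta\subseteq\Delta_0$, all $X\in\mathfrak a$ with $\alpha(X)\ne0$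 for $\alpha\in\Phi_1^+$, and all $\lambda\in i\mathfrak a^*$ $$\big|\mathbf c(\lambda)^{-2}\phi_\lambda(e^X)\big|\le C\,(1+\|\lambda\|)^{d-r-|\Phi_1^+|}\prod_{\alpha\in\Phi_1^+}|\sinh\alpha(X)|^{-1}.$$ -/

import Mathlib

open scoped BigOperators

noncomputable section

namespace SphericalGL

variable {n : ℕ}

/-! ### Roots, standard Levi subgroups and their Weyl groups

The space `𝔞` of real diagonal matrices of trace zero, its dual `𝔞*` and their complexifications
are identified with coordinate vectors of sum zero, and `λ(X) = ∑ i, λ i * X i`.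
The simple root `α_k(X) = X_k - X_{k+1}` is indexed by `k : Fin (n - 1)`, so a subset of the set of
simple roots is a `Finset (Fin (n - 1))`.  The choice `S = Finset.univ` gives `GL_n` itself. -/

/-- `i` and `j` lie in the same block of the standard Levi subgroup attached to `S`: all simple
roots occurring in `±(e_i - e_j) = ± ∑_{min ≤ k < max} α_k` belong to `S`. -/
def SameBlock (S : Finset (Fin (n - 1))) (i j : Fin n) : Prop :=
  ∀ k : Fin (n - 1), min (i : ℕ) (j : ℕ) ≤ (k : ℕ) → (k : ℕ) < max (i : ℕ) (j : ℕ) → k ∈ S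

instance instDecSameBlock (S : Finset (Fin (n - 1))) (i j : Fin n) : Decidable (SameBlock S i j) := by
  unfold SameBlock
  infer_instance

theorem SameBlock.rfl (S : Finset (Fin (n - 1))) (i : Fin n) : SameBlock S i i := by
  intro k h1 h2
  simp only [min_self, max_self] at h1 h2
  omega

theorem SameBlock.symm {S : Finset (Fin (n - 1))} {i j : Fin n} (h : SameBlock S i j) :
    SameBlock S j i := by
  intro k h1 h2
  exact h k (by rwa [min_comm]) (by rwa [max_comm])

theorem SameBlock.trans {S : Finset (Fin (n - 1))} {i j l : Fin n} (h : SameBlock S i j)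
    (h' : SameBlock S j l) : SameBlock S i l := by
  intro k h1 h2
  by_cases hk : min (i : ℕ) (j : ℕ) ≤ (k : ℕ) ∧ (k : ℕ) < max (i : ℕ) (j : ℕ)
  · exact h k hk.1 hk.2
  · exact h' k (by omega) (by omega)

/-- The positive roots `e_i - e_j`, `i < j`, of the standard Levi subgroup attached to `S`,
i.e. the positive roots that are combinations of the simple roots in `S`. -/
def posRoots (S : Finset (Fin (n - 1))) : Finset (Fin n × Fin n) :=
  Finset.univ.filter fun p => p.1 < p.2 ∧ SameBlock S p.1 p.2

/-- The value `α(X) = X_i - X_j` of the root `α = e_i - e_j`. -/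
def rootVal (p : Fin n × Fin n) (X : Fin n → ℂ) : ℂ := X p.1 - X p.2

/-- The root `α = e_i - e_j` as a coordinate vector. -/
def rootVec (p : Fin n × Fin n) : Fin n → ℂ := Pi.single p.1 1 - Pi.single p.2 1

/-- Half the sum of the positive roots, each counted with its multiplicity: every root space of
the real Lie algebra of a complex group has real dimension `2`. -/
def rho (S : Finset (Fin (n - 1))) : Fin n → ℂ :=
  (1 / 2 : ℂ) • ∑ p ∈ posRoots S, (2 : ℂ) • rootVec p

/-- The bilinear form on the dual space that is dual to `⟨X, Y⟩ = 2n ∑ X_i Y_i`. -/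
def form (l m : Fin n → ℂ) : ℂ := (∑ i, l i * m i) / (2 * (n : ℂ))

/-- The norm `(⟨Re λ, Re λ⟩ + ⟨Im λ, Im λ⟩)^{1/2}` for the same form. -/
def dualNorm (l : Fin n → ℂ) : ℝ :=
  Real.sqrt ((∑ i, (l i).re * (l i).re) / (2 * (n : ℝ)) +
    (∑ i, (l i).im * (l i).im) / (2 * (n : ℝ)))

/-- The product of `⟨α, λ⟩` over the positive roots of the Levi subgroup. -/
def piFn (S : Finset (Fin (n - 1))) (l : Fin n → ℂ) : ℂ := ∏ p ∈ posRoots S, form (rootVec p) l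

/-- The function `π_S(ρ) / π_S(λ)`, where `ρ` belongs to `GL_n`. For `S = Finset.univ` it is
Harish-Chandra's function for `GL_n`. Only its inverse is used below, and that inverse equals
`π_S(λ) / π_S(ρ)` for every `λ`, also where `π_S(λ) = 0`. -/
def cFn (S : Finset (Fin (n - 1))) (l : Fin n → ℂ) : ℂ := piFn S (rho Finset.univ) / piFn S l

/-- The Weyl group of the standard Levi subgroup, inside the permutation group. -/
def weyl (S : Finset (Fin (n - 1))) : Finset (Equiv.Perm (Fin n)) :=
  Finset.univ.filter fun s => ∀ i, SameBlock S (s i) i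

/-- The action `(σλ)_i = λ_{σ⁻¹ i}` of the Weyl group. -/
def permAct (s : Equiv.Perm (Fin n)) (l : Fin n → ℂ) : Fin n → ℂ := fun i => l (s⁻¹ i)

/-- The complexification of `𝔞` for the standard Levi subgroup (the span of its coroots; dually
the span of its roots): the vectors all of whose block sums vanish. -/
def aSpace (S : Finset (Fin (n - 1))) : Submodule ℂ (Fin n → ℂ) where
  carrier := {X | ∀ i, ∑ j ∈ Finset.univ.filter (fun j => SameBlock S i j), X j = 0}
  add_mem' := by
    intro X Y hX hY i
    simp [Finset.sum_add_distrib, hX i, hY i]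
  zero_mem' := by
    intro i
    simp
  smul_mem' := by
    intro c X hX i
    simp [← Finset.mul_sum, hX i]

/-- The component `X_1` of `X` orthogonal to `aSpace S`: it is constant on each block, with value
the mean of the entries of `X` in that block. -/
def projOne (S : Finset (Fin (n - 1))) (X : Fin n → ℂ) : Fin n → ℂ := fun i =>
  (∑ j ∈ Finset.univ.filter (fun j => SameBlock S i j), X j) /
    ((Finset.univ.filter (fun j => SameBlock S i j)).card : ℂ)

theorem projOne_eq (S : Finset (Fin (n - 1))) (X : Fin n → ℂ) {i j : Fin n}
    (h : SameBlock S i j) : projOne S X j = projOne S X i := by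
  have : Finset.univ.filter (fun k => SameBlock S j k)
      = Finset.univ.filter (fun k => SameBlock S i k) := by
    ext k
    simp only [Finset.mem_filter, Finset.mem_univ, true_and]
    exact ⟨fun hk => h.trans hk, fun hk => h.symm.trans hk⟩
  simp [projOne, this]

/-- The component of `X` in `aSpace S` with respect to the orthogonal decomposition. -/
def projTilde (S : Finset (Fin (n - 1))) (X : Fin n → ℂ) : aSpace S :=
  ⟨X - projOne S X, by
    intro i
    have hc : ((Finset.univ.filter (fun j => SameBlock S i j)).card : ℂ) ≠ 0 := by
      rw [Nat.cast_ne_zero, Finset.card_ne_zero]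
      exact ⟨i, by simpa using SameBlock.rfl S i⟩
    have h1 : ∑ j ∈ Finset.univ.filter (fun j => SameBlock S i j), projOne S X j
        = ∑ j ∈ Finset.univ.filter (fun j => SameBlock S i j), projOne S X i := by
      refine Finset.sum_congr (by simp) fun j hj => projOne_eq S X ?_
      simpa using hj
    simp only [Pi.sub_apply, Finset.sum_sub_distrib, h1, Finset.sum_const, nsmul_eq_mul]
    simp only [projOne]
    rw [mul_div_cancel₀ _ hc, sub_self]⟩

/-- The pairing of the dual space with the diagonal Lie algebra. -/
def pairing (l X : Fin n → ℂ) : ℂ := ∑ i, l i * X i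

/-- The diagonal matrix `e^X`. -/
def expDiag (X : Fin n → ℂ) : Matrix (Fin n) (Fin n) ℂ := Matrix.diagonal fun i => Complex.exp (X i)

/-! ### The Iwasawa projection and spherical functions -/

/-- `g = u e^X k` with `u` unipotent upper triangular, `X` real diagonal, `k` unitary. -/
def IsIwasawa (g : Matrix (Fin n) (Fin n) ℂ) (X : Fin n → ℝ) : Prop :=
  ∃ u k : Matrix (Fin n) (Fin n) ℂ, (∀ i, u i i = 1) ∧ (∀ i j, j < i → u i j = 0) ∧
    k ∈ Matrix.unitaryGroup (Fin n) ℂ ∧ g = u * expDiag (fun i => (X i : ℂ)) * k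

/-- The Iwasawa projection `H_0`: `H_0(u e^X k) = X`. It is used for invertible matrices only,
for which such an `X` exists and is unique. -/
def iwasawaH (g : Matrix (Fin n) (Fin n) ℂ) : Fin n → ℝ := Classical.epsilon (IsIwasawa g)

/-- The maximal compact subgroup of the standard Levi subgroup: the block diagonal unitary
matrices (all of `U(n)` for `S = Finset.univ`). -/
def compactK (S : Finset (Fin (n - 1))) : Subgroup (Matrix.unitaryGroup (Fin n) ℂ) where
  carrier := {k | ∀ i j, ¬ SameBlock S i j → (k : Matrix (Fin n) (Fin n) ℂ) i j = 0}
  mul_mem' := by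
    intro a b ha hb i j hij
    change ((a : Matrix (Fin n) (Fin n) ℂ) * (b : Matrix (Fin n) (Fin n) ℂ)) i j = 0
    rw [Matrix.mul_apply]
    refine Finset.sum_eq_zero fun m _ => ?_
    by_cases him : SameBlock S i m
    · rw [hb m j fun hmj => hij (him.trans hmj), mul_zero]
    · rw [ha i m him, zero_mul]
  one_mem' := by
    intro i j hij
    change (1 : Matrix (Fin n) (Fin n) ℂ) i j = 0
    refine Matrix.one_apply_ne ?_
    rintro ⟨⟩
    exact hij (SameBlock.rfl S i)
  inv_mem' := by
    intro a ha i j hij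
    change (star (a : Matrix (Fin n) (Fin n) ℂ)) i j = 0
    rw [Matrix.star_apply, ha j i fun h => hij h.symm, star_zero]

theorem isCompact_unitary (n : ℕ) :
    IsCompact (Matrix.unitaryGroup (Fin n) ℂ : Set (Matrix (Fin n) (Fin n) ℂ)) := by
  have hbig : IsCompact {A : Matrix (Fin n) (Fin n) ℂ | ∀ i, ∀ j, A i j ∈ Metric.closedBall 0 1} := by
    have h := isCompact_univ_pi (X := fun _ : Fin n => Fin n → ℂ)
      (s := fun _ => Set.univ.pi fun _ => Metric.closedBall (0 : ℂ) 1)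
      (fun _ => isCompact_univ_pi fun _ => isCompact_closedBall 0 1)
    have he : {A : Fin n → Fin n → ℂ | ∀ i, ∀ j, A i j ∈ Metric.closedBall (0 : ℂ) 1}
        = Set.univ.pi fun _ => Set.univ.pi fun _ => Metric.closedBall (0 : ℂ) 1 := by
      ext A
      simp [Set.mem_pi]
    rw [← he] at h
    exact h
  refine hbig.of_isClosed_subset ?_ ?_
  · have : (Matrix.unitaryGroup (Fin n) ℂ : Set (Matrix (Fin n) (Fin n) ℂ))
        = {A | A * star A = 1} := by
      ext A
      exact Matrix.mem_unitaryGroup_iff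
    rw [this]
    exact isClosed_eq (by fun_prop) continuous_const
  · intro A hA i j
    simpa using entry_norm_bound_of_unitary hA i j

instance instCompactK (S : Finset (Fin (n - 1))) : CompactSpace (compactK S) := by
  have : CompactSpace (Matrix.unitaryGroup (Fin n) ℂ) :=
    isCompact_iff_compactSpace.mp (isCompact_unitary n)
  refine isCompact_iff_compactSpace.mp (IsClosed.isCompact ?_)
  have h : (compactK S : Set (Matrix.unitaryGroup (Fin n) ℂ))
      = ⋂ i, ⋂ j, ⋂ (_ : ¬ SameBlock S i j),
          {k : Matrix.unitaryGroup (Fin n) ℂ | (k : Matrix (Fin n) (Fin n) ℂ) i j = 0} := by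
    ext k
    simp [compactK]
  rw [h]
  refine isClosed_iInter fun i => isClosed_iInter fun j => isClosed_iInter fun _ => ?_
  exact isClosed_eq ((continuous_subtype_val).matrix_elem i j) continuous_const

instance instMeasK (S : Finset (Fin (n - 1))) : MeasurableSpace (compactK S) := borel _

instance instBorelK (S : Finset (Fin (n - 1))) : BorelSpace (compactK S) := ⟨rfl⟩

/-- The Haar measure of total mass one on the maximal compact subgroup. -/
def haarK (S : Finset (Fin (n - 1))) : MeasureTheory.Measure (compactK S) :=
  MeasureTheory.Measure.haarMeasure (⊤ : TopologicalSpace.PositiveCompacts (compactK S))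

/-- The elementary spherical function `x ↦ ∫ e^{(μ+ρ_S)(H_0(kx))} dk` of the standard Levi
subgroup, with parameter `μ`. On the Levi subgroup its own Iwasawa projection is the restriction
of that of `GL_n`. -/
def sph (S : Finset (Fin (n - 1))) (μ : aSpace S) (x : Matrix (Fin n) (Fin n) ℂ) : ℂ :=
  ∫ k : compactK S,
    Complex.exp (pairing ((μ : Fin n → ℂ) + rho S)
      (fun i => ((iwasawaH ((k : Matrix (Fin n) (Fin n) ℂ) * x) i : ℝ) : ℂ))) ∂(haarK S)

/-- The vectors `X` in the complexified space such that no positive root of the Levi subgroup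
takes a value in `πi(ℤ \ {0})` at `X`: a connected open dense set that contains all real `X`. -/
def contDomain (S : Finset (Fin (n - 1))) : Set (aSpace S) :=
  {X | ∀ p ∈ posRoots S, ∀ m : ℤ, m ≠ 0 →
    rootVal p X ≠ (m : ℂ) * (Real.pi : ℂ) * Complex.I}

/-- `F` is holomorphic on `contDomain S` and `F(X)` is the value of the spherical function at the
matrix `e^X` for real `X`. -/
def IsContinuation (S : Finset (Fin (n - 1))) (μ : aSpace S) (F : aSpace S → ℂ) : Prop :=
  DifferentiableOn ℂ F (contDomain S) ∧
    ∀ X : aSpace S, (∀ i, ((X : Fin n → ℂ) i).im = 0) → F X = sph S μ (expDiag X)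

/-- The analytic continuation of `X ↦ φ_μ(e^X)` from real `X` to `contDomain S`. -/
def sphExp (S : Finset (Fin (n - 1))) (μ : aSpace S) : aSpace S → ℂ :=
  Classical.epsilon (IsContinuation S μ)

end SphericalGL

end

/-! Everything rests on one determinant formula (`prod_mul_sphInt`). For a standard Levi subgroup
and real X regular in its chamber, ∏(λ_i − λ_j) · ∏ 2 sinh(X_i − X_j) · φ_λ(e^X) equals ∏ 2(j − i)
times the determinant of the block diagonal matrix with entries e^{λ_j X_i}; the products run over
the positive roots of the Levi subgroup.

The formula is proved by induction on the number of simple roots, in the manner of Gelfand and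
Naimark. One splits the first index off the first nontrivial block and averages the integral over
K_S over left translates by the smaller group K_{S'}. The Iwasawa projection is read off the lower
right minors of the Gram matrix k e^{2X} k* (`IsIwasawa.eq_minorH`), so the inner average sees only
the corner of its block with first row and column deleted. The eigenvalues e^{2y_j} of this corner
interlace the e^{2x_i}, and Lagrange interpolation expresses its characteristic polynomial through
the squared moduli of the first row of the block of k. The inner average is therefore a spherical
integral for S' at y (`FirstBlock.inner_integral`). The squared moduli are distributed like
independent exponential variables divided by their sum (`lintegral_row_normSq`), and passing to the
variables y costs a quotient of Vandermonde determinants (`abs_det_chartJac`). The Vandermonde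
determinant in y cancels the sinh denominator supplied by induction. What remains is a determinant
with one variable per row; it is integrated row by row over the gaps between consecutive x_i, and
row operations recover the larger determinant (`mul_integral_chartBox`).

Weyl invariance removes the chamber condition. The determinant vanishes on all root hyperplanes in λ
and in X, hence equals the two root products times a smooth, hence entire, factor
(`exists_det_blockExp_eq`). This gives an explicit continuation `sphCont`, with denominator ∏ 2
sinh(z)/z at the roots, and continuity extends the identity to singular λ and X. Uniqueness of the
continuation is the identity theorem on complex lines.

For (i), summing the signed block determinants at σλ over W gives |W̃| times the full determinant
(`sum_sign_mul_det_blockExp`). Each block determinant factors into e^{(σλ)_1(X_1)} and a block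
determinant in the tilde components, which the formula for the Levi subgroup rewrites as c̃⁻¹ φ̃;
the sinh factors of Φ̃⁺ cancel and those of Φ₁⁺ remain. Points singular for Φ̃⁺ are reached by a
limit. Part (ii) is φ̃(1) = 1. For (iii), |φ̃| ≤ φ̃_0 ≤ 1 at imaginary parameters, so only the
polynomials c⁻¹ and c̃⁻¹ grow, with degrees |Φ⁺| and |Φ̃⁺|, whose sum is d − r − |Φ₁⁺|. -/

namespace SphericalGL

open Polynomial Finset

/-! ### Interlacing sequences and barycentric weights -/

section Interlacing

variable {m : ℕ}

/-- `b` interlaces the decreasing sequence `a`. -/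
def Interlaces (a : Fin (m + 1) → ℝ) (b : Fin m → ℝ) : Prop :=
  ∀ j : Fin m, a j.succ < b j ∧ b j < a j.castSucc

/-- The residues of `∏ (z - b j) / ∏ (z - a i)`. -/
noncomputable def weight (a : Fin (m + 1) → ℝ) (b : Fin m → ℝ) (i : Fin (m + 1)) : ℝ :=
  ∏ j, (a i - b j) / (a i - a (i.succAbove j))

/-- The polynomial with roots `a l`, `l ≠ i`. -/
noncomputable def omitPoly {K : Type*} [CommRing K] (a : Fin (m + 1) → K) (i : Fin (m + 1)) : K[X] :=
  ∏ j, (X - C (a (i.succAbove j)))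

theorem natDegree_omitPoly {K : Type*} [CommRing K] [Nontrivial K] (a : Fin (m + 1) → K)
    (i : Fin (m + 1)) : (omitPoly a i).natDegree = m := by
  rw [omitPoly, natDegree_prod_of_monic _ _ fun _ _ => monic_X_sub_C _]
  simp

theorem monic_omitPoly {K : Type*} [CommRing K] (a : Fin (m + 1) → K)
    (i : Fin (m + 1)) : (omitPoly a i).Monic :=
  monic_prod_of_monic _ _ fun _ _ => monic_X_sub_C _

theorem eval_omitPoly_self (a : Fin (m + 1) → ℝ) (i : Fin (m + 1)) :
    (omitPoly a i).eval (a i) = ∏ j, (a i - a (i.succAbove j)) := by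
  simp [omitPoly, eval_prod]

theorem eval_omitPoly_of_ne (a : Fin (m + 1) → ℝ) {i l : Fin (m + 1)} (h : l ≠ i) :
    (omitPoly a i).eval (a l) = 0 := by
  obtain ⟨j, rfl⟩ := Fin.exists_succAbove_eq h
  rw [omitPoly, eval_prod]
  exact prod_eq_zero (mem_univ j) (by simp)

theorem eval_omitPoly_self_ne_zero {a : Fin (m + 1) → ℝ} (ha : StrictAnti a) (i : Fin (m + 1)) :
    ∏ j, (a i - a (i.succAbove j)) ≠ 0 :=
  prod_ne_zero_iff.mpr fun j _ => sub_ne_zero.mpr (ha.injective.ne (Fin.succAbove_ne i j).symm)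

theorem eval_sum_omitPoly (a u : Fin (m + 1) → ℝ) (i : Fin (m + 1)) :
    (∑ l, C (u l) * omitPoly a l).eval (a i) = u i * ∏ j, (a i - a (i.succAbove j)) := by
  rw [eval_finsetSum, sum_eq_single i]
  · simp [eval_omitPoly_self]
  · intro l _ hl
    simp [eval_omitPoly_of_ne a hl.symm]
  · simp

theorem coeff_sum_omitPoly {K : Type*} [CommRing K] [Nontrivial K] (a u : Fin (m + 1) → K) :
    (∑ l, C (u l) * omitPoly a l).coeff m = ∑ l, u l := by
  rw [finsetSum_coeff]
  refine sum_congr rfl fun l _ => ?_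
  have h := (monic_omitPoly a l).coeff_natDegree
  rw [natDegree_omitPoly] at h
  rw [coeff_C_mul, h, mul_one]

theorem natDegree_sum_omitPoly_le {K : Type*} [CommRing K] [Nontrivial K] (a u : Fin (m + 1) → K) :
    (∑ l, C (u l) * omitPoly a l).natDegree ≤ m :=
  natDegree_sum_le_of_forall_le _ _ fun l _ =>
    (natDegree_C_mul_le _ _).trans (natDegree_omitPoly a l).le

theorem natDegree_prod_X_sub_C' (b : Fin m → ℝ) : (∏ j, (X - C (b j))).natDegree = m := by
  rw [natDegree_prod_of_monic _ _ fun _ _ => monic_X_sub_C _]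
  simp

theorem coeff_prod_X_sub_C (b : Fin m → ℝ) : (∏ j, (X - C (b j))).coeff m = 1 := by
  have h := (monic_prod_of_monic univ (fun j => X - C (b j)) fun _ _ => monic_X_sub_C _).coeff_natDegree
  rwa [natDegree_prod_X_sub_C'] at h

theorem weight_mul_eval (a : Fin (m + 1) → ℝ) (ha : StrictAnti a) (b : Fin m → ℝ)
    (i : Fin (m + 1)) :
    weight a b i * ∏ j, (a i - a (i.succAbove j)) = ∏ j, (a i - b j) := by
  rw [weight, prod_div_distrib, div_mul_cancel₀ _ (eval_omitPoly_self_ne_zero ha i)]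

/-- Lagrange interpolation of `∏ (z - b j)` at the nodes `a i`. -/
theorem sum_weight_omitPoly (a : Fin (m + 1) → ℝ) (ha : StrictAnti a) (b : Fin m → ℝ) :
    ∑ i, C (weight a b i) * omitPoly a i = ∏ j, (X - C (b j)) := by
  refine Polynomial.eq_of_degrees_lt_of_eval_index_eq (s := univ) (v := a) ha.injective.injOn ?_ ?_ ?_
  · rw [card_univ, Fintype.card_fin]
    exact (degree_le_of_natDegree_le (natDegree_sum_omitPoly_le a _)).trans_lt
      (by exact_mod_cast Nat.lt_succ_self m)
  · rw [card_univ, Fintype.card_fin]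
    exact (degree_le_of_natDegree_le (natDegree_prod_X_sub_C' b).le).trans_lt
      (by exact_mod_cast Nat.lt_succ_self m)
  · intro i _
    rw [eval_sum_omitPoly, weight_mul_eval a ha, eval_prod]
    simp

/-- Compare leading coefficients in the Lagrange identity: ∏(z − b_j) is monic. -/
theorem sum_weight (a : Fin (m + 1) → ℝ) (ha : StrictAnti a) (b : Fin m → ℝ) :
    ∑ i, weight a b i = 1 := by
  have h := congrArg (fun p => p.coeff m) (sum_weight_omitPoly a ha b)
  simpa only [coeff_sum_omitPoly, coeff_prod_X_sub_C] using h

/-- Each factor pairs b_j with that neighbouring node which is different from a_i or further away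
from it, so numerator and denominator have the same sign. -/
theorem weight_pos {a : Fin (m + 1) → ℝ} (ha : StrictAnti a) {b : Fin m → ℝ}
    (hb : Interlaces a b) (i : Fin (m + 1)) : 0 < weight a b i := by
  refine prod_pos fun j _ => ?_
  rcases lt_or_ge j.castSucc i with h | h
  · rw [Fin.succAbove_of_castSucc_lt _ _ h]
    have h1 : a i ≤ a j.succ := ha.antitone (Fin.castSucc_lt_iff_succ_le.mp h)
    exact div_pos_of_neg_of_neg (by linarith [(hb j).1]) (by linarith [ha h])
  · rw [Fin.succAbove_of_le_castSucc _ _ h]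
    have h1 : a j.castSucc ≤ a i := ha.antitone h
    exact div_pos (by linarith [(hb j).2]) (by linarith [ha j.castSucc_lt_succ, h1])

theorem Interlaces.strictAnti {a : Fin (m + 1) → ℝ} (ha : StrictAnti a) {b : Fin m → ℝ}
    (hb : Interlaces a b) : StrictAnti b := by
  intro j l hjl
  have h1 : a l.castSucc ≤ a j.succ := ha.antitone (by
    rw [Fin.le_def]; simp only [Fin.val_succ, Fin.val_castSucc]; exact hjl)
  linarith [(hb j).1, (hb l).2]

/-- The weights sum to 1, which fixes r. They then determine ∏(z − b_j) by interpolation, and since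
each gap between nodes holds exactly one root, the roots agree in order as well. -/
theorem interlaces_unique {a : Fin (m + 1) → ℝ} (ha : StrictAnti a) {b b' : Fin m → ℝ}
    (hb : Interlaces a b) (hb' : Interlaces a b') {r r' : ℝ}
    (h : ∀ i, r * weight a b i = r' * weight a b' i) (hr : r ≠ 0) : r = r' ∧ b = b' := by
  have hrr : r = r' := by
    have := sum_congr rfl fun (i : Fin (m + 1)) (_ : i ∈ univ) => h i
    rwa [← mul_sum, ← mul_sum, sum_weight a ha, sum_weight a ha, mul_one, mul_one] at this
  subst hrr
  refine ⟨rfl, ?_⟩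
  have hw : weight a b = weight a b' := by
    ext i
    exact mul_left_cancel₀ hr (h i)
  have hp := sum_weight_omitPoly a ha b
  rw [hw, sum_weight_omitPoly a ha b'] at hp
  ext j
  have he := congrArg (eval (b j)) hp
  rw [eval_prod, eval_prod, prod_eq_zero (f := fun l => eval (b j) (X - C (b l))) (mem_univ j)
    (by simp), prod_eq_zero_iff] at he
  obtain ⟨l, -, hl⟩ := he
  have hl' : b j = b' l := by simpa [sub_eq_zero] using hl
  have : l = j := by
    by_contra hne
    rcases lt_or_gt_of_ne hne with hlt | hlt
    · have h1 : a j.castSucc ≤ a l.succ := ha.antitone (by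
        rw [Fin.le_def]; simp only [Fin.val_succ, Fin.val_castSucc]; exact hlt)
      linarith [(hb j).2, (hb' l).1]
    · have h1 : a l.castSucc ≤ a j.succ := ha.antitone (by
        rw [Fin.le_def]; simp only [Fin.val_succ, Fin.val_castSucc]; exact hlt)
      linarith [(hb j).1, (hb' l).2]
  rw [hl', this]

/-- Exactly i of the factors are negative, those belonging to the larger nodes, which have smaller
index. -/
theorem sign_eval_omitPoly {a : Fin (m + 1) → ℝ} (ha : StrictAnti a) (i : Fin (m + 1)) :
    0 < (-1 : ℝ) ^ (i : ℕ) * ∏ j, (a i - a (i.succAbove j)) := by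
  have h1 : (-1 : ℝ) ^ (i : ℕ) = ∏ j : Fin m, if j.castSucc < i then (-1 : ℝ) else 1 := by
    rw [prod_ite, prod_const, prod_const_one, mul_one]
    congr 1
    have : (univ.filter fun j : Fin m => j.castSucc < i).card = (Finset.range i).card := by
      refine card_bij (fun j _ => (j : ℕ)) ?_ ?_ ?_
      · intro j hj
        simpa [Fin.lt_def] using hj
      · intro j _ l _ h
        exact Fin.ext h
      · intro l hl
        rw [Finset.mem_range] at hl
        exact ⟨⟨l, by omega⟩, by simpa [Fin.lt_def] using hl, rfl⟩
    rw [this, card_range]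
  rw [h1, ← prod_mul_distrib]
  refine prod_pos fun j _ => ?_
  split_ifs with h
  · rw [Fin.succAbove_of_castSucc_lt _ _ h]
    linarith [ha h]
  · push Not at h
    rw [Fin.succAbove_of_le_castSucc _ _ h]
    linarith [ha j.castSucc_lt_succ, ha.antitone h]

/-- With positive u, the polynomial ∑ u_l ∏_{i≠l}(z − a_i) alternates in sign at the nodes, so it
has a root in each gap; these m roots and the leading coefficient ∑ u_l determine it. -/
theorem exists_interlaces {a : Fin (m + 1) → ℝ} (ha : StrictAnti a) {u : Fin (m + 1) → ℝ}
    (hu : ∀ i, 0 < u i) :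
    ∃ b, Interlaces a b ∧ ∀ i, u i = (∑ l, u l) * weight a b i := by
  set P : ℝ[X] := ∑ l, C (u l) * omitPoly a l with hP
  have hsgn : ∀ i : Fin (m + 1), 0 < (-1 : ℝ) ^ (i : ℕ) * P.eval (a i) := by
    intro i
    rw [hP, eval_sum_omitPoly, mul_left_comm]
    exact mul_pos (hu i) (sign_eval_omitPoly ha i)
  have hroot : ∀ j : Fin m, ∃ b, (a j.succ < b ∧ b < a j.castSucc) ∧ P.eval b = 0 := by
    intro j
    have hlt := ha j.castSucc_lt_succ
    have h1 := hsgn j.castSucc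
    have h2 := hsgn j.succ
    simp only [Fin.val_succ, Fin.val_castSucc, pow_succ] at h1 h2
    have hc : ContinuousOn (fun z => (-1 : ℝ) ^ (j : ℕ) * P.eval z)
        (Set.Icc (a j.succ) (a j.castSucc)) := by fun_prop
    obtain ⟨b, hb, hb0⟩ := intermediate_value_Ioo hlt.le hc (show (0 : ℝ) ∈ _ from
      ⟨by linarith, h1⟩)
    refine ⟨b, hb, ?_⟩
    simpa using hb0
  choose b hb hb0 using hroot
  refine ⟨b, hb, ?_⟩
  have hbi : Function.Injective b := (Interlaces.strictAnti ha hb).injective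
  have hPb : P = C (∑ l, u l) * ∏ j, (X - C (b j)) := by
    refine Polynomial.eq_of_degree_sub_lt_of_eval_index_eq (s := univ) (v := b) hbi.injOn ?_ ?_
    -- Both sides have degree at most m and the same coefficient at m, so their difference has
    -- degree below m and is determined by its values at the m points b_j.
    · rw [card_univ, Fintype.card_fin]
      rw [degree_lt_iff_coeff_zero]
      intro k hk
      rcases hk.eq_or_lt with rfl | hk
      · rw [coeff_sub, coeff_C_mul, coeff_prod_X_sub_C, hP, coeff_sum_omitPoly]
        ring
      · refine coeff_eq_zero_of_natDegree_lt (lt_of_le_of_lt ?_ hk)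
        refine (natDegree_sub_le _ _).trans (max_le (natDegree_sum_omitPoly_le a u) ?_)
        exact (natDegree_C_mul_le _ _).trans (natDegree_prod_X_sub_C' b).le
    · intro j _
      rw [hb0, eval_mul, eval_prod, prod_eq_zero (mem_univ j) (by simp), mul_zero]
  intro i
  have h1 := eval_sum_omitPoly a u i
  rw [← hP, hPb, eval_mul, eval_C, eval_prod] at h1
  simp only [eval_sub, eval_X, eval_C] at h1
  rw [← weight_mul_eval a ha, ← mul_assoc] at h1
  exact (mul_right_cancel₀ (eval_omitPoly_self_ne_zero ha i) h1).symm

/-! ### The Jacobian determinant -/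

/-- The matrix of values is the Vandermonde matrix times the matrix of coefficients. In particular
the nodes enter only through the Vandermonde factor. -/
theorem det_eval_eq_vandermonde_mul {N : ℕ} (a : Fin N → ℝ) (p : Fin N → ℝ[X])
    (hp : ∀ j, (p j).natDegree < N) :
    (Matrix.of fun i j => (p j).eval (a i)).det
      = (Matrix.vandermonde a).det * (Matrix.of fun k j : Fin N => (p j).coeff k).det := by
  rw [← Matrix.det_mul]
  congr 1
  ext i j
  rw [Matrix.mul_apply, Matrix.of_apply, eval_eq_sum_range' (hp j), ← Fin.sum_univ_eq_sum_range
    (fun k => (p j).coeff k * a i ^ k)]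
  refine sum_congr rfl fun k _ => ?_
  simp [Matrix.vandermonde_apply, mul_comm]

theorem abs_prod_succAbove (a : Fin (m + 1) → ℝ) :
    |∏ i, ∏ j, (a i - a (i.succAbove j))| = |(Matrix.vandermonde a).det| ^ 2 := by
  have h1 : ∀ i : Fin (m + 1), ∏ j, (a i - a (i.succAbove j)) = ∏ l ∈ ({i}ᶜ : Finset _), (a i - a l) := by
    intro i
    rw [← Fin.image_succAbove_univ, prod_image (fun _ _ _ _ h => Fin.succAbove_right_injective h)]
  rw [Matrix.det_vandermonde, prod_congr rfl fun i _ => h1 i,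
    ← prod_prod_Ioi_mul_eq_prod_prod_off_diag (fun i j => a j - a i), abs_prod, abs_prod, ← prod_pow]
  refine prod_congr rfl fun i _ => ?_
  rw [abs_prod, abs_prod, ← prod_pow]
  refine prod_congr rfl fun j _ => ?_
  rw [abs_mul, abs_sub_comm (a i), sq]

theorem abs_prod_erase (b : Fin m → ℝ) :
    |∏ i, ∏ j ∈ univ.erase i, (b i - b j)| = |(Matrix.vandermonde b).det| ^ 2 := by
  have h1 : ∀ i : Fin m, univ.erase i = ({i}ᶜ : Finset _) := by
    intro i
    ext j
    simp
  rw [Matrix.det_vandermonde, prod_congr rfl fun i _ => by rw [h1 i],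
    ← prod_prod_Ioi_mul_eq_prod_prod_off_diag (fun i j => b j - b i), abs_prod, abs_prod, ← prod_pow]
  refine prod_congr rfl fun i _ => ?_
  rw [abs_prod, abs_prod, ← prod_pow]
  refine prod_congr rfl fun j _ => ?_
  rw [abs_mul, abs_sub_comm (b i), sq]

/-- The matrix of values at the `a i` of `∏ (z - b j)` and of its quotients by one factor. -/
theorem abs_det_prod_matrix (a : Fin (m + 1) → ℝ) {b : Fin m → ℝ} (hb : Function.Injective b) :
    |(Matrix.of fun i j : Fin (m + 1) => Fin.cases (motive := fun _ => ℝ) (∏ l, (a i - b l))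
        (fun j => ∏ l ∈ univ.erase j, (a i - b l)) j).det|
      = |(Matrix.vandermonde a).det| * |(Matrix.vandermonde b).det| := by
  set p : Fin (m + 1) → ℝ[X] := fun j => Fin.cases (motive := fun _ => ℝ[X])
    (∏ l, (X - C (b l))) (fun j => ∏ l ∈ univ.erase j, (X - C (b l))) j with hp
  have hdeg : ∀ j, (p j).natDegree < m + 1 := by
    intro j
    refine Fin.cases ?_ (fun j => ?_) j
    · simp only [hp, Fin.cases_zero]
      rw [natDegree_prod_X_sub_C']
      omega
    · simp only [hp, Fin.cases_succ]
      rw [natDegree_prod_of_monic _ _ fun _ _ => monic_X_sub_C _]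
      simp only [natDegree_X_sub_C, sum_const, smul_eq_mul, mul_one]
      refine lt_of_le_of_lt (card_le_univ _) (by simp)
  have heval : ∀ (v : Fin (m + 1) → ℝ), (Matrix.of fun i j : Fin (m + 1) =>
      Fin.cases (motive := fun _ => ℝ) (∏ l, (v i - b l))
        (fun j => ∏ l ∈ univ.erase j, (v i - b l)) j) = Matrix.of fun i j => (p j).eval (v i) := by
    intro v
    ext i j
    refine Fin.cases ?_ (fun j => ?_) j <;> simp [hp, eval_prod]
  -- The coefficient determinant does not depend on the nodes, so it may be computed at s, b_0, …,
  -- b_{m−1} with s off the b_j. There every product containing a vanishing factor drops out: below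
  -- the first row only the diagonal entries survive.
  obtain ⟨s, hs⟩ : ∃ s, s ∉ Set.range b := Set.Infinite.exists_notMem_finite
    Set.infinite_univ (Set.finite_range b) |>.imp fun s h => h.2
  have hs' : ∀ j, s - b j ≠ 0 := fun j h => hs ⟨j, (sub_eq_zero.mp h).symm⟩
  have hdet : (Matrix.of fun i j : Fin (m + 1) =>
      Fin.cases (motive := fun _ => ℝ) (∏ l, ((Fin.cons s b : Fin (m + 1) → ℝ) i - b l))
        (fun j => ∏ l ∈ univ.erase j, ((Fin.cons s b : Fin (m + 1) → ℝ) i - b l)) j).det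
      = (∏ l, (s - b l)) * ∏ i, ∏ l ∈ univ.erase i, (b i - b l) := by
    rw [Matrix.det_succ_column_zero, Finset.sum_eq_single 0]
    · have hd : (Matrix.of fun i j : Fin (m + 1) =>
          Fin.cases (motive := fun _ => ℝ) (∏ l, ((Fin.cons s b : Fin (m + 1) → ℝ) i - b l))
            (fun j => ∏ l ∈ univ.erase j, ((Fin.cons s b : Fin (m + 1) → ℝ) i - b l)) j).submatrix
              (Fin.succAbove 0) Fin.succ
          = Matrix.diagonal fun i => ∏ l ∈ univ.erase i, (b i - b l) := by
        ext i j
        by_cases hij : i = j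
        · subst hij
          simp
        · rw [Matrix.diagonal_apply_ne _ hij]
          simp only [Matrix.submatrix_apply, Matrix.of_apply, Fin.succAbove_zero, Fin.cons_succ,
            Fin.cases_succ]
          exact prod_eq_zero (mem_erase.mpr ⟨hij, mem_univ i⟩) (by simp)
      rw [hd, Matrix.det_diagonal]
      simp
    · intro i _ hi
      obtain ⟨j, rfl⟩ := Fin.exists_succ_eq.mpr hi
      simp only [Matrix.of_apply, Fin.cons_succ, Fin.cases_zero]
      rw [prod_eq_zero (mem_univ j) (by simp)]
      simp
    · simp
  have hV : (Matrix.vandermonde (Fin.cons s b : Fin (m + 1) → ℝ)).det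
      = (∏ l, (b l - s)) * (Matrix.vandermonde b).det := by
    rw [Matrix.det_vandermonde, Matrix.det_vandermonde, Fin.prod_univ_succ]
    congr 1
    · rw [Fin.prod_Ioi_zero]
      simp
    · refine prod_congr rfl fun i _ => ?_
      rw [Fin.prod_Ioi_succ]
      simp
  -- At these nodes one side contains |V(b)|² and the Vandermonde factor contains |V(b)|, up to the
  -- common ∏|s − b_l|. Hence the coefficient determinant has absolute value |V(b)|.
  have key := congrArg abs (det_eval_eq_vandermonde_mul (Fin.cons s b) p hdeg)
  rw [← heval, hdet, hV, abs_mul, abs_prod_erase, abs_mul, abs_mul] at key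
  have hss : |∏ l, (s - b l)| = |∏ l, (b l - s)| := by
    rw [abs_prod, abs_prod]
    exact prod_congr rfl fun l _ => abs_sub_comm _ _
  have h0 : |∏ l, (b l - s)| ≠ 0 := by
    rw [← hss]
    exact abs_ne_zero.mpr (prod_ne_zero_iff.mpr fun j _ => hs' j)
  have hVb : |(Matrix.vandermonde b).det| ≠ 0 :=
    abs_ne_zero.mpr (Matrix.det_vandermonde_ne_zero_iff.mpr hb)
  rw [heval a, det_eval_eq_vandermonde_mul a p hdeg, abs_mul]
  congr 1
  rw [hss, sq, ← mul_assoc] at key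
  exact (mul_left_cancel₀ (mul_ne_zero h0 hVb) key).symm

/-! ### The interlacing chart of the positive orthant -/

/-- The point with total mass `c 0` whose barycentric weights belong to the logarithmic interlacing
parameters `c j.succ`. -/
noncomputable def chart (x : Fin (m + 1) → ℝ) (c : Fin (m + 1) → ℝ) (i : Fin (m + 1)) : ℝ :=
  c 0 * weight (fun i => Real.exp (2 * x i)) (fun j => Real.exp (2 * c j.succ)) i

/-- The domain of the interlacing chart. -/
def chartBox (x : Fin (m + 1) → ℝ) : Set (Fin (m + 1) → ℝ) :=
  Set.pi Set.univ fun i => Fin.cases (motive := fun _ => Set ℝ) (Set.Ioi 0)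
    (fun j => Set.Ioo (x j.succ) (x j.castSucc)) i

theorem mem_chartBox {x c : Fin (m + 1) → ℝ} :
    c ∈ chartBox x ↔ 0 < c 0 ∧ ∀ j : Fin m, x j.succ < c j.succ ∧ c j.succ < x j.castSucc := by
  simp [chartBox, Set.mem_pi, Fin.forall_fin_succ]

theorem measurableSet_chartBox (x : Fin (m + 1) → ℝ) : MeasurableSet (chartBox x) := by
  refine MeasurableSet.univ_pi fun i => ?_
  refine Fin.cases ?_ (fun j => ?_) i
  · exact measurableSet_Ioi
  · exact measurableSet_Ioo

theorem strictAnti_exp {N : ℕ} {x : Fin N → ℝ} (hx : StrictAnti x) :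
    StrictAnti fun i => Real.exp (2 * x i) := fun i j h =>
  Real.exp_lt_exp.mpr (by linarith [hx h])

theorem interlaces_of_mem {x c : Fin (m + 1) → ℝ} (hc : c ∈ chartBox x) :
    Interlaces (fun i => Real.exp (2 * x i)) (fun j : Fin m => Real.exp (2 * c j.succ)) := by
  intro j
  have := (mem_chartBox.mp hc).2 j
  exact ⟨Real.exp_lt_exp.mpr (by linarith), Real.exp_lt_exp.mpr (by linarith)⟩

theorem injOn_chart {x : Fin (m + 1) → ℝ} (hx : StrictAnti x) : Set.InjOn (chart x) (chartBox x) := by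
  intro c hc c' hc' h
  obtain ⟨h1, h2⟩ := interlaces_unique (strictAnti_exp hx) (interlaces_of_mem hc)
    (interlaces_of_mem hc') (fun i => congrFun h i) (mem_chartBox.mp hc).1.ne'
  ext i
  refine Fin.cases h1 (fun j => ?_) i
  have h3 := Real.exp_injective (congrFun h2 j)
  linarith

theorem image_chart {x : Fin (m + 1) → ℝ} (hx : StrictAnti x) :
    chart x '' chartBox x = {u | ∀ i, 0 < u i} := by
  ext u
  constructor
  · rintro ⟨c, hc, rfl⟩ i
    exact mul_pos (mem_chartBox.mp hc).1 (weight_pos (strictAnti_exp hx) (interlaces_of_mem hc) i)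
  · intro hu
    obtain ⟨b, hb, h⟩ := exists_interlaces (strictAnti_exp hx) hu
    have hbpos : ∀ j, 0 < b j := fun j => (Real.exp_pos _).trans (hb j).1
    refine ⟨Fin.cons (∑ l, u l) fun j => Real.log (b j) / 2, ?_, ?_⟩
    · rw [mem_chartBox]
      refine ⟨sum_pos (fun i _ => hu i) univ_nonempty, fun j => ?_⟩
      have h1 := (Real.lt_log_iff_exp_lt (hbpos j)).mpr (hb j).1
      have h2 := (Real.log_lt_iff_lt_exp (hbpos j)).mpr (hb j).2
      simp only [Fin.cons_succ]
      constructor <;> linarith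
    · ext i
      rw [h i, chart]
      simp only [Fin.cons_zero, Fin.cons_succ]
      congr 2
      ext j
      rw [mul_div_cancel₀ _ two_ne_zero, Real.exp_log (hbpos j)]

theorem sum_chart {x : Fin (m + 1) → ℝ} (hx : StrictAnti x) (c : Fin (m + 1) → ℝ) :
    ∑ i, chart x c i = c 0 := by
  simp only [chart]
  rw [← mul_sum, sum_weight _ (strictAnti_exp hx), mul_one]

/-- The Jacobian matrix of the interlacing chart. -/
noncomputable def chartJac (x c : Fin (m + 1) → ℝ) : Matrix (Fin (m + 1)) (Fin (m + 1)) ℝ :=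
  Matrix.of fun i j =>
    (∏ l, (Real.exp (2 * x i) - Real.exp (2 * x (i.succAbove l))))⁻¹ *
      ((Fin.cases (motive := fun _ => ℝ) 1 (fun j => -(c 0 * (2 * Real.exp (2 * c j.succ)))) j) *
      Fin.cases (motive := fun _ => ℝ) (∏ l : Fin m, (Real.exp (2 * x i) - Real.exp (2 * c l.succ)))
        (fun j => ∏ l ∈ univ.erase j, (Real.exp (2 * x i) - Real.exp (2 * c l.succ))) j)

theorem hasFDerivAt_chart (x c : Fin (m + 1) → ℝ) :
    HasFDerivAt (chart x) (LinearMap.toContinuousLinearMap (Matrix.toLin' (chartJac x c))) c := by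
  rw [hasFDerivAt_pi']
  intro i
  have h0 : HasFDerivAt (fun c : Fin (m + 1) → ℝ => c 0)
      (ContinuousLinearMap.proj (R := ℝ) (φ := fun _ : Fin (m + 1) => ℝ) 0) c :=
    (ContinuousLinearMap.proj (R := ℝ) (φ := fun _ : Fin (m + 1) => ℝ) 0).hasFDerivAt
  have h1 : ∀ j ∈ (univ : Finset (Fin m)), HasFDerivAt (fun c : Fin (m + 1) → ℝ =>
      Real.exp (2 * x i) - Real.exp (2 * c j.succ))
      (-(2 * Real.exp (2 * c j.succ)) • ContinuousLinearMap.proj (R := ℝ)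
        (φ := fun _ : Fin (m + 1) => ℝ) j.succ) c := by
    intro j _
    have hp := (ContinuousLinearMap.proj (R := ℝ) (φ := fun _ : Fin (m + 1) => ℝ) j.succ).hasFDerivAt
      (x := c)
    have h := ((hp.const_mul 2).exp).const_sub (Real.exp (2 * x i))
    refine h.congr_fderiv ?_
    ext v
    simp
    ring
  have h2 := (h0.mul (HasFDerivAt.finsetProd h1)).const_mul
    (∏ l, (Real.exp (2 * x i) - Real.exp (2 * x (i.succAbove l))))⁻¹
  refine (h2.congr_fderiv ?_).congr_of_eventuallyEq (Filter.Eventually.of_forall fun c => ?_)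
  · ext v
    simp [chartJac, Matrix.mulVec, dotProduct, Fin.sum_univ_succ, mul_sum]
    rw [add_comm]
    congr 1
    · ring
    · rw [neg_inj]
      exact sum_congr rfl fun _ _ => by ring
  · simp only [chart, weight, prod_div_distrib, Pi.mul_apply]
    ring

/-- Rows carry the denominators of the weights, columns the derivatives of e^{2c_j} and the mass c
0. The remaining matrix has determinant ±V(a)V(b), and the row factors contribute V(a)⁻² in absolute
value, which leaves V(b)/V(a). -/
theorem abs_det_chartJac {x : Fin (m + 1) → ℝ} (hx : StrictAnti x) {c : Fin (m + 1) → ℝ}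
    (hc : c ∈ chartBox x) :
    |(chartJac x c).det| = c 0 ^ m * (∏ j : Fin m, (2 * Real.exp (2 * c j.succ))) *
      |(Matrix.vandermonde fun j : Fin m => Real.exp (2 * c j.succ)).det| /
      |(Matrix.vandermonde fun i => Real.exp (2 * x i)).det| := by
  have hb := (Interlaces.strictAnti (strictAnti_exp hx) (interlaces_of_mem hc)).injective
  have hV : |(Matrix.vandermonde fun i => Real.exp (2 * x i)).det| ≠ 0 :=
    abs_ne_zero.mpr (Matrix.det_vandermonde_ne_zero_iff.mpr (strictAnti_exp hx).injective)
  set v : Fin (m + 1) → ℝ := fun i =>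
    (∏ l, (Real.exp (2 * x i) - Real.exp (2 * x (i.succAbove l))))⁻¹ with hv
  set w : Fin (m + 1) → ℝ := fun j => Fin.cases (motive := fun _ => ℝ) 1
    (fun j => -(c 0 * (2 * Real.exp (2 * c j.succ)))) j with hw
  set A : Matrix (Fin (m + 1)) (Fin (m + 1)) ℝ := Matrix.of fun i j =>
    Fin.cases (motive := fun _ => ℝ) (∏ l : Fin m, (Real.exp (2 * x i) - Real.exp (2 * c l.succ)))
      (fun j => ∏ l ∈ univ.erase j, (Real.exp (2 * x i) - Real.exp (2 * c l.succ))) j with hA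
  have hfac : (chartJac x c).det = (∏ i, v i) * ((∏ j, w j) * A.det) :=
    (Matrix.det_mul_column v (Matrix.of fun i j => w j * A i j)).trans
      (congrArg _ (Matrix.det_mul_row w A))
  rw [hfac, abs_mul, abs_mul, hA,
    abs_det_prod_matrix _ hb, hv, prod_inv_distrib, abs_inv,
    abs_prod_succAbove fun i => Real.exp (2 * x i), Fin.prod_univ_succ]
  simp only [hw]
  simp only [Fin.cases_zero, Fin.cases_succ, one_mul]
  have h2 : |∏ j : Fin m, -(c 0 * (2 * Real.exp (2 * c j.succ)))|
      = c 0 ^ m * ∏ j : Fin m, (2 * Real.exp (2 * c j.succ)) := by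
    rw [abs_prod]
    simp only [abs_neg]
    rw [prod_congr rfl fun j _ => abs_of_pos (mul_pos (mem_chartBox.mp hc).1
      (mul_pos two_pos (Real.exp_pos (2 * c (Fin.succ j))))), prod_mul_distrib]
    simp
  rw [h2]
  field_simp

end Interlacing

end SphericalGL
namespace SphericalGL

open Finset MeasureTheory

/-! ### Integration over the interlacing box. -/

section BoxIntegral

variable {m : ℕ}

/-- The product of `2 sinh (y i - y j)` over `i < j`. -/
noncomputable def sinhProd {N : ℕ} (y : Fin N → ℝ) : ℝ :=
  ∏ i, ∏ j ∈ Ioi i, 2 * Real.sinh (y i - y j)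

theorem sinhProd_pos {N : ℕ} {y : Fin N → ℝ} (hy : StrictAnti y) : 0 < sinhProd y :=
  prod_pos fun _ _ => prod_pos fun _ hj =>
    mul_pos two_pos (Real.sinh_pos_iff.mpr (sub_pos.mpr (hy (mem_Ioi.mp hj))))

theorem sum_sum_Ioi_add {N : ℕ} (y : Fin N → ℝ) :
    ∑ i, ∑ j ∈ Ioi i, (y i + y j) = ((N : ℝ) - 1) * ∑ i, y i := by
  have h := sum_sum_Ioi_add_eq_sum_sum_off_diag (fun _ i : Fin N => y i)
  rw [h, mul_sum]
  refine sum_congr rfl fun i _ => ?_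
  rw [sum_const, card_compl, card_singleton, Fintype.card_fin, nsmul_eq_mul,
    Nat.cast_sub (by have := i.2; omega)]
  simp

/-- Each factor is e^{2s} − e^{2t} = 2 sinh(s − t) e^{s+t}, and every y_i occurs in N − 1 pairs. -/
theorem abs_vandermonde_exp {N : ℕ} {y : Fin N → ℝ} (hy : StrictAnti y) :
    |(Matrix.vandermonde fun j => Real.exp (2 * y j)).det|
      = sinhProd y * Real.exp (((N : ℝ) - 1) * ∑ i, y i) := by
  rw [← sum_sum_Ioi_add, Matrix.det_vandermonde, Real.exp_sum, sinhProd, ← prod_mul_distrib, abs_prod]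
  refine prod_congr rfl fun i _ => ?_
  rw [Real.exp_sum, ← prod_mul_distrib, abs_prod]
  refine prod_congr rfl fun j hj => ?_
  have h : y j < y i := hy (mem_Ioi.mp hj)
  rw [abs_of_neg (sub_neg.mpr (Real.exp_lt_exp.mpr (by linarith))), Real.sinh_eq]
  have h1 : Real.exp (2 * y j) = Real.exp (-(y i - y j)) * Real.exp (y i + y j) := by
    rw [← Real.exp_add]; ring_nf
  have h2 : Real.exp (2 * y i) = Real.exp (y i - y j) * Real.exp (y i + y j) := by
    rw [← Real.exp_add]; ring_nf
  rw [h1, h2]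
  ring

/-- Change of variables along the interlacing chart. The coordinate `c 0` is the total mass, and
dividing by it leaves the weights. -/
theorem integral_positive_orthant {x : Fin (m + 1) → ℝ} (hx : StrictAnti x)
    (f : (Fin (m + 1) → ℝ) → ℂ) :
    ∫ u in {u : Fin (m + 1) → ℝ | ∀ i, 0 < u i},
        Real.exp (-∑ i, u i) • f (fun i => u i / ∑ l, u l)
      = ∫ c in chartBox x, (|(chartJac x c).det| * Real.exp (-c 0)) •
          f (weight (fun i => Real.exp (2 * x i)) fun j => Real.exp (2 * c j.succ)) := by
  rw [← image_chart hx, integral_image_eq_integral_abs_det_fderiv_smul volume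
    (measurableSet_chartBox x) (fun c _ => (hasFDerivAt_chart x c).hasFDerivWithinAt)
    (injOn_chart hx)]
  refine setIntegral_congr_fun (measurableSet_chartBox x) fun c hc => ?_
  have hdet : (LinearMap.toContinuousLinearMap (Matrix.toLin' (chartJac x c))).det
      = (chartJac x c).det := by
    rw [ContinuousLinearMap.det, LinearMap.coe_toContinuousLinearMap, LinearMap.det_toLin']
  simp only [sum_chart hx, hdet, smul_smul]
  congr 2
  ext i
  rw [chart, mul_div_cancel_left₀ _ (mem_chartBox.mp hc).1.ne']

/-- Integration over a box of a determinant whose rows depend on one variable each. -/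
theorem integral_chartBox_det (x : Fin (m + 1) → ℝ) (ν : Fin m → ℂ) :
    ∫ c in chartBox x, ((c 0 ^ m * Real.exp (-c 0) : ℝ) : ℂ) *
        (Matrix.of fun i j : Fin m => Complex.exp (ν j * (c i.succ : ℝ))).det
      = (m.factorial : ℂ) * (Matrix.of fun i j : Fin m =>
          ∫ y in Set.Ioo (x i.succ) (x i.castSucc), Complex.exp (ν j * (y : ℝ))).det := by
  set F : Equiv.Perm (Fin m) → (i : Fin (m + 1)) → ℝ → ℂ := fun σ i =>
    Fin.cases (motive := fun _ => ℝ → ℂ) (fun r => ((r ^ m * Real.exp (-r) : ℝ) : ℂ))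
      (fun i y => Complex.exp (ν (σ i) * (y : ℝ))) i with hF
  set s : Fin (m + 1) → Set ℝ := fun i => Fin.cases (motive := fun _ => Set ℝ) (Set.Ioi 0)
    (fun j => Set.Ioo (x j.succ) (x j.castSucc)) i with hs
  have hrestr : (volume : Measure (Fin (m + 1) → ℝ)).restrict (chartBox x)
      = Measure.pi fun i => (volume : Measure ℝ).restrict (s i) := by
    rw [volume_pi, chartBox, Measure.restrict_pi_pi]
  have hgam : IntegrableOn (fun r : ℝ => r ^ m * Real.exp (-r)) (Set.Ioi 0) := by
    have := Real.GammaIntegral_convergent (s := m + 1) (by positivity)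
    refine this.congr_fun (fun r hr => ?_) measurableSet_Ioi
    simp only [add_sub_cancel_right, Real.rpow_natCast]
    ring
  have hint : ∀ σ i, Integrable (F σ i) ((volume : Measure ℝ).restrict (s i)) := by
    intro σ i
    refine Fin.cases ?_ (fun i => ?_) i
    · exact hgam.ofReal
    · have hc : Continuous fun y : ℝ => Complex.exp (ν (σ i) * (y : ℝ)) := by fun_prop
      exact (hc.integrableOn_Icc (a := x i.succ) (b := x i.castSucc)).mono_set Set.Ioo_subset_Icc_self
  have hexp : ∀ c : Fin (m + 1) → ℝ, ((c 0 ^ m * Real.exp (-c 0) : ℝ) : ℂ) *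
        (Matrix.of fun i j : Fin m => Complex.exp (ν j * (c i.succ : ℝ))).det
      = ∑ σ : Equiv.Perm (Fin m), ((Equiv.Perm.sign σ : ℤ) : ℂ) * ∏ i, F σ i (c i) := by
    intro c
    rw [← Matrix.det_transpose, Matrix.det_apply', mul_sum]
    refine sum_congr rfl fun σ _ => ?_
    rw [Fin.prod_univ_succ]
    simp only [hF, Fin.cases_zero, Fin.cases_succ, Matrix.transpose_apply, Matrix.of_apply]
    ring
  simp only [hexp]
  rw [hrestr, integral_finsetSum _ fun σ _ => (Integrable.fintype_prod (hint σ)).const_mul _,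
    ← Matrix.det_transpose, Matrix.det_apply', mul_sum]
  refine sum_congr rfl fun σ _ => ?_
  rw [integral_const_mul, integral_fintype_prod_eq_prod, Fin.prod_univ_succ]
  have h0 : ∫ r in Set.Ioi (0 : ℝ), ((r ^ m * Real.exp (-r) : ℝ) : ℂ) = (m.factorial : ℂ) := by
    rw [integral_complex_ofReal, ← Complex.ofReal_natCast, ← Real.Gamma_nat_eq_factorial,
      Real.Gamma_eq_integral (by positivity)]
    congr 1
    refine setIntegral_congr_fun measurableSet_Ioi fun r _ => ?_
    simp only [add_sub_cancel_right, Real.rpow_natCast]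
    ring
  simp only [hF, hs, Fin.cases_zero, Fin.cases_succ, Matrix.transpose_apply, Matrix.of_apply, h0]
  ring

/-- Multiplying by −ν instead of dividing keeps the identity valid at ν = 0, so no genericity of the
parameter is needed later. -/
theorem mul_integral_exp {a b : ℝ} (hab : a ≤ b) (ν : ℂ) :
    -ν * ∫ y in Set.Ioo a b, Complex.exp (ν * (y : ℝ))
      = Complex.exp (ν * a) - Complex.exp (ν * b) := by
  rw [← integral_Ioc_eq_integral_Ioo, ← intervalIntegral.integral_of_le hab]
  by_cases h : ν = 0
  · simp [h]
  · rw [integral_exp_mul_complex h]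
    field_simp
    ring

/-- Subtract from each row its predecessor; the column of ones becomes the first unit vector, and
one expands along it. -/
theorem det_sub_pred_rows (E : Fin (m + 1) → Fin (m + 1) → ℂ) (h : ∀ i, E i 0 = 1) :
    (Matrix.of fun i j : Fin m => E i.succ j.succ - E i.castSucc j.succ).det
      = (Matrix.of E).det := by
  set A : Matrix (Fin (m + 1)) (Fin (m + 1)) ℂ := Matrix.of fun i => Fin.cases
    (motive := fun _ => Fin (m + 1) → ℂ) (E 0) (fun i j => E i.succ j - E i.castSucc j) i with hA
  have h1 : (Matrix.of E).det = A.det := by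
    refine Matrix.det_eq_of_forall_row_eq_smul_add_pred (fun _ => 1) ?_ ?_
    · intro j; simp [hA]
    · intro i j; simp [hA]
  rw [h1, Matrix.det_succ_column_zero, Finset.sum_eq_single 0]
  · simp only [hA, Matrix.of_apply, Fin.cases_zero, h, Fin.val_zero, pow_zero, one_mul]
    congr 1
  · intro i _ hi
    obtain ⟨j, rfl⟩ := Fin.exists_succ_eq.mpr hi
    simp [hA, h]
  · simp

/-- The integral behind the recursion for spherical functions. -/
theorem mul_integral_chartBox {x : Fin (m + 1) → ℝ} (hx : StrictAnti x) (l : Fin (m + 1) → ℂ) :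
    (∏ j : Fin m, (l 0 - l j.succ)) * ∫ c in chartBox x, (|(chartJac x c).det| * Real.exp (-c 0)) •
        (Complex.exp ((l 0 + m) * ((∑ i, x i - ∑ j : Fin m, c j.succ : ℝ) : ℂ)) *
          ((Matrix.of fun i j : Fin m => Complex.exp ((l j.succ - 1) * (c i.succ : ℝ))).det /
            (sinhProd fun j : Fin m => c j.succ : ℝ)))
      = (m.factorial : ℂ) * 2 ^ m *
          ((Matrix.of fun i j => Complex.exp (l j * (x i : ℝ))).det / (sinhProd x : ℝ)) := by
  -- The Vandermonde determinant of the corner in the Jacobian cancels `sinhProd` of the corner up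
  -- to an exponential, so the integrand becomes a constant times a function of the mass times a
  -- determinant with one variable per row.
  have hpt : ∀ c ∈ chartBox x, (|(chartJac x c).det| * Real.exp (-c 0)) •
        (Complex.exp ((l 0 + m) * ((∑ i, x i - ∑ j : Fin m, c j.succ : ℝ) : ℂ)) *
          ((Matrix.of fun i j : Fin m => Complex.exp ((l j.succ - 1) * (c i.succ : ℝ))).det /
            (sinhProd fun j : Fin m => c j.succ : ℝ)))
      = (2 ^ m * Complex.exp (l 0 * (∑ i, x i : ℝ)) / (sinhProd x : ℝ)) *
        (((c 0 ^ m * Real.exp (-c 0) : ℝ) : ℂ) *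
        (Matrix.of fun i j : Fin m => Complex.exp ((l j.succ - l 0) * (c i.succ : ℝ))).det) := by
    intro c hc
    have hy : StrictAnti fun j : Fin m => c j.succ := by
      intro i j hij
      have h1 := (mem_chartBox.mp hc).2 i
      have h2 := (mem_chartBox.mp hc).2 j
      have h3 : x j.castSucc ≤ x i.succ := hx.antitone (by
        rw [Fin.le_def]; simp only [Fin.val_succ, Fin.val_castSucc]; exact hij)
      simp only
      linarith [h1.1, h2.2]
    have hd1 : (Matrix.of fun i j : Fin m => Complex.exp ((l j.succ - 1) * (c i.succ : ℝ))).det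
        = Complex.exp ((l 0 - 1) * (∑ j : Fin m, c j.succ : ℝ)) * (Matrix.of fun i j : Fin m =>
          Complex.exp ((l j.succ - l 0) * (c i.succ : ℝ))).det := by
      have h := Matrix.det_mul_column (fun i : Fin m => Complex.exp ((l 0 - 1) * (c i.succ : ℝ)))
        (Matrix.of fun i j : Fin m => Complex.exp ((l j.succ - l 0) * (c i.succ : ℝ)))
      rw [← Complex.exp_sum, ← mul_sum, ← Complex.ofReal_sum] at h
      rw [← h]
      congr 1
      ext i j
      simp only [Matrix.of_apply]
      rw [← Complex.exp_add]
      ring_nf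
    have hs0 : ((sinhProd fun j : Fin m => c j.succ : ℝ) : ℂ) ≠ 0 :=
      Complex.ofReal_ne_zero.mpr (sinhProd_pos hy).ne'
    have hs1 : ((sinhProd x : ℝ) : ℂ) ≠ 0 := Complex.ofReal_ne_zero.mpr (sinhProd_pos hx).ne'
    rw [hd1, abs_det_chartJac hx hc, abs_vandermonde_exp hy, abs_vandermonde_exp hx,
      prod_mul_distrib, prod_const, card_univ, Fintype.card_fin, ← Real.exp_sum, ← mul_sum]
    rw [Complex.real_smul]
    set Y := ∑ j : Fin m, c j.succ
    set Z := ∑ i, x i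
    set D := (Matrix.of fun i j : Fin m => Complex.exp ((l j.succ - l 0) * (c i.succ : ℝ))).det
    push_cast
    -- The coefficients of Y add up to 2 + (m − 1) − (l 0 + m) + (l 0 − 1) = 0, so no exponential of
    -- ∑ c_j is left.
    have he : Complex.exp (2 * Y) * Complex.exp ((m - 1) * Y) *
        Complex.exp ((l 0 + m) * (Z - Y)) * Complex.exp ((l 0 - 1) * Y)
        = Complex.exp (l 0 * Z) * Complex.exp (m * Z) := by
      rw [← Complex.exp_add, ← Complex.exp_add, ← Complex.exp_add, ← Complex.exp_add]
      ring_nf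
    have h4 : Complex.exp ((m + 1 - 1) * (Z : ℂ)) = Complex.exp (m * (Z : ℂ)) := by ring_nf
    have h3 := Complex.exp_ne_zero (m * (Z : ℂ))
    rw [h4]
    generalize Complex.exp (2 * Y) = e1 at he ⊢
    generalize Complex.exp ((m - 1) * Y) = e2 at he ⊢
    generalize Complex.exp ((l 0 + m) * (Z - Y)) = e3 at he ⊢
    generalize Complex.exp ((l 0 - 1) * Y) = e4 at he ⊢
    generalize Complex.exp (l 0 * Z) = e5 at he ⊢
    generalize Complex.exp (m * Z) = e6 at he h3 ⊢
    field_simp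
    linear_combination ((c 0 : ℂ) ^ m * D) * he
  rw [setIntegral_congr_fun (measurableSet_chartBox x) hpt, integral_const_mul,
    integral_chartBox_det]
  -- The factors l 0 − l_j go into the columns and turn the entries into differences of exponentials
  -- at consecutive x_i. The shift by l 0 makes column 0 consist of ones, as the row operations
  -- require.
  have hd : (∏ j : Fin m, (l 0 - l j.succ)) * (Matrix.of fun i j : Fin m =>
      ∫ y in Set.Ioo (x i.succ) (x i.castSucc), Complex.exp ((l j.succ - l 0) * (y : ℝ))).det
      = (Matrix.of fun i j => Complex.exp ((l j - l 0) * (x i : ℝ))).det := by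
    refine (Matrix.det_mul_row (fun j : Fin m => l 0 - l j.succ) _).symm.trans ?_
    rw [← det_sub_pred_rows (fun i j => Complex.exp ((l j - l 0) * (x i : ℝ))) (by simp)]
    congr 1
    ext i j
    simp only [Matrix.of_apply]
    rw [← mul_integral_exp (hx i.castSucc_lt_succ).le]
    ring
  have hd2 : Complex.exp (l 0 * (∑ i, x i : ℝ)) *
      (Matrix.of fun i j => Complex.exp ((l j - l 0) * (x i : ℝ))).det
      = (Matrix.of fun i j => Complex.exp (l j * (x i : ℝ))).det := by
    rw [Complex.ofReal_sum, mul_sum, Complex.exp_sum]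
    refine (Matrix.det_mul_column (fun i => Complex.exp (l 0 * (x i : ℝ))) _).symm.trans ?_
    congr 1
    ext i j
    simp only [Matrix.of_apply]
    rw [← Complex.exp_add]
    ring_nf
  rw [← hd2, ← hd]
  ring

end BoxIntegral

end SphericalGL
namespace SphericalGL

open MeasureTheory
open scoped ENNReal Matrix

/-! ### Distribution of the squared moduli of a random unitary row. -/

section GaussianLaw

variable {q : ℕ}

/-- A disc of squared radius b has area πb, and the rays below b form a generating π-system. -/
theorem map_normSq_volume :
    (volume : Measure ℂ).map Complex.normSq = ENNReal.ofReal Real.pi • volume.restrict (Set.Ioi 0) := by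
  have hm : Measurable (Complex.normSq : ℂ → ℝ) := Complex.continuous_normSq.measurable
  have hball : ∀ b : ℝ, volume {z : ℂ | Complex.normSq z < b} = ENNReal.ofReal (Real.pi * max b 0) := by
    intro b
    rcases le_or_gt b 0 with hb | hb
    · have : {z : ℂ | Complex.normSq z < b} = ∅ := by
        ext z
        simp only [Set.mem_ofPred_eq, Set.mem_empty_iff_false, iff_false, not_lt]
        exact hb.trans (Complex.normSq_nonneg z)
      simp [this, hb]
    · have : {z : ℂ | Complex.normSq z < b} = Metric.ball 0 (Real.sqrt b) := by
        ext z
        rw [mem_ball_zero_iff, Set.mem_ofPred_eq, Complex.normSq_eq_norm_sq,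
          Real.lt_sqrt (norm_nonneg _)]
      rw [this, Complex.volume_ball, ← ENNReal.ofReal_pow (Real.sqrt_nonneg _), Real.sq_sqrt hb.le,
        max_eq_left hb.le, mul_comm Real.pi, ENNReal.ofReal_mul hb.le]
      congr 1
      rw [ENNReal.ofReal, Real.toNNReal_of_nonneg Real.pi_pos.le]
      rfl
  have hfin : ∀ b : ℝ, ENNReal.ofReal (Real.pi * max b 0) ≠ ⊤ := fun b => ENNReal.ofReal_ne_top
  have hIio : ∀ b : ℝ, (volume : Measure ℂ).map Complex.normSq (Set.Iio b)
      = ENNReal.ofReal (Real.pi * max b 0) := by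
    intro b
    rw [Measure.map_apply hm measurableSet_Iio]
    exact hball b
  have hIio' : ∀ b : ℝ, (ENNReal.ofReal Real.pi • volume.restrict (Set.Ioi 0)) (Set.Iio b)
      = ENNReal.ofReal (Real.pi * max b 0) := by
    intro b
    rw [Measure.smul_apply, Measure.restrict_apply measurableSet_Iio, Set.inter_comm,
      Set.Ioi_inter_Iio, Real.volume_Ioo, smul_eq_mul, ← ENNReal.ofReal_mul Real.pi_pos.le, sub_zero]
    rcases le_or_gt b 0 with hb | hb
    · rw [max_eq_right hb, mul_zero, ENNReal.ofReal_zero,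
        ENNReal.ofReal_of_nonpos (mul_nonpos_of_nonneg_of_nonpos Real.pi_pos.le hb)]
    · rw [max_eq_left hb.le]
  refine Measure.ext_of_generateFrom_of_iUnion (Set.range fun b : ℝ => Set.Iio b)
    (fun k : ℕ => Set.Iio (k : ℝ)) ?_ ?_ ?_ ?_ ?_ ?_
  · exact borel_eq_generateFrom_Iio ℝ ▸ BorelSpace.measurable_eq
  · exact isPiSystem_Iio
  · ext r
    simpa using exists_nat_gt r
  · intro k
    exact ⟨k, rfl⟩
  · intro k
    rw [hIio]
    exact hfin _
  · rintro _ ⟨b, rfl⟩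
    rw [hIio, hIio']

theorem restrict_orthant :
    (volume : Measure (Fin q → ℝ)).restrict {u | ∀ i, 0 < u i}
      = Measure.pi fun _ => (volume : Measure ℝ).restrict (Set.Ioi 0) := by
  have : {u : Fin q → ℝ | ∀ i, 0 < u i} = Set.pi Set.univ fun _ => Set.Ioi 0 := by
    ext u; simp [Set.mem_pi]
  rw [this, volume_pi, Measure.restrict_pi_pi]

theorem lintegral_comp_normSq {f : (Fin q → ℝ) → ℝ≥0∞} (hf : Measurable f) :
    ∫⁻ z : Fin q → ℂ, f (fun i => Complex.normSq (z i))
      = ENNReal.ofReal Real.pi ^ q * ∫⁻ u in {u : Fin q → ℝ | ∀ i, 0 < u i}, f u := by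
  have hm : Measurable (Complex.normSq : ℂ → ℝ) := Complex.continuous_normSq.measurable
  have hmap : (volume : Measure (Fin q → ℂ)).map (fun z i => Complex.normSq (z i))
      = ENNReal.ofReal Real.pi ^ q • volume.restrict {u : Fin q → ℝ | ∀ i, 0 < u i} := by
    have hsf : SigmaFinite ((volume : Measure ℂ).map Complex.normSq) := by
      rw [map_normSq_volume]
      change SigmaFinite (Real.toNNReal Real.pi • (volume : Measure ℝ).restrict (Set.Ioi 0))
      infer_instance
    rw [volume_pi, Measure.pi_map_pi (fun _ => hm.aemeasurable), restrict_orthant]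
    symm
    refine (Measure.pi_eq fun s hs => ?_).symm
    rw [Measure.smul_apply, Measure.pi_pi, map_normSq_volume]
    simp only [Measure.smul_apply, smul_eq_mul, Finset.prod_mul_distrib]
    simp
  rw [← smul_eq_mul, ← lintegral_smul_measure, ← hmap, lintegral_map hf]
  exact measurable_pi_lambda _ fun i => hm.comp (measurable_pi_apply i)

theorem lintegral_exp_neg_sum :
    ∫⁻ u in {u : Fin q → ℝ | ∀ i, 0 < u i}, ENNReal.ofReal (Real.exp (-∑ i, u i)) = 1 := by
  have h1 : Integrable (fun r : ℝ => Real.exp (-r)) (volume.restrict (Set.Ioi 0)) :=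
    integrableOn_exp_neg_Ioi 0
  have hprod : (fun u : Fin q → ℝ => Real.exp (-∑ i, u i)) = fun u => ∏ i, Real.exp (-(u i)) := by
    ext u
    rw [← Finset.sum_neg_distrib, Real.exp_sum]
  simp only [funext_iff] at hprod
  simp only [hprod]
  rw [restrict_orthant, ← ofReal_integral_eq_lintegral_ofReal
    (Integrable.fintype_prod (f := fun _ r => Real.exp (-r)) fun _ => h1)
    (Filter.Eventually.of_forall fun u => Finset.prod_nonneg fun i _ => (Real.exp_pos _).le),
    integral_fintype_prod_eq_prod (fun _ r => Real.exp (-r))]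
  rw [integral_exp_neg_Ioi]
  simp

theorem sum_normSq_vecMul {U : Matrix (Fin q) (Fin q) ℂ} (hU : U ∈ Matrix.unitaryGroup (Fin q) ℂ)
    (z : Fin q → ℂ) : ∑ i, Complex.normSq ((z ᵥ* U) i) = ∑ i, Complex.normSq (z i) := by
  have h : ∀ w : Fin q → ℂ, ((∑ i, Complex.normSq (w i) : ℝ) : ℂ) = w ⬝ᵥ star w := by
    intro w
    simp [dotProduct, Complex.mul_conj]
  have hU' : U * Uᴴ = 1 := Matrix.mem_unitaryGroup_iff.mp hU
  apply Complex.ofReal_injective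
  rw [h, h, Matrix.star_vecMul, Matrix.dotProduct_mulVec, Matrix.vecMul_vecMul, hU',
    Matrix.vecMul_one]

/-- As a real linear map, right multiplication by U has determinant |det U|² = 1, so Lebesgue
measure is preserved. -/
theorem lintegral_comp_vecMul_unitary {U : Matrix (Fin q) (Fin q) ℂ}
    (hU : U ∈ Matrix.unitaryGroup (Fin q) ℂ) (f : (Fin q → ℂ) → ℝ≥0∞) (hf : Measurable f) :
    ∫⁻ z, f (z ᵥ* U) = ∫⁻ z, f z := by
  have hdetU : ‖U.det‖ = 1 := by
    have h := congrArg Matrix.det (Matrix.mem_unitaryGroup_iff.mp hU)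
    rw [Matrix.det_mul, Matrix.star_eq_conjTranspose, Matrix.det_conjTranspose, Matrix.det_one] at h
    have h2 := congrArg norm h
    rw [norm_mul, norm_star, norm_one] at h2
    nlinarith [norm_nonneg U.det]
  set T : (Fin q → ℂ) →ₗ[ℝ] (Fin q → ℂ) := (Matrix.toLin' Uᵀ).restrictScalars ℝ with hT
  have hdet : LinearMap.det T = 1 := by
    rw [hT, LinearMap.det_restrictScalars, LinearMap.det_toLin', Matrix.det_transpose]
    rw [Algebra.norm_complex_eq]
    simp [Complex.normSq_eq_norm_sq, hdetU]
  have hTz : ∀ z, T z = z ᵥ* U := fun z => by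
    simp [hT, Matrix.mulVec_transpose]
  have hmp : (volume : Measure (Fin q → ℂ)).map T = volume := by
    rw [Measure.map_linearMap_addHaar_eq_smul_addHaar _ (by rw [hdet]; exact one_ne_zero), hdet]
    simp
  have hTm : Measurable T := (LinearMap.continuous_of_finiteDimensional T).measurable
  calc ∫⁻ z, f (z ᵥ* U) = ∫⁻ z, f (T z) := by simp only [hTz]
    _ = ∫⁻ z, f z := by rw [← lintegral_map hf hTm, hmp]

/-- A row of a random matrix in a group that acts transitively on the unit sphere has squared
moduli uniformly distributed on the simplex. -/
theorem lintegral_row_normSq {G : Type*} [Group G] [TopologicalSpace G] [IsTopologicalGroup G]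
    [MeasurableSpace G] [BorelSpace G] (μ : Measure G) [IsProbabilityMeasure μ]
    [μ.IsMulLeftInvariant] (V : G → Matrix (Fin (q + 1)) (Fin (q + 1)) ℂ) (hVc : Continuous V)
    (hVm : ∀ a b, V (a * b) = V a * V b) (hVu : ∀ a, V a ∈ Matrix.unitaryGroup (Fin (q + 1)) ℂ)
    (hVt : ∀ v : Fin (q + 1) → ℂ, ∑ i, Complex.normSq (v i) = 1 → ∃ a, ∀ i, V a 0 i = v i)
    {g : (Fin (q + 1) → ℝ) → ℝ≥0∞} (hg : Measurable g) :
    ∫⁻ a, g (fun i => Complex.normSq (V a 0 i)) ∂μ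
      = ∫⁻ u in {u : Fin (q + 1) → ℝ | ∀ i, 0 < u i},
          g (fun i => u i / ∑ l, u l) * ENNReal.ofReal (Real.exp (-∑ i, u i)) := by
  set E : (Fin (q + 1) → ℝ) → ℝ≥0∞ := fun u => ENNReal.ofReal (Real.exp (-∑ i, u i)) with hE
  set P : (Fin (q + 1) → ℝ) → ℝ≥0∞ := fun u => g (fun i => u i / ∑ l, u l) * E u with hP
  set N : (Fin (q + 1) → ℂ) → (Fin (q + 1) → ℝ) := fun z i => Complex.normSq (z i) with hN
  have hEm : Measurable E := by fun_prop
  have hPm : Measurable P := (hg.comp (by fun_prop)).mul hEm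
  have hNm : Measurable N := measurable_pi_lambda _ fun i =>
    Complex.continuous_normSq.measurable.comp (measurable_pi_apply i)
  set R : G → (Fin (q + 1) → ℝ) := fun a i => Complex.normSq (V a 0 i) with hR
  have hRc : Continuous R := by
    refine continuous_pi fun i => Complex.continuous_normSq.comp ?_
    exact hVc.matrix_elem 0 i
  set I := ∫⁻ a, g (R a) ∂μ with hI
  -- By transitivity z/|z| is the first row of some V(a₀), so z V(a) is |z| times the first row of
  -- V(a₀a). Left invariance removes a₀, while |z V(a)| = |z| keeps the Gaussian factor.
  have hinner : ∀ z : Fin (q + 1) → ℂ, z ≠ 0 → ∫⁻ a, P (N (z ᵥ* V a)) ∂μ = I * E (N z) := by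
    intro z hz
    have hpos : 0 < ∑ i, N z i := by
      obtain ⟨i, hi⟩ := Function.ne_iff.mp hz
      exact Finset.sum_pos' (fun i _ => Complex.normSq_nonneg _)
        ⟨i, Finset.mem_univ i, Complex.normSq_pos.mpr hi⟩
    set r := Real.sqrt (∑ i, N z i) with hr
    have hr0 : 0 < r := Real.sqrt_pos.mpr hpos
    have hrr : r * r = ∑ i, N z i := Real.mul_self_sqrt hpos.le
    obtain ⟨a₀, ha₀⟩ := hVt (fun i => (r : ℂ)⁻¹ * z i) (by
      simp only [Complex.normSq_mul, ← Finset.mul_sum, Complex.normSq_inv, Complex.normSq_ofReal, hrr]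
      exact inv_mul_cancel₀ hpos.ne')
    have hrow : ∀ a, N (z ᵥ* V a) = fun i => r * r * R (a₀ * a) i := by
      intro a
      ext i
      have h1 : (z ᵥ* V a) i = r * V (a₀ * a) 0 i := by
        rw [hVm, Matrix.mul_apply, Matrix.vecMul, dotProduct, Finset.mul_sum]
        refine Finset.sum_congr rfl fun l _ => ?_
        rw [ha₀, ← mul_assoc, ← mul_assoc, mul_inv_cancel₀ (Complex.ofReal_ne_zero.mpr hr0.ne'),
          one_mul]
      simp only [hN, hR]
      rw [h1, Complex.normSq_mul, Complex.normSq_ofReal]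
    have hPa : ∀ a, P (N (z ᵥ* V a)) = g (R (a₀ * a)) * E (N z) := by
      intro a
      have h1 : ∑ i, N (z ᵥ* V a) i = ∑ i, N z i := sum_normSq_vecMul (hVu a) z
      simp only [hP, hE, h1]
      congr 2
      ext i
      rw [hrow a, ← hrr]
      field_simp
    simp only [hPa]
    have hRm : Measurable fun a => g (R (a₀ * a)) :=
      hg.comp (hRc.comp (continuous_const_mul a₀)).measurable
    rw [lintegral_mul_const _ hRm,
      lintegral_mul_left_eq_self (fun a => g (R a)) a₀]
  have hjoint : Measurable fun p : (Fin (q + 1) → ℂ) × G => P (N (p.1 ᵥ* V p.2)) :=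
    hPm.comp (hNm.comp (Continuous.measurable (by fun_prop)))
  -- The double integral over z and a is evaluated twice: for fixed a by unitary invariance of
  -- Lebesgue measure, for fixed z by invariance of μ. The null point z = 0 is discarded.
  have hswap : ∫⁻ z, P (N z) = ∫⁻ z : Fin (q + 1) → ℂ, I * E (N z) := by
    calc ∫⁻ z, P (N z) = ∫⁻ a, ∫⁻ z : Fin (q + 1) → ℂ, P (N (z ᵥ* V a)) ∂volume ∂μ := by
          simp only [lintegral_comp_vecMul_unitary (hVu _) (fun z => P (N z)) (hPm.comp hNm)]
          simp
      _ = ∫⁻ z : Fin (q + 1) → ℂ, ∫⁻ a, P (N (z ᵥ* V a)) ∂μ := by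
          rw [lintegral_lintegral_swap]
          exact (hjoint.comp measurable_swap).aemeasurable
      _ = _ := by
          refine lintegral_congr_ae ?_
          filter_upwards [compl_mem_ae_iff.mpr (measure_singleton (0 : Fin (q + 1) → ℂ))] with z hz
          exact hinner z hz
  have hENm : Measurable fun z => E (N z) := hEm.comp hNm
  rw [lintegral_const_mul _ hENm, lintegral_comp_normSq hPm, lintegral_comp_normSq hEm,
    lintegral_exp_neg_sum, mul_one, mul_comm I] at hswap
  have hc0 : ENNReal.ofReal Real.pi ^ (q + 1) ≠ 0 :=
    pow_ne_zero _ (ENNReal.ofReal_pos.mpr Real.pi_pos).ne'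
  have hct : ENNReal.ofReal Real.pi ^ (q + 1) ≠ ⊤ := ENNReal.pow_ne_top ENNReal.ofReal_ne_top
  exact ((ENNReal.mul_right_inj hc0 hct).mp hswap).symm

end GaussianLaw

end SphericalGL
namespace SphericalGL

open Matrix
open scoped ComplexOrder

variable {n : ℕ}

/-! ### Lower right minors and the Iwasawa projection -/

/-- The lower right corner of a matrix, on the indices `i ≥ j`. -/
def low (j : ℕ) (M : Matrix (Fin n) (Fin n) ℂ) :
    Matrix {i : Fin n // j ≤ (i : ℕ)} {i : Fin n // j ≤ (i : ℕ)} ℂ :=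
  M.submatrix Subtype.val Subtype.val

theorem low_mul_of_left {j : ℕ} {A M : Matrix (Fin n) (Fin n) ℂ}
    (hA : ∀ i x : Fin n, j ≤ (i : ℕ) → (x : ℕ) < j → A i x = 0) :
    low j (A * M) = low j A * low j M := by
  ext i l
  simp only [low, submatrix_apply, mul_apply]
  have h := Finset.sum_subtype (p := fun x : Fin n => j ≤ (x : ℕ))
    (Finset.univ.filter fun x : Fin n => j ≤ (x : ℕ)) (by simp)
    (F := inferInstance) (fun x => A i x * M x l)
  refine Eq.trans ?_ h
  rw [Finset.sum_filter]
  refine Finset.sum_congr rfl fun x _ => ?_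
  split_ifs with h
  · rfl
  · rw [hA i x i.2 (by omega), zero_mul]

theorem low_mul_of_right {j : ℕ} {M B : Matrix (Fin n) (Fin n) ℂ}
    (hB : ∀ x l : Fin n, (x : ℕ) < j → j ≤ (l : ℕ) → B x l = 0) :
    low j (M * B) = low j M * low j B := by
  have h := low_mul_of_left (j := j) (A := Bᵀ) (M := Mᵀ) fun i x hi hx => hB x i hx hi
  rw [← transpose_mul] at h
  exact transpose_injective (by rw [transpose_mul]; exact h)

theorem low_conj {j : ℕ} {A M : Matrix (Fin n) (Fin n) ℂ}
    (hA : ∀ i x : Fin n, j ≤ (i : ℕ) → (x : ℕ) < j → A i x = 0) :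
    low j (A * M * Aᴴ) = low j A * low j M * (low j A)ᴴ := by
  rw [low_mul_of_right, low_mul_of_left hA]
  · rfl
  · intro x l hx hl
    rw [conjTranspose_apply, hA l x hl hx, star_zero]

theorem det_low_unipotent (j : ℕ) {u : Matrix (Fin n) (Fin n) ℂ} (h1 : ∀ i, u i i = 1)
    (h2 : ∀ i j, j < i → u i j = 0) : (low j u).det = 1 := by
  rw [det_of_isUpperTriangular]
  · simp [low, h1]
  · intro i l hl
    exact h2 _ _ hl

theorem det_low_expDiag (j : ℕ) (X : Fin n → ℂ) :
    (low j (expDiag X)).det = Complex.exp (∑ i : {i : Fin n // j ≤ (i : ℕ)}, X i) := by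
  have : low j (expDiag X) =
      diagonal fun i : {i : Fin n // j ≤ (i : ℕ)} => Complex.exp (X i) := by
    ext i l
    simp [low, expDiag, diagonal_apply, Subtype.ext_iff]
  rw [this, det_diagonal, Complex.exp_sum]

theorem expDiag_add (X Y : Fin n → ℂ) : expDiag (X + Y) = expDiag X * expDiag Y := by
  simp [expDiag, Complex.exp_add]

theorem expDiag_conjTranspose (X : Fin n → ℝ) :
    (expDiag fun i => (X i : ℂ))ᴴ = expDiag fun i => (X i : ℂ) := by
  simp only [expDiag, diagonal_conjTranspose]
  congr 1
  ext i
  simp [← Complex.ofReal_exp]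

/-- The determinant of the lower right corner of `g gᴴ`. -/
def lowMinor (j : ℕ) (g : Matrix (Fin n) (Fin n) ℂ) : ℂ := (low j (g * gᴴ)).det

/-- The unitary factor drops out of g g* = u e^{2X} u*, and passing to a lower right corner is
compatible with the unipotent u, whose corners have determinant 1. -/
theorem IsIwasawa.lowMinor_eq {g : Matrix (Fin n) (Fin n) ℂ} {X : Fin n → ℝ} (h : IsIwasawa g X)
    (j : ℕ) : lowMinor j g = Complex.exp (∑ i : {i : Fin n // j ≤ (i : ℕ)}, ((2 * X i : ℝ) : ℂ)) := by
  obtain ⟨u, k, h1, h2, hk, rfl⟩ := h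
  have hk' : k * kᴴ = 1 := mem_unitaryGroup_iff.mp hk
  have : u * expDiag (fun i => (X i : ℂ)) * k * (u * expDiag (fun i => (X i : ℂ)) * k)ᴴ
      = u * expDiag (fun i => ((2 * X i : ℝ) : ℂ)) * uᴴ := by
    have h3 : (fun i => ((2 * X i : ℝ) : ℂ)) = (fun i => (X i : ℂ)) + fun i => (X i : ℂ) := by
      ext i; simp; ring
    rw [h3, expDiag_add]
    simp only [conjTranspose_mul, expDiag_conjTranspose, Matrix.mul_assoc]
    rw [← Matrix.mul_assoc k, hk', Matrix.one_mul]
  rw [lowMinor, this, low_conj, det_mul, det_mul, det_conjTranspose, det_low_unipotent j h1 h2,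
    det_low_expDiag]
  · simp
  · intro i x hi hx
    exact h2 i x (by rw [Fin.lt_def]; omega)

/-- The formula for the Iwasawa projection in terms of lower right minors. -/
noncomputable def minorH (g : Matrix (Fin n) (Fin n) ℂ) (i : Fin n) : ℝ :=
  (Real.log ‖lowMinor i g‖ - Real.log ‖lowMinor (i + 1) g‖) / 2

theorem sum_ge_eq (X : Fin n → ℝ) (i : Fin n) :
    ∑ l : {l : Fin n // (i : ℕ) ≤ (l : ℕ)}, X l
      = X i + ∑ l : {l : Fin n // (i : ℕ) + 1 ≤ (l : ℕ)}, X l := by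
  have key : ∀ j : ℕ, ∑ l : {l : Fin n // j ≤ (l : ℕ)}, X l
      = ∑ l ∈ Finset.univ.filter (fun l : Fin n => j ≤ (l : ℕ)), X l := fun j =>
    (Finset.sum_subtype (Finset.univ.filter (fun l : Fin n => j ≤ (l : ℕ))) (by simp) X).symm
  rw [key, key]
  have : Finset.univ.filter (fun l : Fin n => (i : ℕ) ≤ (l : ℕ))
      = insert i (Finset.univ.filter (fun l : Fin n => (i : ℕ) + 1 ≤ (l : ℕ))) := by
    ext l
    simp [Fin.ext_iff]
    omega
  rw [this, Finset.sum_insert (by simp)]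

/-- The logarithm of the minor at j is twice the tail sum of X from j on, so consecutive differences
give X. This also proves uniqueness of the Iwasawa projection. -/
theorem IsIwasawa.eq_minorH {g : Matrix (Fin n) (Fin n) ℂ} {X : Fin n → ℝ} (h : IsIwasawa g X) :
    X = minorH g := by
  ext i
  have e : ∀ j, Real.log ‖lowMinor j g‖ = ∑ l : {l : Fin n // j ≤ (l : ℕ)}, 2 * X l := by
    intro j
    rw [h.lowMinor_eq j, Complex.norm_exp, Real.log_exp, ← Complex.ofReal_sum, Complex.ofReal_re]
  rw [minorH, e, e, sum_ge_eq (fun l => 2 * X l)]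
  ring

/-- Diagonalise the positive definite matrix g g* by a triangular congruence, normalise it to be
unipotent, and take half the logarithms of the resulting diagonal as X. -/
theorem exists_isIwasawa {g : Matrix (Fin n) (Fin n) ℂ} (hg : IsUnit g.det) :
    ∃ X, IsIwasawa g X := by
  have hM : (g * gᴴ).PosDef := by
    refine Matrix.PosDef.mul_conjTranspose_self g ?_
    intro v w hvw
    have := congrArg (fun z => z ᵥ* g⁻¹) hvw
    simpa [vecMul_vecMul, mul_nonsing_inv _ hg] using this
  -- The LDL decomposition is taken for the reversed order of the indices, which makes its lower
  -- triangular factor upper triangular.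
  obtain ⟨L, hLt, hLu, hLd⟩ : ∃ L : Matrix (Fin n) (Fin n) ℂ, (∀ i j, j < i → L i j = 0) ∧
      IsUnit L.det ∧ (L * (g * gᴴ) * Lᴴ).IsDiag := by
    refine ⟨LDL.lowerInv (n := (Fin n)ᵒᵈ) (S := g * gᴴ) hM, ?_, ?_, ?_⟩
    · intro i j hij
      exact LDL.lowerInv_triangular (n := (Fin n)ᵒᵈ) hM (i := i) (j := j) hij
    · have := LDL.invertibleLowerInv (n := (Fin n)ᵒᵈ) (S := g * gᴴ) hM
      exact (isUnit_iff_isUnit_det _).mp (@isUnit_of_invertible _ _ _ this)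
    · have := LDL.diag_eq_lowerInv_conj (n := (Fin n)ᵒᵈ) (S := g * gᴴ) hM
      intro i j hij
      exact (congrFun (congrFun this i) j).symm.trans (diagonal_apply_ne _ hij)
  have hLdet : ∏ i, L i i = L.det := (det_of_isUpperTriangular (fun i j h => hLt i j h)).symm
  have hLii : ∀ i, L i i ≠ 0 := by
    intro i h0
    have h1 : L.det = 0 := hLdet.symm.trans (Finset.prod_eq_zero (Finset.mem_univ i) h0)
    simp [h1] at hLu
  set D : Matrix (Fin n) (Fin n) ℂ := diagonal fun i => (L i i)⁻¹ with hD
  set u := D * L with hu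
  have hut : ∀ i j, j < i → u i j = 0 := by
    intro i j hij
    simp [hu, hD, hLt i j hij]
  have hu1 : ∀ i, u i i = 1 := by
    intro i
    simp [hu, hD, hLii i]
  have hudet : u.det = 1 := by
    rw [det_of_isUpperTriangular (fun i j h => hut i j h)]
    simp [hu1]
  have huu : IsUnit u := (isUnit_iff_isUnit_det u).mpr (by rw [hudet]; exact isUnit_one)
  have hPD : (u * (g * gᴴ) * uᴴ).PosDef := by
    refine hM.mul_mul_conjTranspose_same ?_
    intro v w hvw
    have := congrArg (fun z => z ᵥ* u⁻¹) hvw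
    simpa [vecMul_vecMul, mul_nonsing_inv _ (by rw [hudet]; exact isUnit_one)] using this
  have hdiag : (u * (g * gᴴ) * uᴴ).IsDiag := by
    have : u * (g * gᴴ) * uᴴ = D * (L * (g * gᴴ) * Lᴴ) * Dᴴ := by
      simp [hu, conjTranspose_mul, Matrix.mul_assoc]
    rw [this, hD, diagonal_conjTranspose]
    intro i j hij
    simp [hLd hij]
  set d : Fin n → ℝ := fun i => ((u * (g * gᴴ) * uᴴ) i i).re with hd
  have hdpos : ∀ i, 0 < d i := fun i => (Complex.pos_iff.mp (hPD.diag_pos (i := i))).1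
  have hdeq : u * (g * gᴴ) * uᴴ = diagonal fun i => (d i : ℂ) := by
    ext i j
    by_cases hij : i = j
    · subst hij
      have := (Complex.pos_iff.mp (hPD.diag_pos (i := i))).2
      rw [diagonal_apply_eq]
      apply Complex.ext
      · simp [hd]
      · simpa using this.symm
    · rw [diagonal_apply_ne _ hij, hdiag hij]
  set X : Fin n → ℝ := fun i => Real.log (d i) / 2 with hX
  have hE : expDiag (fun i => ((-X i : ℝ) : ℂ)) * expDiag (fun i => (X i : ℂ)) = 1 := by
    rw [← expDiag_add]
    have : ((fun i => ((-X i : ℝ) : ℂ)) + fun i => (X i : ℂ)) = 0 := by ext i; simp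
    rw [this]
    simp [expDiag]
  have hE' : expDiag (fun i => (X i : ℂ)) * expDiag (fun i => ((-X i : ℝ) : ℂ)) = 1 :=
    mul_eq_one_comm.mp hE
  have hinv : u * u⁻¹ = 1 := mul_nonsing_inv _ (by rw [hudet]; exact isUnit_one)
  have hinv' : u⁻¹ * u = 1 := nonsing_inv_mul _ (by rw [hudet]; exact isUnit_one)
  have htri : ∀ i j, j < i → u⁻¹ i j = 0 := by
    have : Invertible u := huu.invertible
    have hb : BlockTriangular u id := fun i j h => hut i j h
    intro i j h
    exact blockTriangular_inv_of_blockTriangular hb h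
  -- Unitarity of e^{−X} u g amounts to u g g* u* = e^{2X}.
  refine ⟨X, u⁻¹, expDiag (fun i => ((-X i : ℝ) : ℂ)) * u * g, ?_, htri, ?_, ?_⟩
  · intro i
    have h := congrFun (congrFun hinv i) i
    rw [mul_apply, Finset.sum_eq_single i, hu1, one_mul, one_apply_eq] at h
    · exact h
    · intro b _ hb
      rcases lt_or_gt_of_ne hb with hb | hb
      · rw [hut i b hb, zero_mul]
      · rw [htri b i hb, mul_zero]
    · simp
  · rw [mem_unitaryGroup_iff, star_eq_conjTranspose, conjTranspose_mul, conjTranspose_mul,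
      expDiag_conjTranspose]
    have : expDiag (fun i => ((-X i : ℝ) : ℂ)) * u * g *
        (gᴴ * (uᴴ * expDiag (fun i => ((-X i : ℝ) : ℂ))))
        = expDiag (fun i => ((-X i : ℝ) : ℂ)) * (u * (g * gᴴ) * uᴴ) *
          expDiag (fun i => ((-X i : ℝ) : ℂ)) := by
      simp only [Matrix.mul_assoc]
    rw [this, hdeq, expDiag, diagonal_mul_diagonal, diagonal_mul_diagonal, ← diagonal_one]
    congr 1
    ext i
    rw [← Complex.ofReal_exp, ← Complex.ofReal_mul, ← Complex.ofReal_mul, ← Complex.ofReal_one]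
    congr 1
    have h3 : Real.exp (-X i) * Real.exp (-X i) = (d i)⁻¹ := by
      have h4 : -X i + -X i = -Real.log (d i) := by simp only [hX]; ring
      rw [← Real.exp_add, h4, Real.exp_neg, Real.exp_log (hdpos i)]
    rw [mul_right_comm, h3, inv_mul_cancel₀ (hdpos i).ne']
  · simp only [Matrix.mul_assoc]
    rw [← Matrix.mul_assoc _ (expDiag fun i => ((-X i : ℝ) : ℂ)), hE', Matrix.one_mul,
      ← Matrix.mul_assoc, hinv', Matrix.one_mul]

theorem isIwasawa_minorH {g : Matrix (Fin n) (Fin n) ℂ} (hg : IsUnit g.det) :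
    IsIwasawa g (minorH g) := by
  obtain ⟨X, hX⟩ := exists_isIwasawa hg
  rwa [← hX.eq_minorH]

theorem iwasawaH_eq_minorH {g : Matrix (Fin n) (Fin n) ℂ} (hg : IsUnit g.det) :
    iwasawaH g = minorH g :=
  (Classical.epsilon_spec (exists_isIwasawa hg)).eq_minorH

theorem lowMinor_ne_zero {g : Matrix (Fin n) (Fin n) ℂ} (hg : IsUnit g.det) (j : ℕ) :
    lowMinor j g ≠ 0 := by
  rw [(isIwasawa_minorH hg).lowMinor_eq]
  exact Complex.exp_ne_zero _

theorem continuous_lowMinor (j : ℕ) :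
    Continuous (lowMinor j : Matrix (Fin n) (Fin n) ℂ → ℂ) := by
  unfold lowMinor low
  fun_prop

theorem continuous_minorH {Y : Type*} [TopologicalSpace Y] {g : Y → Matrix (Fin n) (Fin n) ℂ}
    (hg : Continuous g) (hu : ∀ y, IsUnit (g y).det) (i : Fin n) :
    Continuous fun y => minorH (g y) i := by
  unfold minorH
  refine Continuous.div_const (Continuous.sub ?_ ?_) _
  · exact Continuous.log ((continuous_lowMinor _).comp hg).norm fun y =>
      norm_ne_zero_iff.mpr (lowMinor_ne_zero (hu y) _)
  · exact Continuous.log ((continuous_lowMinor _).comp hg).norm fun y =>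
      norm_ne_zero_iff.mpr (lowMinor_ne_zero (hu y) _)

theorem lowMinor_mul_unitary (j : ℕ) (g : Matrix (Fin n) (Fin n) ℂ)
    {k : Matrix (Fin n) (Fin n) ℂ} (hk : k ∈ unitaryGroup (Fin n) ℂ) :
    lowMinor j (g * k) = lowMinor j g := by
  have hk' : k * kᴴ = 1 := mem_unitaryGroup_iff.mp hk
  rw [lowMinor, lowMinor, conjTranspose_mul, Matrix.mul_assoc, ← Matrix.mul_assoc k, hk',
    Matrix.one_mul]

theorem minorH_mul_unitary (g : Matrix (Fin n) (Fin n) ℂ)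
    {k : Matrix (Fin n) (Fin n) ℂ} (hk : k ∈ unitaryGroup (Fin n) ℂ) :
    minorH (g * k) = minorH g := by
  ext i
  simp [minorH, lowMinor_mul_unitary _ g hk]

theorem minorH_expDiag (X : Fin n → ℝ) : minorH (expDiag fun i => (X i : ℂ)) = X := by
  have : IsIwasawa (expDiag fun i => (X i : ℂ)) X :=
    ⟨1, 1, by simp, fun i j h => one_apply_ne h.ne', one_mem _, by simp⟩
  exact this.eq_minorH.symm

theorem isUnit_det_unitary {k : Matrix (Fin n) (Fin n) ℂ} (hk : k ∈ unitaryGroup (Fin n) ℂ) :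
    IsUnit k.det := by
  refine (isUnit_iff_isUnit_det k).mp ?_
  exact IsUnit.of_mul_eq_one _ (mem_unitaryGroup_iff.mp hk)

theorem isUnit_det_expDiag (X : Fin n → ℂ) : IsUnit (expDiag X).det := by
  rw [expDiag, det_diagonal, isUnit_iff_ne_zero, Finset.prod_ne_zero_iff]
  exact fun i _ => Complex.exp_ne_zero _

end SphericalGL
namespace SphericalGL

open Matrix

section Blocks

variable {n : ℕ}

/-! ### Removing the first simple root of a Levi subgroup -/

/-- `{p, …, p + m}` is the first nontrivial block of `S`, and `S'` arises from `S` by splitting off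
its first index. -/
structure FirstBlock (S S' : Finset (Fin (n - 1))) (p m : ℕ) : Prop where
  lt : p + m < n
  block : ∀ i j : Fin n, p ≤ (i : ℕ) → (i : ℕ) ≤ p + m →
    (SameBlock S i j ↔ p ≤ (j : ℕ) ∧ (j : ℕ) ≤ p + m)
  erase : ∀ i j : Fin n, SameBlock S' i j ↔ SameBlock S i j ∧ ((i : ℕ) = p ↔ (j : ℕ) = p)
  low : ∀ i j : Fin n, (i : ℕ) < p → SameBlock S i j → i = j

/-- Take for p the least element k of S, for m the length of the run of consecutive elements
starting there, and delete k from S. -/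
theorem exists_firstBlock {S : Finset (Fin (n - 1))} (hS : S.Nonempty) :
    ∃ S' p m, S'.card < S.card ∧ FirstBlock S S' p m := by
  obtain ⟨k, hk, hmin⟩ : ∃ k ∈ S, ∀ l ∈ S, k ≤ l := ⟨S.min' hS, S.min'_mem hS, fun l hl => S.min'_le l hl⟩
  -- The run ends at the first m with k + m outside S or beyond the last simple root; m = n
  -- satisfies this vacuously, so the search terminates.
  have hex : ∃ m : ℕ, ∀ h : (k : ℕ) + m < n - 1, (⟨k + m, h⟩ : Fin (n - 1)) ∉ S :=
    ⟨n, fun h => by omega⟩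
  classical
  set m := Nat.find hex with hm
  have hm1 := Nat.find_spec hex
  rw [← hm] at hm1
  have hm2 : ∀ l < m, ∃ h : (k : ℕ) + l < n - 1, (⟨k + l, h⟩ : Fin (n - 1)) ∈ S := by
    intro l hl
    have := Nat.find_min hex hl
    push Not at this
    exact this
  have hlt : (k : ℕ) + m < n := by
    rcases Nat.eq_zero_or_pos m with h0 | h0
    · have := k.2; omega
    · obtain ⟨h, -⟩ := hm2 (m - 1) (by omega)
      omega
  refine ⟨S.erase k, k, m, Finset.card_erase_lt_of_mem hk, hlt, ?_, ?_, ?_⟩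
  · intro i j hi1 hi2
    constructor
    · intro h
      constructor
      · by_contra hj
        have h1 := h ⟨j, by have := i.2; omega⟩ (by simp) (by simp; omega)
        have h2 := hmin _ h1
        rw [Fin.le_def] at h2
        simp only at h2
        omega
      · by_contra hj
        have h1 := h ⟨k + m, by have := j.2; omega⟩ (by simp; omega) (by simp; omega)
        exact hm1 _ h1
    · rintro ⟨hj1, hj2⟩ l hl1 hl2
      obtain ⟨h, hmem⟩ := hm2 (l - k) (by omega)
      have : (⟨k + (l - k), h⟩ : Fin (n - 1)) = l := Fin.ext (by simp only; omega)
      rwa [this] at hmem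
  · intro i j
    constructor
    · intro h
      have hS : SameBlock S i j := fun l h1 h2 => Finset.mem_of_mem_erase (h l h1 h2)
      refine ⟨hS, ?_⟩
      by_contra hne
      have hij : (i : ℕ) ≠ j := fun e => hne (by rw [e])
      by_cases hlow : min (i : ℕ) (j : ℕ) < k
      · have h1 := hS ⟨min (i : ℕ) (j : ℕ), by have := k.2; omega⟩ le_rfl (by simp; omega)
        have h2 := hmin _ h1
        rw [Fin.le_def] at h2
        simp only at h2
        omega
      · have h1 := h k (by omega) (by omega)
        exact Finset.notMem_erase k S h1
    · rintro ⟨h, hiff⟩ l hl1 hl2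
      have hl := h l hl1 hl2
      refine Finset.mem_erase.mpr ⟨?_, hl⟩
      rintro rfl
      have h1 : ¬ min (i : ℕ) (j : ℕ) < l := by
        intro hlt'
        have h1 := h ⟨min (i : ℕ) (j : ℕ), by have := l.2; omega⟩ le_rfl (by simp; omega)
        have h2 := hmin _ h1
        rw [Fin.le_def] at h2
        simp only at h2
        omega
      omega
  · intro i j hi h
    by_contra hne
    have hij : (i : ℕ) ≠ j := fun e => hne (Fin.ext e)
    have h1 := h ⟨min (i : ℕ) (j : ℕ), by have := k.2; omega⟩ le_rfl (by simp; omega)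
    have h2 := hmin _ h1
    rw [Fin.le_def] at h2
    simp only at h2
    omega

variable {S S' : Finset (Fin (n - 1))} {p m : ℕ}

/-- The inclusion of the first block. -/
def FirstBlock.emb (h : FirstBlock S S' p m) (i : Fin (m + 1)) : Fin n :=
  ⟨p + i, by have := h.lt; omega⟩

theorem FirstBlock.val_emb (h : FirstBlock S S' p m) (i : Fin (m + 1)) : (h.emb i : ℕ) = p + i := rfl

theorem FirstBlock.emb_injective (h : FirstBlock S S' p m) : Function.Injective h.emb := by
  intro i j hij
  have := congrArg Fin.val hij
  rw [h.val_emb, h.val_emb] at this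
  exact Fin.ext (by omega)

/-- Membership in the first block. -/
def InBlock (p m : ℕ) (i : Fin n) : Prop := p ≤ (i : ℕ) ∧ (i : ℕ) ≤ p + m

instance (i : Fin n) : Decidable (InBlock p m i) := by unfold InBlock; infer_instance

theorem FirstBlock.inBlock_emb (h : FirstBlock S S' p m) (i : Fin (m + 1)) : InBlock p m (h.emb i) := by
  constructor <;> rw [h.val_emb] <;> omega

theorem FirstBlock.exists_emb (h : FirstBlock S S' p m) {i : Fin n} (hi : InBlock p m i) :
    ∃ j, h.emb j = i :=
  ⟨⟨i - p, by have := hi.1; have := hi.2; omega⟩, Fin.ext (by rw [h.val_emb]; have := hi.1; simp; omega)⟩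

theorem FirstBlock.sameBlock_iff (h : FirstBlock S S' p m) {i j : Fin n} (hi : InBlock p m i) :
    SameBlock S i j ↔ InBlock p m j := h.block i j hi.1 hi.2

theorem FirstBlock.not_sameBlock (h : FirstBlock S S' p m) {i j : Fin n} (hi : ¬ InBlock p m i)
    (hj : InBlock p m j) : ¬ SameBlock S i j := fun hs => hi ((h.sameBlock_iff hj).mp hs.symm)

theorem FirstBlock.sameBlock_emb (h : FirstBlock S S' p m) (i j : Fin (m + 1)) :
    SameBlock S (h.emb i) (h.emb j) := (h.sameBlock_iff (h.inBlock_emb i)).mpr (h.inBlock_emb j)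

theorem FirstBlock.sameBlock'_emb_succ (h : FirstBlock S S' p m) (i j : Fin m) :
    SameBlock S' (h.emb i.succ) (h.emb j.succ) := by
  rw [h.erase]
  refine ⟨h.sameBlock_emb _ _, ?_⟩
  simp [h.val_emb]

theorem FirstBlock.le (h : FirstBlock S S' p m) {i j : Fin n} (hs : SameBlock S' i j) :
    SameBlock S i j := ((h.erase i j).mp hs).1

theorem FirstBlock.sameBlock'_iff_of_not (h : FirstBlock S S' p m) {i j : Fin n}
    (hi : ¬ InBlock p m i) : SameBlock S' i j ↔ SameBlock S i j := by
  rw [h.erase]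
  refine ⟨And.left, fun hs => ⟨hs, ?_⟩⟩
  have hj : ¬ InBlock p m j := fun hj => h.not_sameBlock hi hj hs
  unfold InBlock at hi hj
  omega

theorem FirstBlock.not_sameBlock'_zero_succ (h : FirstBlock S S' p m) (j : Fin m) :
    ¬ SameBlock S' (h.emb 0) (h.emb j.succ) := by
  rw [h.erase]
  simp [h.val_emb]

theorem FirstBlock.sum_block {M : Type*} [AddCommMonoid M] (h : FirstBlock S S' p m)
    {f : Fin n → M} (hf : ∀ i, ¬ InBlock p m i → f i = 0) : ∑ i, f i = ∑ i, f (h.emb i) := by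
  classical
  rw [← Finset.sum_image (s := Finset.univ) (g := h.emb) fun _ _ _ _ e => h.emb_injective e]
  symm
  refine Finset.sum_subset (Finset.subset_univ _) fun i _ hi => hf i fun hb => hi ?_
  obtain ⟨j, rfl⟩ := h.exists_emb hb
  exact Finset.mem_image_of_mem _ (Finset.mem_univ j)

theorem mem_posRoots {S : Finset (Fin (n - 1))} {q : Fin n × Fin n} :
    q ∈ posRoots S ↔ q.1 < q.2 ∧ SameBlock S q.1 q.2 := by simp [posRoots]

/-- The positive roots away from the first block. -/
def outRoots (S : Finset (Fin (n - 1))) (p m : ℕ) : Finset (Fin n × Fin n) :=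
  (posRoots S).filter fun q => ¬ InBlock p m q.1

theorem FirstBlock.outRoots_eq (h : FirstBlock S S' p m) : outRoots S' p m = outRoots S p m := by
  ext q
  simp only [outRoots, Finset.mem_filter, mem_posRoots]
  constructor
  · rintro ⟨⟨h1, h2⟩, h3⟩
    exact ⟨⟨h1, (h.sameBlock'_iff_of_not h3).mp h2⟩, h3⟩
  · rintro ⟨⟨h1, h2⟩, h3⟩
    exact ⟨⟨h1, (h.sameBlock'_iff_of_not h3).mpr h2⟩, h3⟩

theorem FirstBlock.prod_posRoots {M : Type*} [CommMonoid M] (h : FirstBlock S S' p m)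
    (f : Fin n × Fin n → M) :
    ∏ q ∈ posRoots S, f q
      = (∏ i, ∏ j ∈ Finset.Ioi i, f (h.emb i, h.emb j)) * ∏ q ∈ outRoots S p m, f q := by
  rw [← Finset.prod_filter_mul_prod_filter_not (posRoots S) (fun q => InBlock p m q.1)]
  congr 1
  rw [Finset.prod_sigma']
  symm
  refine Finset.prod_bij (fun q _ => (h.emb q.1, h.emb q.2)) ?_ ?_ ?_ ?_
  · rintro ⟨i, j⟩ hq
    simp only [Finset.mem_sigma, Finset.mem_univ, Finset.mem_Ioi, true_and] at hq
    simp only [Finset.mem_filter, mem_posRoots]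
    refine ⟨⟨?_, h.sameBlock_emb _ _⟩, h.inBlock_emb _⟩
    rw [Fin.lt_def, h.val_emb, h.val_emb]
    rw [Fin.lt_def] at hq
    omega
  · rintro ⟨i, j⟩ _ ⟨i', j'⟩ _ he
    simp only [Prod.mk.injEq] at he
    obtain ⟨h1, h2⟩ := he
    rw [h.emb_injective h1, h.emb_injective h2]
  · rintro ⟨i, j⟩ hq
    simp only [Finset.mem_filter, mem_posRoots] at hq
    obtain ⟨⟨h1, h2⟩, h3⟩ := hq
    obtain ⟨a, rfl⟩ := h.exists_emb h3
    obtain ⟨b, rfl⟩ := h.exists_emb ((h.sameBlock_iff h3).mp h2)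
    refine ⟨⟨a, b⟩, ?_, rfl⟩
    rw [Fin.lt_def, h.val_emb, h.val_emb] at h1
    simp only [Finset.mem_sigma, Finset.mem_univ, Finset.mem_Ioi, true_and, Fin.lt_def]
    omega
  · intros
    rfl

theorem FirstBlock.prod_posRoots' {M : Type*} [CommMonoid M] (h : FirstBlock S S' p m)
    (f : Fin n × Fin n → M) :
    ∏ q ∈ posRoots S', f q
      = (∏ i : Fin m, ∏ j ∈ Finset.Ioi i, f (h.emb i.succ, h.emb j.succ)) *
        ∏ q ∈ outRoots S p m, f q := by
  rw [← Finset.prod_filter_mul_prod_filter_not (posRoots S') (fun q => InBlock p m q.1),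
    ← h.outRoots_eq]
  congr 1
  rw [Finset.prod_sigma']
  symm
  refine Finset.prod_bij (fun q _ => (h.emb q.1.succ, h.emb q.2.succ)) ?_ ?_ ?_ ?_
  · rintro ⟨i, j⟩ hq
    simp only [Finset.mem_sigma, Finset.mem_univ, Finset.mem_Ioi, true_and] at hq
    simp only [Finset.mem_filter, mem_posRoots]
    refine ⟨⟨?_, h.sameBlock'_emb_succ _ _⟩, h.inBlock_emb _⟩
    rw [Fin.lt_def, h.val_emb, h.val_emb]
    rw [Fin.lt_def] at hq
    simp
    omega
  · rintro ⟨i, j⟩ _ ⟨i', j'⟩ _ he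
    simp only [Prod.mk.injEq] at he
    obtain ⟨h1, h2⟩ := he
    rw [Fin.succ_injective _ (h.emb_injective h1), Fin.succ_injective _ (h.emb_injective h2)]
  · rintro ⟨i, j⟩ hq
    simp only [Finset.mem_filter, mem_posRoots] at hq
    obtain ⟨⟨h1, h2⟩, h3⟩ := hq
    obtain ⟨a, rfl⟩ := h.exists_emb h3
    obtain ⟨b, rfl⟩ := h.exists_emb ((h.sameBlock_iff h3).mp (h.le h2))
    rw [Fin.lt_def, h.val_emb, h.val_emb] at h1
    have h4 := ((h.erase _ _).mp h2).2
    rw [h.val_emb, h.val_emb] at h4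
    obtain ⟨a, rfl⟩ := Fin.exists_succ_eq.mpr (show a ≠ 0 by rintro rfl; simp at h1 h4; omega)
    obtain ⟨b, rfl⟩ := Fin.exists_succ_eq.mpr (show b ≠ 0 by rintro rfl; simp at h1)
    refine ⟨⟨a, b⟩, ?_, rfl⟩
    simp at h1
    simp only [Finset.mem_sigma, Finset.mem_univ, Finset.mem_Ioi, true_and, Fin.lt_def]
    omega
  · intros
    rfl

/-- The roots lost by splitting off p are e_p − e_{p+1}, …, e_p − e_{p+m}. -/
theorem FirstBlock.prod_posRoots_eq_mul {M : Type*} [CommMonoid M] (h : FirstBlock S S' p m)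
    (f : Fin n × Fin n → M) :
    ∏ q ∈ posRoots S, f q = (∏ q ∈ posRoots S', f q) * ∏ j : Fin m, f (h.emb 0, h.emb j.succ) := by
  rw [h.prod_posRoots, h.prod_posRoots', Fin.prod_univ_succ, Fin.prod_Ioi_zero]
  simp only [Fin.prod_Ioi_succ]
  rw [mul_comm _ (∏ j : Fin m, f (h.emb 0, h.emb j.succ)), mul_assoc, mul_comm]

theorem FirstBlock.sum_posRoots_eq_add {M : Type*} [AddCommMonoid M] (h : FirstBlock S S' p m)
    (f : Fin n × Fin n → M) :
    ∑ q ∈ posRoots S, f q = ∑ q ∈ posRoots S', f q + ∑ j : Fin m, f (h.emb 0, h.emb j.succ) :=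
  h.prod_posRoots_eq_mul (M := Multiplicative M) f

theorem rho_eq (S : Finset (Fin (n - 1))) : rho S = ∑ q ∈ posRoots S, rootVec q := by
  rw [rho, ← Finset.smul_sum, smul_smul]
  norm_num

/-- The shift `ρ_S - ρ_{S'}`. -/
def rhoShift (p m : ℕ) (i : Fin n) : ℂ :=
  if (i : ℕ) = p then m else if InBlock p m i then -1 else 0

/-- The shift is the sum of the m lost roots e_p − e_{p+j}: it has entry m at p and −1 at the other
indices of the block. -/
theorem FirstBlock.rho_eq (h : FirstBlock S S' p m) : rho S = rho S' + rhoShift p m := by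
  rw [SphericalGL.rho_eq, SphericalGL.rho_eq, h.sum_posRoots_eq_add]
  congr 1
  ext i
  simp only [rootVec, Finset.sum_apply, Pi.sub_apply, Finset.sum_sub_distrib, rhoShift]
  by_cases hb : InBlock p m i
  · obtain ⟨a, rfl⟩ := h.exists_emb hb
    simp only [Pi.single_apply, h.emb_injective.eq_iff, h.val_emb, hb, if_true]
    refine Fin.cases ?_ (fun a => ?_) a
    · simp [(Fin.succ_ne_zero _).symm]
    · simp
  · have h1 : ∀ a, i ≠ h.emb a := fun a e => hb (e ▸ h.inBlock_emb a)
    have h2 : (i : ℕ) ≠ p := fun e => hb ⟨e.ge, by omega⟩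
    simp [h1, hb, h2]

/-- The shift is constant on the blocks of S', so adding it to the parameter leaves ∏(λ_i − λ_j)
over the roots of S' unchanged. -/
theorem FirstBlock.rhoShift_sub (h : FirstBlock S S' p m) {q : Fin n × Fin n}
    (hq : q ∈ posRoots S') : rhoShift p m q.1 = rhoShift p m q.2 := by
  obtain ⟨-, hs⟩ := mem_posRoots.mp hq
  have h1 := ((h.erase _ _).mp hs).2
  have h2 : InBlock p m q.1 ↔ InBlock p m q.2 :=
    ⟨fun hb => (h.sameBlock_iff hb).mp (h.le hs), fun hb => (h.sameBlock_iff hb).mp (h.le hs).symm⟩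
  simp only [rhoShift, h1, h2]

end Blocks

end SphericalGL
namespace SphericalGL

open MeasureTheory
open scoped Matrix

/-! ### Haar measure on the compact groups. -/

section Haar

variable {n : ℕ}

instance (S : Finset (Fin (n - 1))) : SecondCountableTopology (compactK S) := by
  have h1 : SecondCountableTopology (Matrix (Fin n) (Fin n) ℂ) :=
    inferInstanceAs (SecondCountableTopology (Fin n → Fin n → ℂ))
  have h2 : SecondCountableTopology (Matrix.unitaryGroup (Fin n) ℂ) :=
    TopologicalSpace.Subtype.secondCountableTopology _
  exact TopologicalSpace.Subtype.secondCountableTopology _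

instance (S : Finset (Fin (n - 1))) : (haarK S).IsHaarMeasure :=
  Measure.isHaarMeasure_haarMeasure ⊤

instance (S : Finset (Fin (n - 1))) : IsProbabilityMeasure (haarK S) :=
  ⟨Measure.haarMeasure_self⟩

/-- Compact groups are unimodular: a right translate of the Haar probability measure is again one,
and there is only one. -/
instance (S : Finset (Fin (n - 1))) : (haarK S).IsMulRightInvariant := by
  refine ⟨fun g => ?_⟩
  have hm : Measurable fun x : compactK S => x * g := (continuous_mul_const g).measurable
  have h1 : IsProbabilityMeasure ((haarK S).map fun x => x * g) :=
    Measure.isProbabilityMeasure_map hm.aemeasurable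
  have h2 : ((haarK S).map fun x => x * g).IsHaarMeasure := inferInstance
  exact Measure.isHaarMeasure_eq_of_isProbabilityMeasure _ _

/-- A compact group element as a matrix. -/
abbrev toMat {S : Finset (Fin (n - 1))} (k : compactK S) : Matrix (Fin n) (Fin n) ℂ :=
  ((k : Matrix.unitaryGroup (Fin n) ℂ) : Matrix (Fin n) (Fin n) ℂ)

theorem continuous_toMat (S : Finset (Fin (n - 1))) :
    Continuous (toMat : compactK S → Matrix (Fin n) (Fin n) ℂ) :=
  continuous_subtype_val.comp continuous_subtype_val

theorem toMat_unitary {S : Finset (Fin (n - 1))} (k : compactK S) :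
    toMat k ∈ Matrix.unitaryGroup (Fin n) ℂ := k.1.2

theorem toMat_mul {S : Finset (Fin (n - 1))} (k l : compactK S) :
    toMat (k * l) = toMat k * toMat l := rfl

theorem toMat_eq_zero {S : Finset (Fin (n - 1))} (k : compactK S) {i j : Fin n}
    (h : ¬ SameBlock S i j) : toMat k i j = 0 := k.2 i j h

/-- For fixed h in the smaller group, left invariance makes the integral over k independent of h;
then exchange the order of integration. -/
theorem integral_comp_inclusion {S S' : Finset (Fin (n - 1))} (hle : compactK S' ≤ compactK S)
    {f : compactK S → ℂ} (hf : Continuous f) :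
    ∫ k, f k ∂haarK S = ∫ k, ∫ h, f (Subgroup.inclusion hle h * k) ∂haarK S' ∂haarK S := by
  have hinc : Continuous (Subgroup.inclusion hle) := by
    exact Continuous.subtype_mk continuous_subtype_val _
  have hc : Continuous (Function.uncurry fun (k : compactK S) (h : compactK S') =>
      f (Subgroup.inclusion hle h * k)) :=
    hf.comp ((hinc.comp continuous_snd).mul continuous_fst)
  rw [integral_integral_swap]
  · simp only [integral_mul_left_eq_self]
    simp
  · exact hc.integrable_of_hasCompactSupport (HasCompactSupport.of_compactSpace _)

/-! ### The spherical integral with arbitrary parameters -/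

/-- The spherical integral in terms of minors, for real `X` and an arbitrary parameter. -/
noncomputable def sphInt (S : Finset (Fin (n - 1))) (l : Fin n → ℂ) (X : Fin n → ℝ) : ℂ :=
  ∫ k : compactK S, Complex.exp (pairing (l + rho S)
    fun i => ((minorH (toMat k * expDiag fun i => (X i : ℂ)) i : ℝ) : ℂ)) ∂haarK S

theorem isUnit_det_mul_expDiag {k : Matrix (Fin n) (Fin n) ℂ}
    (hk : k ∈ Matrix.unitaryGroup (Fin n) ℂ) (X : Fin n → ℂ) : IsUnit (k * expDiag X).det := by
  rw [Matrix.det_mul]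
  exact (isUnit_det_unitary hk).mul (isUnit_det_expDiag X)

theorem sph_expDiag (S : Finset (Fin (n - 1))) (l : aSpace S) (X : Fin n → ℝ) :
    sph S l (expDiag fun i => (X i : ℂ)) = sphInt S l X := by
  unfold sph sphInt
  congr 1
  ext k
  have h := isUnit_det_mul_expDiag (toMat_unitary k) fun i => (X i : ℂ)
  rw [iwasawaH_eq_minorH h]

theorem continuous_expDiag {Y : Type*} [TopologicalSpace Y] {X : Y → Fin n → ℝ}
    (hX : Continuous X) : Continuous fun y => expDiag fun i => (X y i : ℂ) := by
  unfold expDiag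
  refine Continuous.matrix_diagonal ?_
  fun_prop

theorem continuous_sphInt_integrand (S : Finset (Fin (n - 1))) {Y : Type*} [TopologicalSpace Y]
    {l : Y → Fin n → ℂ} {X : Y → Fin n → ℝ} {k : Y → compactK S} (hl : Continuous l)
    (hX : Continuous X) (hk : Continuous k) :
    Continuous fun y => Complex.exp (pairing (l y)
      fun i => ((minorH (toMat (k y) * expDiag fun i => (X y i : ℂ)) i : ℝ) : ℂ)) := by
  have h1 : ∀ i, Continuous fun y => minorH (toMat (k y) * expDiag fun i => (X y i : ℂ)) i := by
    intro i
    refine continuous_minorH (((continuous_toMat S).comp hk).matrix_mul (continuous_expDiag hX))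
      (fun y => isUnit_det_mul_expDiag (toMat_unitary _) _) i
  unfold pairing
  refine Complex.continuous_exp.comp (continuous_finsetSum _ fun i _ => ?_)
  exact ((continuous_apply i).comp hl).mul (Complex.continuous_ofReal.comp (h1 i))

theorem continuous_sphInt (S : Finset (Fin (n - 1))) {Y : Type*} [TopologicalSpace Y]
    [FirstCountableTopology Y] [LocallyCompactSpace Y] {l : Y → Fin n → ℂ} {X : Y → Fin n → ℝ}
    (hl : Continuous l) (hX : Continuous X) : Continuous fun y => sphInt S (l y) (X y) := by
  have h := continuous_parametric_integral_of_continuous (μ := haarK S)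
    (f := fun (y : Y) (k : compactK S) => Complex.exp (pairing (l y + rho S)
      fun i => ((minorH (toMat k * expDiag fun i => (X y i : ℂ)) i : ℝ) : ℂ)))
    (continuous_sphInt_integrand S (Y := Y × compactK S) (l := fun p => l p.1 + rho S)
      (X := fun p => X p.1) (k := fun p => p.2) (by fun_prop) (by fun_prop) continuous_snd)
    (isCompact_univ)
  simp only [Measure.restrict_univ] at h
  exact h

/-- The Iwasawa projection of a unitary matrix is 0. -/
theorem sphInt_zero_arg (S : Finset (Fin (n - 1))) (l : Fin n → ℂ) : sphInt S l 0 = 1 := by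
  have h0 : (expDiag fun i => (((0 : Fin n → ℝ) i : ℝ) : ℂ)) = 1 := by simp [expDiag]
  have h : ∀ k : compactK S,
      minorH (toMat k * expDiag fun i => (((0 : Fin n → ℝ) i : ℝ) : ℂ)) = 0 := by
    intro k
    have h1 := minorH_mul_unitary (expDiag fun i => (((0 : Fin n → ℝ) i : ℝ) : ℂ)) (toMat_unitary k)
    rw [minorH_expDiag, h0, Matrix.one_mul] at h1
    rw [h0, Matrix.mul_one, h1]
  simp only [sphInt, h]
  simp [pairing]

end Haar

end SphericalGL
namespace SphericalGL

open Matrix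

section Graft

variable {n : ℕ} {S S' : Finset (Fin (n - 1))} {p m : ℕ}

/-! ### Block replacement in unitary matrices -/

/-- Replace the first block of `k` by `A`. -/
def FirstBlock.graft (_h : FirstBlock S S' p m) (A : Matrix (Fin (m + 1)) (Fin (m + 1)) ℂ)
    (k : Matrix (Fin n) (Fin n) ℂ) : Matrix (Fin n) (Fin n) ℂ := of fun i j =>
  if hi : InBlock p m i then
    if hj : InBlock p m j then
      A ⟨i - p, by have := hi.1; have := hi.2; omega⟩ ⟨j - p, by have := hj.1; have := hj.2; omega⟩
    else 0
  else if InBlock p m j then 0 else k i j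

theorem FirstBlock.graft_emb (h : FirstBlock S S' p m) (A : Matrix (Fin (m + 1)) (Fin (m + 1)) ℂ)
    (k : Matrix (Fin n) (Fin n) ℂ) (i j : Fin (m + 1)) :
    h.graft A k (h.emb i) (h.emb j) = A i j := by
  simp [graft, h.inBlock_emb, h.val_emb]

theorem FirstBlock.graft_left (h : FirstBlock S S' p m) (A : Matrix (Fin (m + 1)) (Fin (m + 1)) ℂ)
    (k : Matrix (Fin n) (Fin n) ℂ) (i : Fin (m + 1)) {j : Fin n} (hj : ¬ InBlock p m j) :
    h.graft A k (h.emb i) j = 0 := by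
  simp [graft, h.inBlock_emb, hj]

theorem FirstBlock.graft_right (h : FirstBlock S S' p m) (A : Matrix (Fin (m + 1)) (Fin (m + 1)) ℂ)
    (k : Matrix (Fin n) (Fin n) ℂ) (i : Fin (m + 1)) {j : Fin n} (hj : ¬ InBlock p m j) :
    h.graft A k j (h.emb i) = 0 := by
  simp [graft, h.inBlock_emb, hj]

theorem FirstBlock.graft_out (h : FirstBlock S S' p m) (A : Matrix (Fin (m + 1)) (Fin (m + 1)) ℂ)
    (k : Matrix (Fin n) (Fin n) ℂ) {i j : Fin n} (hi : ¬ InBlock p m i) (hj : ¬ InBlock p m j) :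
    h.graft A k i j = k i j := by
  simp [graft, hi, hj]

theorem FirstBlock.ext_block (h : FirstBlock S S' p m) {M N : Matrix (Fin n) (Fin n) ℂ}
    (h1 : ∀ i j, M (h.emb i) (h.emb j) = N (h.emb i) (h.emb j))
    (h2 : ∀ i j, ¬ InBlock p m j → M (h.emb i) j = N (h.emb i) j)
    (h3 : ∀ i j, ¬ InBlock p m j → M j (h.emb i) = N j (h.emb i))
    (h4 : ∀ i j, ¬ InBlock p m i → ¬ InBlock p m j → M i j = N i j) : M = N := by
  ext i j
  by_cases hi : InBlock p m i <;> by_cases hj : InBlock p m j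
  · obtain ⟨a, rfl⟩ := h.exists_emb hi
    obtain ⟨b, rfl⟩ := h.exists_emb hj
    exact h1 a b
  · obtain ⟨a, rfl⟩ := h.exists_emb hi
    exact h2 a j hj
  · obtain ⟨b, rfl⟩ := h.exists_emb hj
    exact h3 b i hi
  · exact h4 i j hi hj

/-- The matrix `k` respects the decomposition into the first block and the rest. -/
def FirstBlock.Respects (_h : FirstBlock S S' p m) (k : Matrix (Fin n) (Fin n) ℂ) : Prop :=
  ∀ i j, ¬ SameBlock S i j → k i j = 0

theorem FirstBlock.Respects.out_emb {h : FirstBlock S S' p m} {k : Matrix (Fin n) (Fin n) ℂ}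
    (hk : h.Respects k) {i : Fin n} (hi : ¬ InBlock p m i) (j : Fin (m + 1)) : k i (h.emb j) = 0 :=
  hk _ _ (h.not_sameBlock hi (h.inBlock_emb j))

theorem FirstBlock.Respects.emb_out {h : FirstBlock S S' p m} {k : Matrix (Fin n) (Fin n) ℂ}
    (hk : h.Respects k) {i : Fin n} (hi : ¬ InBlock p m i) (j : Fin (m + 1)) : k (h.emb j) i = 0 :=
  hk _ _ fun hs => h.not_sameBlock hi (h.inBlock_emb j) hs.symm

theorem FirstBlock.graft_submatrix (h : FirstBlock S S' p m) {k : Matrix (Fin n) (Fin n) ℂ}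
    (hk : h.Respects k) : h.graft (k.submatrix h.emb h.emb) k = k := by
  refine h.ext_block ?_ ?_ ?_ ?_
  · intro i j; rw [h.graft_emb]; rfl
  · intro i j hj; rw [h.graft_left _ _ _ hj, hk.emb_out hj]
  · intro i j hj; rw [h.graft_right _ _ _ hj, hk.out_emb hj]
  · intro i j hi hj; rw [h.graft_out _ _ hi hj]

theorem mul_diagonal_conjTranspose_apply {q : ℕ} (k : Matrix (Fin q) (Fin q) ℂ) (D : Fin q → ℂ)
    (i j : Fin q) : (k * diagonal D * kᴴ) i j = ∑ x, k i x * D x * star (k j x) := by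
  rw [mul_apply]
  exact Finset.sum_congr rfl fun x _ => by rw [mul_diagonal, conjTranspose_apply]

theorem FirstBlock.graft_conj (h : FirstBlock S S' p m) (A : Matrix (Fin (m + 1)) (Fin (m + 1)) ℂ)
    {k : Matrix (Fin n) (Fin n) ℂ} (hk : h.Respects k) (D : Fin n → ℂ) :
    h.graft A k * diagonal D * (h.graft A k)ᴴ
      = h.graft (A * diagonal (fun i => D (h.emb i)) * Aᴴ) (k * diagonal D * kᴴ) := by
  refine h.ext_block ?_ ?_ ?_ ?_
  · intro i j
    rw [mul_diagonal_conjTranspose_apply, h.graft_emb, mul_diagonal_conjTranspose_apply,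
      h.sum_block]
    · simp only [h.graft_emb]
    · intro x hx
      rw [h.graft_left _ _ _ hx]
      simp
  · intro i j hj
    rw [mul_diagonal_conjTranspose_apply, h.graft_left _ _ _ hj, h.sum_block]
    · simp [h.graft_right _ _ _ hj]
    · intro x hx
      rw [h.graft_left _ _ _ hx]
      simp
  · intro i j hj
    rw [mul_diagonal_conjTranspose_apply, h.graft_right _ _ _ hj, h.sum_block]
    · simp [h.graft_right _ _ _ hj]
    · intro x hx
      rw [h.graft_left _ _ _ hx]
      simp
  · intro i j hi hj
    rw [mul_diagonal_conjTranspose_apply, h.graft_out _ _ hi hj, mul_diagonal_conjTranspose_apply]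
    refine Finset.sum_congr rfl fun x _ => ?_
    by_cases hx : InBlock p m x
    · obtain ⟨a, rfl⟩ := h.exists_emb hx
      rw [h.graft_right _ _ _ hi, hk.out_emb hi]
      simp
    · rw [h.graft_out _ _ hi hx, h.graft_out _ _ hj hx]

/-- The case D = 1 of `graft_conj`: grafting is compatible with forming k k*. -/
theorem FirstBlock.graft_mem_unitary (h : FirstBlock S S' p m)
    {A : Matrix (Fin (m + 1)) (Fin (m + 1)) ℂ} (hA : A ∈ unitaryGroup (Fin (m + 1)) ℂ)
    {k : Matrix (Fin n) (Fin n) ℂ} (hk : h.Respects k) (hku : k ∈ unitaryGroup (Fin n) ℂ) :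
    h.graft A k ∈ unitaryGroup (Fin n) ℂ := by
  have h1 := h.graft_conj A hk 1
  have hA' : A * Aᴴ = 1 := mem_unitaryGroup_iff.mp hA
  have hk' : k * kᴴ = 1 := mem_unitaryGroup_iff.mp hku
  rw [mem_unitaryGroup_iff, star_eq_conjTranspose]
  have e1 : diagonal (1 : Fin n → ℂ) = 1 := diagonal_one
  have e2 : diagonal (fun i => (1 : Fin n → ℂ) (h.emb i)) = 1 := diagonal_one
  rw [e1, e2, Matrix.mul_one, Matrix.mul_one, Matrix.mul_one, hA', hk'] at h1
  rw [h1]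
  have h2 : h.Respects 1 := by
    intro i j hij
    refine one_apply_ne ?_
    rintro rfl
    exact hij (SameBlock.rfl S i)
  have h3 : (1 : Matrix (Fin n) (Fin n) ℂ).submatrix h.emb h.emb = 1 :=
    submatrix_one _ h.emb_injective
  rw [← h3, h.graft_submatrix h2]

theorem FirstBlock.submatrix_mul (h : FirstBlock S S' p m) {k : Matrix (Fin n) (Fin n) ℂ}
    (hk : h.Respects k) (l : Matrix (Fin n) (Fin n) ℂ) :
    (k * l).submatrix h.emb h.emb = k.submatrix h.emb h.emb * l.submatrix h.emb h.emb := by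
  ext i j
  rw [submatrix_apply, mul_apply, mul_apply, h.sum_block]
  · rfl
  · intro x hx
    rw [hk.emb_out hx, zero_mul]

theorem FirstBlock.submatrix_mem_unitary (h : FirstBlock S S' p m) {k : Matrix (Fin n) (Fin n) ℂ}
    (hk : h.Respects k) (hku : k ∈ unitaryGroup (Fin n) ℂ) :
    k.submatrix h.emb h.emb ∈ unitaryGroup (Fin (m + 1)) ℂ := by
  have hk' : k * kᴴ = 1 := mem_unitaryGroup_iff.mp hku
  rw [mem_unitaryGroup_iff, star_eq_conjTranspose, conjTranspose_submatrix, ← h.submatrix_mul hk, hk']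
  exact submatrix_one _ h.emb_injective

theorem FirstBlock.toMat_respects (h : FirstBlock S S' p m) (k : compactK S) :
    h.Respects (toMat k) := fun _ _ hij => toMat_eq_zero k hij

theorem FirstBlock.compactK_le (h : FirstBlock S S' p m) : compactK S' ≤ compactK S :=
  fun _ hk i j hij => hk i j fun hs => hij (h.le hs)

/-- Every unit vector is the first row of a unitary matrix. -/
theorem exists_unitary_row {q : ℕ} (v : Fin (q + 1) → ℂ) (hv : ∑ i, Complex.normSq (v i) = 1) :
    ∃ A ∈ unitaryGroup (Fin (q + 1)) ℂ, ∀ i, A 0 i = v i := by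
  set w : EuclideanSpace ℂ (Fin (q + 1)) := WithLp.toLp 2 v with hw
  have hnorm : ‖w‖ = 1 := by
    rw [EuclideanSpace.norm_eq, ← Real.sqrt_one]
    congr 1
    rw [← hv]
    exact Finset.sum_congr rfl fun i _ => (Complex.normSq_eq_norm_sq _).symm
  have hon : Orthonormal ℂ (Set.domRestrict {(0 : Fin (q + 1))} fun _ : Fin (q + 1) => w) := by
    rw [orthonormal_iff_ite]
    rintro ⟨i, hi⟩ ⟨j, hj⟩
    rw [Set.mem_singleton_iff] at hi hj
    subst hi hj
    change inner ℂ w w = _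
    rw [inner_self_eq_norm_sq_to_K, hnorm]
    simp
  obtain ⟨b, hb⟩ := hon.exists_orthonormalBasis_extension_of_card_eq (by simp)
  refine ⟨of fun i j => b i j, ?_, ?_⟩
  · rw [mem_unitaryGroup_iff]
    ext i j
    have h1 := orthonormal_iff_ite.mp b.orthonormal j i
    rw [mul_apply]
    rw [EuclideanSpace.inner_eq_star_dotProduct, dotProduct] at h1
    rw [one_apply]
    simp only [eq_comm (a := i)]
    rw [← h1]
    exact Finset.sum_congr rfl fun x _ => rfl
  · intro i
    have := hb 0 (Set.mem_singleton 0)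
    rw [of_apply, this]

/-- The first row of the first block runs through the unit sphere. -/
theorem FirstBlock.exists_row (h : FirstBlock S S' p m) (v : Fin (m + 1) → ℂ)
    (hv : ∑ i, Complex.normSq (v i) = 1) :
    ∃ k : compactK S, ∀ i, (toMat k).submatrix h.emb h.emb 0 i = v i := by
  obtain ⟨A, hA, hAv⟩ := exists_unitary_row v hv
  have h1 := h.toMat_respects 1
  refine ⟨⟨⟨h.graft A (toMat (1 : compactK S)), h.graft_mem_unitary hA h1 (toMat_unitary 1)⟩, ?_⟩, ?_⟩
  · intro i j hij
    change h.graft A (toMat (1 : compactK S)) i j = 0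
    by_cases hi : InBlock p m i <;> by_cases hj : InBlock p m j
    · exact absurd ((h.sameBlock_iff hi).mpr hj) hij
    · obtain ⟨a, rfl⟩ := h.exists_emb hi
      exact h.graft_left _ _ _ hj
    · obtain ⟨a, rfl⟩ := h.exists_emb hj
      exact h.graft_right _ _ _ hi
    · rw [h.graft_out _ _ hi hj]
      exact h1 _ _ hij
  · intro i
    change h.graft A _ (h.emb 0) (h.emb i) = v i
    rw [h.graft_emb, hAv]

/-! ### The corner of a Hermitian matrix with given spectrum -/

open Polynomial in
/-- The characteristic polynomial of the corner of `V D Vᴴ`. -/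
theorem charpoly_corner {V : Matrix (Fin (m + 1)) (Fin (m + 1)) ℂ}
    (hV : V ∈ unitaryGroup (Fin (m + 1)) ℂ) (a : Fin (m + 1) → ℂ) :
    ((V * diagonal a * Vᴴ).submatrix Fin.succ Fin.succ).charpoly
      = ∑ i, C (V 0 i * star (V 0 i)) * omitPoly a i := by
  have hVV : V * Vᴴ = 1 := mem_unitaryGroup_iff.mp hV
  set W : Matrix (Fin (m + 1)) (Fin (m + 1)) ℂ[X] := V.map C with hW
  set W' : Matrix (Fin (m + 1)) (Fin (m + 1)) ℂ[X] := Vᴴ.map C with hW'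
  have hWW : W * W' = 1 := by
    rw [hW, hW', ← Matrix.map_mul, hVV]
    simp
  have hWW' : W' * W = 1 := mul_eq_one_comm.mp hWW
  have hchar : charmatrix (V * diagonal a * Vᴴ) = W * diagonal (fun i => X - C (a i)) * W' := by
    have h1 : diagonal (fun i => (X : ℂ[X]) - C (a i)) = scalar _ X - (diagonal a).map C := by
      rw [diagonal_map (by simp)]
      simp [scalar_apply, diagonal_sub]
    have h2 : (scalar (Fin (m + 1)) (X : ℂ[X])) = W * scalar (Fin (m + 1)) (X : ℂ[X]) * W' := by
      rw [← (scalar_commute (X : ℂ[X]) (fun _ => Commute.all _ _) W).eq, Matrix.mul_assoc, hWW,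
        Matrix.mul_one]
    rw [h1, Matrix.mul_sub, Matrix.sub_mul, ← h2, charmatrix]
    simp [hW, hW', Matrix.map_mul]
  -- The characteristic polynomial of the corner is the (0,0) entry of the adjugate of z − V D V*.
  -- Adjugates are transported by conjugation, and that of a diagonal matrix consists of the
  -- products omitting one factor.
  have hadj : adjugate (charmatrix (V * diagonal a * Vᴴ))
      = W * adjugate (diagonal fun i => (X : ℂ[X]) - C (a i)) * W' := by
    have hdet : W.det * W'.det = 1 := by rw [← det_mul, hWW, det_one]
    have e1 : adjugate W' = W'.det • W := by
      have := congrArg (fun M => W * M) (mul_adjugate W')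
      simp only [← Matrix.mul_assoc, hWW, Matrix.one_mul] at this
      rw [this]
      simp
    have e2 : adjugate W = W.det • W' := by
      have := congrArg (fun M => W' * M) (mul_adjugate W)
      simp only [← Matrix.mul_assoc, hWW', Matrix.one_mul] at this
      rw [this]
      simp
    rw [hchar, adjugate_mul_distrib, adjugate_mul_distrib, e1, e2]
    simp only [Matrix.smul_mul, Matrix.mul_smul, smul_smul, Matrix.mul_assoc]
    rw [hdet, one_smul]
  have hsub : charmatrix ((V * diagonal a * Vᴴ).submatrix Fin.succ Fin.succ)
      = (charmatrix (V * diagonal a * Vᴴ)).submatrix Fin.succ Fin.succ := by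
    ext1 i j
    by_cases hij : i = j
    · subst hij; simp
    · simp [hij]
  have hcorner := congrFun (congrFun hadj 0) 0
  rw [adjugate_fin_succ_eq_det_submatrix] at hcorner
  rw [charpoly, hsub]
  simp only [Fin.val_zero, add_zero, pow_zero, one_mul, Fin.succAbove_zero] at hcorner
  refine hcorner.trans ?_
  rw [adjugate_diagonal, mul_apply]
  refine Finset.sum_congr rfl fun i _ => ?_
  rw [mul_diagonal, omitPoly]
  have h4 : ∏ j ∈ Finset.univ.erase i, ((X : ℂ[X]) - C (a j)) = ∏ j, (X - C (a (i.succAbove j))) := by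
    have : Finset.univ.erase i = ({i}ᶜ : Finset (Fin (m + 1))) := by ext j; simp
    rw [this, ← Fin.image_succAbove_univ,
      Finset.prod_image fun _ _ _ _ h => Fin.succAbove_right_injective h]
  rw [h4, hW, hW']
  simp only [map_apply, conjTranspose_apply, C_mul]
  ring

/-- Sorting both families gives the same list. -/
theorem exists_perm_of_map_eq {f g : Fin m → ℝ}
    (h : Multiset.map f Finset.univ.val = Multiset.map g Finset.univ.val) :
    ∃ σ : Equiv.Perm (Fin m), g = f ∘ σ := by
  have key : ∀ f : Fin m → ℝ, Multiset.map f Finset.univ.val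
      = (List.ofFn (f ∘ Tuple.sort f) : Multiset ℝ) := by
    intro f
    rw [Fin.univ_val_map]
    exact Multiset.coe_eq_coe.mpr (Equiv.Perm.ofFn_comp_perm _ f).symm
  rw [key, key, Multiset.coe_eq_coe] at h
  have h2 : f ∘ Tuple.sort f = g ∘ Tuple.sort g :=
    List.ofFn_injective (h.eq_of_pairwise' (Tuple.monotone_sort f).sortedLE_ofFn.pairwise
      (Tuple.monotone_sort g).sortedLE_ofFn.pairwise)
  refine ⟨(Tuple.sort g).symm.trans (Tuple.sort f), ?_⟩
  ext i
  have := congrFun h2 ((Tuple.sort g).symm i)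
  simp only [Function.comp_apply, Equiv.apply_symm_apply] at this
  simp [this]

/-- A Hermitian matrix is unitarily equivalent to any diagonal matrix with the same
characteristic polynomial. -/
theorem exists_unitary_diagonal {B : Matrix (Fin m) (Fin m) ℂ} (hB : B.IsHermitian) {b : Fin m → ℝ}
    (hchar : B.charpoly = ∏ j, (Polynomial.X - Polynomial.C (b j : ℂ))) :
    ∃ U ∈ unitaryGroup (Fin m) ℂ, B = U * diagonal (fun j => (b j : ℂ)) * Uᴴ := by
  have h1 := hB.roots_charpoly_eq_eigenvalues
  have h2 : (∏ j, (Polynomial.X - Polynomial.C (b j : ℂ))).roots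
      = Multiset.map (fun j => (b j : ℂ)) Finset.univ.val := by
    rw [Polynomial.roots_prod _ _ (Finset.prod_ne_zero_iff.mpr fun j _ =>
      Polynomial.X_sub_C_ne_zero _)]
    simp
  rw [hchar, h2] at h1
  have h4 := congrArg (Multiset.map Complex.re) h1
  rw [Multiset.map_map, Multiset.map_map] at h4
  obtain ⟨σ, hσ⟩ := exists_perm_of_map_eq h4.symm
  have hσ' : ∀ j, b j = hB.eigenvalues (σ j) := fun j => by simpa using congrFun hσ j
  set Q : Matrix (Fin m) (Fin m) ℂ := hB.eigenvectorUnitary.1 with hQ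
  have hQu : Q * Qᴴ = 1 := mem_unitaryGroup_iff.mp hB.eigenvectorUnitary.2
  refine ⟨Q.submatrix id σ, ?_, ?_⟩
  · rw [mem_unitaryGroup_iff, star_eq_conjTranspose, conjTranspose_submatrix,
      submatrix_mul_equiv, hQu, submatrix_id_id]
  · have hd : diagonal (fun j => (b j : ℂ))
        = (diagonal ((RCLike.ofReal : ℝ → ℂ) ∘ hB.eigenvalues)).submatrix σ σ := by
      rw [submatrix_diagonal_equiv]
      congr 1
      ext j
      rw [hσ' j]
      rfl
    rw [hd, conjTranspose_submatrix, submatrix_mul_equiv, submatrix_mul_equiv, submatrix_id_id]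
    have h3 := hB.spectral_theorem
    rw [Unitary.conjStarAlgAut_apply] at h3
    exact h3

end Graft

end SphericalGL
namespace SphericalGL

open Matrix MeasureTheory

section Parabolic

variable {n : ℕ} {S S' : Finset (Fin (n - 1))} {p m : ℕ}

/-! ### The inner integral of the recursion -/

theorem gram_mul_expDiag (A : Matrix (Fin n) (Fin n) ℂ) (X : Fin n → ℝ) :
    (A * expDiag fun i => (X i : ℂ)) * (A * expDiag fun i => (X i : ℂ))ᴴ
      = A * diagonal (fun i => ((Real.exp (2 * X i) : ℝ) : ℂ)) * Aᴴ := by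
  have h : expDiag (fun i => (X i : ℂ)) * expDiag (fun i => (X i : ℂ))
      = diagonal (fun i => ((Real.exp (2 * X i) : ℝ) : ℂ)) := by
    rw [← expDiag_add, expDiag]
    congr 1
    ext i
    push_cast
    congr 1
    simp only [Pi.add_apply]
    ring
  rw [conjTranspose_mul, expDiag_conjTranspose, Matrix.mul_assoc, ← Matrix.mul_assoc (expDiag _), h,
    Matrix.mul_assoc]

/-- The matrix `1 ⊕ U`. -/
def oneSum (U : Matrix (Fin m) (Fin m) ℂ) : Matrix (Fin (m + 1)) (Fin (m + 1)) ℂ := of fun i j =>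
  Fin.cases (motive := fun _ => ℂ) (Fin.cases (motive := fun _ => ℂ) 1 (fun _ => 0) j)
    (fun i => Fin.cases (motive := fun _ => ℂ) 0 (fun j => U i j) j) i

theorem oneSum_conj (U : Matrix (Fin m) (Fin m) ℂ) (d : Fin (m + 1) → ℂ) (i j : Fin m) :
    (oneSum U * diagonal d * (oneSum U)ᴴ) i.succ j.succ
      = (U * diagonal (fun l : Fin m => d l.succ) * Uᴴ) i j := by
  rw [mul_diagonal_conjTranspose_apply, mul_diagonal_conjTranspose_apply, Fin.sum_univ_succ]
  simp [oneSum]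

theorem oneSum_mem_unitary {U : Matrix (Fin m) (Fin m) ℂ} (hU : U ∈ unitaryGroup (Fin m) ℂ) :
    oneSum U ∈ unitaryGroup (Fin (m + 1)) ℂ := by
  have hU' : U * Uᴴ = 1 := mem_unitaryGroup_iff.mp hU
  rw [mem_unitaryGroup_iff, star_eq_conjTranspose]
  have e1 : oneSum U * (oneSum U)ᴴ = oneSum U * diagonal 1 * (oneSum U)ᴴ := by
    have : diagonal (1 : Fin (m + 1) → ℂ) = 1 := diagonal_one
    rw [this, Matrix.mul_one]
  rw [e1]
  ext i j
  refine Fin.cases ?_ (fun i => ?_) i <;> refine Fin.cases ?_ (fun j => ?_) j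
  · rw [mul_diagonal_conjTranspose_apply, Fin.sum_univ_succ]
    simp [oneSum]
  · rw [mul_diagonal_conjTranspose_apply, Fin.sum_univ_succ]
    simp [oneSum, (Fin.succ_ne_zero j).symm]
  · rw [mul_diagonal_conjTranspose_apply, Fin.sum_univ_succ]
    simp [oneSum]
  · rw [oneSum_conj]
    have : diagonal (fun l : Fin m => (1 : Fin (m + 1) → ℂ) l.succ) = 1 := diagonal_one
    rw [this, Matrix.mul_one, hU', one_apply, one_apply]
    simp

/-- Replace the entries of `X` in the first block by the parameters `y` of the corner, and an entry
that keeps the sum. -/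
def FirstBlock.cornerX (h : FirstBlock S S' p m) (X : Fin n → ℝ) (y : Fin m → ℝ) (i : Fin n) : ℝ :=
  if hi : InBlock p m i then
    (Fin.cons (∑ a, X (h.emb a) - ∑ j, y j) y : Fin (m + 1) → ℝ)
      ⟨i - p, by have := hi.1; have := hi.2; omega⟩
  else X i

theorem FirstBlock.cornerX_emb (h : FirstBlock S S' p m) (X : Fin n → ℝ) (y : Fin m → ℝ)
    (a : Fin (m + 1)) : h.cornerX X y (h.emb a)
      = (Fin.cons (∑ a, X (h.emb a) - ∑ j, y j) y : Fin (m + 1) → ℝ) a := by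
  simp [cornerX, h.inBlock_emb, h.val_emb]

theorem FirstBlock.cornerX_out (h : FirstBlock S S' p m) (X : Fin n → ℝ) (y : Fin m → ℝ)
    {i : Fin n} (hi : ¬ InBlock p m i) : h.cornerX X y i = X i := by
  simp [cornerX, hi]

/-- A tail starting at j ≤ p contains the whole first block, and the entry at p was chosen to keep
the block sum. -/
theorem FirstBlock.sum_cornerX (h : FirstBlock S S' p m) (X : Fin n → ℝ) (y : Fin m → ℝ) {j : ℕ}
    (hj : j ≤ p) : ∑ i : {i : Fin n // j ≤ (i : ℕ)}, h.cornerX X y i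
      = ∑ i : {i : Fin n // j ≤ (i : ℕ)}, X i := by
  have key : ∀ Z : Fin n → ℝ, ∑ l : {l : Fin n // j ≤ (l : ℕ)}, Z l
      = ∑ l ∈ Finset.univ.filter (fun l : Fin n => j ≤ (l : ℕ)), Z l := fun Z =>
    (Finset.sum_subtype (Finset.univ.filter (fun l : Fin n => j ≤ (l : ℕ))) (by simp) Z).symm
  rw [key, key, ← sub_eq_zero, ← Finset.sum_sub_distrib, Finset.sum_filter, h.sum_block]
  · have : ∀ a, j ≤ (h.emb a : ℕ) := fun a => by rw [h.val_emb]; omega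
    simp only [this, if_true, Finset.sum_sub_distrib, h.cornerX_emb]
    rw [Fin.sum_univ_succ]
    simp
  · intro i hi
    rw [h.cornerX_out _ _ hi, sub_self, ite_self]

/-- All indices below p form blocks of size one, so no block crosses a cut at j ≤ p. -/
theorem FirstBlock.cut (h : FirstBlock S S' p m) (k : compactK S) {j : ℕ} (hj : j ≤ p) :
    ∀ i x : Fin n, j ≤ (i : ℕ) → (x : ℕ) < j → toMat k i x = 0 := by
  intro i x hi hx
  refine toMat_eq_zero k fun hs => ?_
  have := h.low x i (by omega) hs.symm
  subst this
  omega

/-- In S' the index p has become a block of its own, so the cut may be moved up to p + 1. -/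
theorem FirstBlock.cut_succ (h : FirstBlock S S' p m) (k : compactK S') :
    ∀ i x : Fin n, p + 1 ≤ (i : ℕ) → (x : ℕ) < p + 1 → toMat k i x = 0 := by
  intro i x hi hx
  refine toMat_eq_zero k fun hs => ?_
  have h1 := ((h.erase _ _).mp hs).2
  have := h.low x i (by omega) (h.le hs).symm
  subst this
  omega

theorem det_low_unitary {j : ℕ} {k : Matrix (Fin n) (Fin n) ℂ} (hk : k ∈ unitaryGroup (Fin n) ℂ)
    (hc : ∀ i x : Fin n, j ≤ (i : ℕ) → (x : ℕ) < j → k i x = 0) :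
    (low j k).det * star (low j k).det = 1 := by
  have hk' : k * kᴴ = 1 := mem_unitaryGroup_iff.mp hk
  have h1 := low_conj (M := 1) hc
  rw [Matrix.mul_one, hk'] at h1
  have h2 : low j (1 : Matrix (Fin n) (Fin n) ℂ) = 1 := by
    ext i l
    simp [low, one_apply, Subtype.ext_iff]
  rw [h2, Matrix.mul_one] at h1
  rw [← det_conjTranspose, ← det_mul, ← h1, det_one]

/-- At such a cut k is block diagonal with a unitary corner, hence the minor does not depend on k.
-/
theorem FirstBlock.lowMinor_eq_of_le (h : FirstBlock S S' p m) (k : compactK S) (X : Fin n → ℝ)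
    {j : ℕ} (hj : j ≤ p) :
    lowMinor j (toMat k * expDiag fun i => (X i : ℂ))
      = Complex.exp ((2 * ∑ i : {i : Fin n // j ≤ (i : ℕ)}, X i : ℝ) : ℂ) := by
  have hd : (diagonal fun i => ((Real.exp (2 * X i) : ℝ) : ℂ))
      = expDiag fun i => ((2 * X i : ℝ) : ℂ) := by
    simp [expDiag]
  rw [lowMinor, gram_mul_expDiag, low_conj (h.cut k hj), det_mul, det_mul, det_conjTranspose,
    mul_right_comm, det_low_unitary (toMat_unitary k) (h.cut k hj), one_mul, hd, det_low_expDiag]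
  rw [Finset.mul_sum, Complex.ofReal_sum]

/-- Minors at j ≤ p involve only tail sums, which X and `cornerX` share. Minors at j > p lie inside
the corner from p + 1 on, where g acts on the Gram matrix by conjugation with its own corner. -/
theorem FirstBlock.minorH_eq_of_low (h : FirstBlock S S' p m) (X : Fin n → ℝ) (y : Fin m → ℝ)
    (k : compactK S) (k₁ : compactK S')
    (hlow : SphericalGL.low (p + 1)
        (toMat k * diagonal (fun i => ((Real.exp (2 * X i) : ℝ) : ℂ)) * (toMat k)ᴴ)
      = SphericalGL.low (p + 1) (toMat k₁ *
        diagonal (fun i => ((Real.exp (2 * h.cornerX X y i) : ℝ) : ℂ)) * (toMat k₁)ᴴ))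
    (g : compactK S') :
    minorH (toMat g * (toMat k * expDiag fun i => (X i : ℂ)))
      = minorH (toMat (g * k₁) * expDiag fun i => (h.cornerX X y i : ℂ)) := by
  set D : Fin n → ℂ := fun i => ((Real.exp (2 * X i) : ℝ) : ℂ) with hD
  set D' : Fin n → ℂ := fun i => ((Real.exp (2 * h.cornerX X y i) : ℝ) : ℂ) with hD'
  have hminor : ∀ j, lowMinor j (toMat g * (toMat k * expDiag fun i => (X i : ℂ)))
      = lowMinor j (toMat (g * k₁) * expDiag fun i => (h.cornerX X y i : ℂ)) := by
    intro j
    rcases le_or_gt j p with hj | hj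
    · have e1 : toMat g * (toMat k * expDiag fun i => (X i : ℂ))
          = toMat (Subgroup.inclusion h.compactK_le g * k) * expDiag fun i => (X i : ℂ) := by
        rw [toMat_mul, Matrix.mul_assoc]
        rfl
      have e2 : toMat (g * k₁) = toMat (Subgroup.inclusion h.compactK_le (g * k₁)) := rfl
      rw [e1, e2, h.lowMinor_eq_of_le _ _ hj, h.lowMinor_eq_of_le _ _ hj, h.sum_cornerX X y hj]
    · have e1 : (toMat g * (toMat k * expDiag fun i => (X i : ℂ))) *
          (toMat g * (toMat k * expDiag fun i => (X i : ℂ)))ᴴ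
          = toMat g * (toMat k * diagonal D * (toMat k)ᴴ) * (toMat g)ᴴ := by
        rw [hD, ← gram_mul_expDiag, conjTranspose_mul]
        simp only [Matrix.mul_assoc]
      have e2 : (toMat (g * k₁) * expDiag fun i => (h.cornerX X y i : ℂ)) *
          (toMat (g * k₁) * expDiag fun i => (h.cornerX X y i : ℂ))ᴴ
          = toMat g * (toMat k₁ * diagonal D' * (toMat k₁)ᴴ) * (toMat g)ᴴ := by
        rw [gram_mul_expDiag, toMat_mul, conjTranspose_mul]
        simp only [Matrix.mul_assoc, hD']
      have e3 : SphericalGL.low (p + 1) (toMat g * (toMat k * diagonal D * (toMat k)ᴴ) * (toMat g)ᴴ)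
          = SphericalGL.low (p + 1) (toMat g * (toMat k₁ * diagonal D' * (toMat k₁)ᴴ) * (toMat g)ᴴ) := by
        rw [low_conj (h.cut_succ g), low_conj (h.cut_succ g), hlow]
      rw [lowMinor, lowMinor, e1, e2]
      congr 1
      ext ⟨i, hi⟩ ⟨l, hl⟩
      exact congrFun (congrFun e3 ⟨i, by omega⟩) ⟨l, by omega⟩
  ext i
  rw [minorH, minorH, hminor, hminor]

/-- The Cartan type parameters of the corner: left translates by the smaller Levi subgroup see only
them. -/
theorem FirstBlock.exists_minorH_eq (h : FirstBlock S S' p m) {X : Fin n → ℝ}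
    (hX : StrictAnti fun i => X (h.emb i)) (k : compactK S) {y : Fin m → ℝ}
    (hk : ∀ i, Complex.normSq (toMat k (h.emb 0) (h.emb i))
      = weight (fun i => Real.exp (2 * X (h.emb i))) (fun j => Real.exp (2 * y j)) i) :
    ∃ k₁ : compactK S', ∀ g : compactK S',
      minorH (toMat g * (toMat k * expDiag fun i => (X i : ℂ)))
        = minorH (toMat (g * k₁) * expDiag fun i => (h.cornerX X y i : ℂ)) := by
  have hr := h.toMat_respects k
  set V := (toMat k).submatrix h.emb h.emb with hV
  have hVu := h.submatrix_mem_unitary hr (toMat_unitary k)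
  set D : Fin n → ℂ := fun i => ((Real.exp (2 * X i) : ℝ) : ℂ) with hD
  set D' : Fin n → ℂ := fun i => ((Real.exp (2 * h.cornerX X y i) : ℝ) : ℂ) with hD'
  set A := V * diagonal (fun i => D (h.emb i)) * Vᴴ with hA
  have hAh : A.IsHermitian := by
    refine isHermitian_mul_mul_conjTranspose V ?_
    rw [IsHermitian, diagonal_conjTranspose]
    congr 1
    ext i
    simp only [hD, Pi.star_apply, Complex.star_def, Complex.conj_ofReal]
  -- The squared moduli of the first row are the interlacing weights of y, so the Lagrange identity
  -- rewrites the polynomial of `charpoly_corner` as ∏(z − e^{2y_j}).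
  have hchar : (A.submatrix Fin.succ Fin.succ).charpoly
      = ∏ j, (Polynomial.X - Polynomial.C (((Real.exp (2 * y j) : ℝ) : ℂ))) := by
    rw [hA, charpoly_corner hVu]
    have h1 := congrArg (Polynomial.map Complex.ofRealHom) (sum_weight_omitPoly
      (fun i => Real.exp (2 * X (h.emb i))) (strictAnti_exp hX) (fun j => Real.exp (2 * y j)))
    rw [Polynomial.map_sum, Polynomial.map_prod] at h1
    simp only [Polynomial.map_mul, Polynomial.map_sub, Polynomial.map_X, Polynomial.map_C, omitPoly,
      Polynomial.map_prod] at h1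
    refine Eq.trans (Finset.sum_congr rfl fun i _ => ?_) h1
    rw [omitPoly]
    congr 2
    rw [← hk i, Complex.star_def, Complex.mul_conj]
    rfl
  obtain ⟨U, hU, hUB⟩ := exists_unitary_diagonal (hAh.submatrix Fin.succ) hchar
  set A' := oneSum U * diagonal (fun i => D' (h.emb i)) * (oneSum U)ᴴ with hA'
  have hAA : ∀ i j : Fin m, A i.succ j.succ = A' i.succ j.succ := by
    intro i j
    have h1 := congrFun (congrFun hUB i) j
    rw [submatrix_apply] at h1
    rw [h1, hA', oneSum_conj]
    simp [hD', h.cornerX_emb]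
  -- The element k₁ keeps k outside the first block and has 1 ⊕ U on it, with U diagonalising the
  -- corner. It lies in K_{S'} and reproduces the Gram matrix from index p + 1 on.
  have hmem : h.graft (oneSum U) (toMat k) ∈ unitaryGroup (Fin n) ℂ :=
    h.graft_mem_unitary (oneSum_mem_unitary hU) hr (toMat_unitary k)
  have hmem' : (⟨h.graft (oneSum U) (toMat k), hmem⟩ : unitaryGroup (Fin n) ℂ) ∈ compactK S' := by
    intro i j hij
    change h.graft (oneSum U) (toMat k) i j = 0
    by_cases hi : InBlock p m i <;> by_cases hj : InBlock p m j
    · obtain ⟨a, rfl⟩ := h.exists_emb hi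
      obtain ⟨b, rfl⟩ := h.exists_emb hj
      rw [h.graft_emb]
      revert hij
      refine Fin.cases ?_ (fun a => ?_) a <;> refine Fin.cases ?_ (fun b => ?_) b <;> intro hij
      · exact absurd (SameBlock.rfl _ _) hij
      · simp [oneSum]
      · simp [oneSum]
      · exact absurd (h.sameBlock'_emb_succ a b) hij
    · obtain ⟨a, rfl⟩ := h.exists_emb hi
      exact h.graft_left _ _ _ hj
    · obtain ⟨a, rfl⟩ := h.exists_emb hj
      exact h.graft_right _ _ _ hi
    · rw [h.graft_out _ _ hi hj]
      exact toMat_eq_zero k fun hs => hij ((h.sameBlock'_iff_of_not hi).mpr hs)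
  obtain ⟨k₁, hk₁⟩ : ∃ k₁ : compactK S', toMat k₁ = h.graft (oneSum U) (toMat k) :=
    ⟨⟨⟨_, hmem⟩, hmem'⟩, rfl⟩
  refine ⟨k₁, h.minorH_eq_of_low X y k k₁ ?_⟩
  have hM : toMat k * diagonal D * (toMat k)ᴴ = h.graft A (toMat k * diagonal D * (toMat k)ᴴ) := by
    have h1 := h.graft_conj V hr D
    rwa [h.graft_submatrix hr] at h1
  have hM' : toMat k₁ * diagonal D' * (toMat k₁)ᴴ
      = h.graft A' (toMat k * diagonal D' * (toMat k)ᴴ) := by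
    rw [hk₁]
    exact h.graft_conj (oneSum U) hr D'
  have hlow : SphericalGL.low (p + 1) (toMat k * diagonal D * (toMat k)ᴴ)
      = SphericalGL.low (p + 1) (toMat k₁ * diagonal D' * (toMat k₁)ᴴ) := by
    rw [hM, hM']
    ext ⟨i, hi⟩ ⟨j, hj⟩
    simp only [SphericalGL.low, submatrix_apply]
    by_cases hbi : InBlock p m i <;> by_cases hbj : InBlock p m j
    · obtain ⟨a, rfl⟩ := h.exists_emb hbi
      obtain ⟨b, rfl⟩ := h.exists_emb hbj
      rw [h.graft_emb, h.graft_emb]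
      rw [h.val_emb] at hi hj
      obtain ⟨a, rfl⟩ := Fin.exists_succ_eq.mpr (show a ≠ 0 by rintro rfl; simp at hi)
      obtain ⟨b, rfl⟩ := Fin.exists_succ_eq.mpr (show b ≠ 0 by rintro rfl; simp at hj)
      exact hAA a b
    · obtain ⟨a, rfl⟩ := h.exists_emb hbi
      rw [h.graft_left _ _ _ hbj, h.graft_left _ _ _ hbj]
    · obtain ⟨a, rfl⟩ := h.exists_emb hbj
      rw [h.graft_right _ _ _ hbi, h.graft_right _ _ _ hbi]
    · rw [h.graft_out _ _ hbi hbj, h.graft_out _ _ hbi hbj, mul_diagonal_conjTranspose_apply,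
        mul_diagonal_conjTranspose_apply]
      refine Finset.sum_congr rfl fun x _ => ?_
      by_cases hx : InBlock p m x
      · obtain ⟨a, rfl⟩ := h.exists_emb hx
        rw [hr.out_emb hbi]
        simp
      · simp only [hD, hD', h.cornerX_out _ _ hx]
  exact hlow

/-- The inner integral of the recursion is a spherical integral of the smaller Levi subgroup. -/
theorem FirstBlock.inner_integral (h : FirstBlock S S' p m) {X : Fin n → ℝ}
    (hX : StrictAnti fun i => X (h.emb i)) (l : Fin n → ℂ) (k : compactK S) {y : Fin m → ℝ}
    (hk : ∀ i, Complex.normSq (toMat k (h.emb 0) (h.emb i))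
      = weight (fun i => Real.exp (2 * X (h.emb i))) (fun j => Real.exp (2 * y j)) i) :
    ∫ g : compactK S', Complex.exp (pairing (l + rho S) fun i =>
        ((minorH (toMat (Subgroup.inclusion h.compactK_le g * k) *
          expDiag fun i => (X i : ℂ)) i : ℝ) : ℂ)) ∂haarK S'
      = sphInt S' (l + rhoShift p m) (h.cornerX X y) := by
  obtain ⟨k₁, hk₁⟩ := h.exists_minorH_eq hX k hk
  have h1 : ∀ g : compactK S', minorH (toMat (Subgroup.inclusion h.compactK_le g * k) *
      expDiag fun i => (X i : ℂ))
      = minorH (toMat (g * k₁) * expDiag fun i => (h.cornerX X y i : ℂ)) := by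
    intro g
    rw [← hk₁ g, toMat_mul, Matrix.mul_assoc]
    rfl
  simp only [h1]
  have h2 : l + rho S = l + rhoShift p m + rho S' := by rw [h.rho_eq, add_assoc, add_comm (rho S')]
  rw [h2]
  -- Right invariance of the Haar measure on K_{S'} absorbs k₁; the difference of the two ρ's has
  -- been moved into the parameter.
  exact integral_mul_right_eq_self (μ := haarK S') (fun g => Complex.exp (pairing
    (l + rhoShift p m + rho S') fun i =>
      ((minorH (toMat g * expDiag fun i => (h.cornerX X y i : ℂ)) i : ℝ) : ℂ))) k₁

end Parabolic

end SphericalGL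
namespace SphericalGL

open Matrix MeasureTheory

section Recursion

/-! ### The recursion for spherical integrals -/

/-- Transfers the law of the squared moduli from nonnegative to complex integrands. Applied to the
indicator of the complement, the same law shows that almost every row lies in the open simplex. -/
theorem ae_row_normSq_and_integral {q : ℕ} {G : Type*} [Group G] [TopologicalSpace G]
    [IsTopologicalGroup G]
    [MeasurableSpace G] [BorelSpace G] (μ : Measure G) [IsProbabilityMeasure μ]
    [μ.IsMulLeftInvariant] (V : G → Matrix (Fin (q + 1)) (Fin (q + 1)) ℂ) (hVc : Continuous V)
    (hVm : ∀ a b, V (a * b) = V a * V b) (hVu : ∀ a, V a ∈ Matrix.unitaryGroup (Fin (q + 1)) ℂ)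
    (hVt : ∀ v : Fin (q + 1) → ℂ, ∑ i, Complex.normSq (v i) = 1 → ∃ a, ∀ i, V a 0 i = v i) :
    (∀ᵐ a ∂μ, (∀ i, 0 < Complex.normSq (V a 0 i)) ∧ ∑ i, Complex.normSq (V a 0 i) = 1) ∧
    ∀ J : (Fin (q + 1) → ℝ) → ℂ, Measurable J →
      ∫ a, J (fun i => Complex.normSq (V a 0 i)) ∂μ
        = ∫ u in {u : Fin (q + 1) → ℝ | ∀ i, 0 < u i},
          Real.exp (-∑ i, u i) • J (fun i => u i / ∑ l, u l) := by
  have hO : MeasurableSet {u : Fin (q + 1) → ℝ | ∀ i, 0 < u i} := by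
    simp only [Set.ofPred_forall]
    exact MeasurableSet.iInter fun i => measurableSet_lt measurable_const (measurable_pi_apply i)
  have ht : Measurable fun a i => Complex.normSq (V a 0 i) := by
    refine measurable_pi_lambda _ fun i => ?_
    exact (Complex.continuous_normSq.comp (hVc.matrix_elem 0 i)).measurable
  have hlaw := fun (g : (Fin (q + 1) → ℝ) → ENNReal) (hg : Measurable g) =>
    lintegral_row_normSq μ V hVc hVm hVu hVt hg
  constructor
  · have hA : MeasurableSet {t : Fin (q + 1) → ℝ | (∀ i, 0 < t i) ∧ ∑ i, t i = 1}ᶜ :=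
      (hO.inter (measurableSet_eq_fun (by fun_prop) measurable_const)).compl
    rw [ae_iff]
    have h1 := hlaw _ (measurable_const.indicator hA : Measurable
      (Set.indicator _ fun _ => (1 : ENNReal)))
    have h2 : ∫⁻ u in {u : Fin (q + 1) → ℝ | ∀ i, 0 < u i},
        ({t : Fin (q + 1) → ℝ | (∀ i, 0 < t i) ∧ ∑ i, t i = 1}ᶜ.indicator (fun _ => (1 : ENNReal))
          (fun i => u i / ∑ l, u l)) * ENNReal.ofReal (Real.exp (-∑ i, u i)) = 0 := by
      rw [setLIntegral_congr_fun (g := 0) hO fun u hu => ?_]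
      · simp
      · have hs : 0 < ∑ l, u l := Finset.sum_pos (fun i _ => hu i) Finset.univ_nonempty
        have : (fun i => u i / ∑ l, u l) ∉ {t : Fin (q + 1) → ℝ | (∀ i, 0 < t i) ∧ ∑ i, t i = 1}ᶜ := by
          simp only [Set.mem_compl_iff, not_not, Set.mem_ofPred_eq]
          refine ⟨fun i => div_pos (hu i) hs, ?_⟩
          rw [← Finset.sum_div, div_self hs.ne']
        rw [Set.indicator_of_notMem this, zero_mul]
        rfl
    rw [h2] at h1
    rw [← lintegral_indicator_one₀]
    · rw [← h1]
      rfl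
    · exact (ht hA).nullMeasurableSet
  · intro J hJ
    set E : (Fin (q + 1) → ℝ) → ENNReal := fun u => ENNReal.ofReal (Real.exp (-∑ i, u i)) with hE
    have hEm : Measurable E := by fun_prop
    have hN : Measurable fun (u : Fin (q + 1) → ℝ) i => u i / ∑ l, u l := by fun_prop
    have hmap : μ.map (fun a i => Complex.normSq (V a 0 i))
        = ((volume.restrict {u : Fin (q + 1) → ℝ | ∀ i, 0 < u i}).withDensity E).map
          (fun u i => u i / ∑ l, u l) := by
      refine Measure.ext_of_lintegral _ fun g hg => ?_
      rw [lintegral_map hg ht, lintegral_map hg hN,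
        lintegral_withDensity_eq_lintegral_mul _ hEm (g := fun u => g fun i => u i / ∑ l, u l)
          (hg.comp hN)]
      refine (hlaw g hg).trans (lintegral_congr fun u => ?_)
      rw [Pi.mul_apply, mul_comm]
    rw [← integral_map ht.aemeasurable hJ.aestronglyMeasurable, hmap,
      integral_map hN.aemeasurable hJ.aestronglyMeasurable,
      integral_withDensity_eq_integral_toReal_smul hEm (by simp [E])]
    simp only [hE, ENNReal.toReal_ofReal (Real.exp_pos _).le]

/-- The inner integral of the recursion is known in the coordinates (mass, y), whereas the law of
the row concerns its squared moduli. The chart, being a measurable embedding, carries the function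
over measurably. -/
theorem exists_measurable_chart {m : ℕ} {x : Fin (m + 1) → ℝ} (hx : StrictAnti x)
    {Ψ : (Fin (m + 1) → ℝ) → ℂ} (hΨ : Measurable Ψ) :
    ∃ J : (Fin (m + 1) → ℝ) → ℂ, Measurable J ∧ ∀ c ∈ chartBox x, J (chart x c) = Ψ c := by
  have hemb : MeasurableEmbedding ((chartBox x).domRestrict (chart x)) :=
    measurableEmbedding_of_fderivWithin (measurableSet_chartBox x)
      (fun c _ => (hasFDerivAt_chart x c).hasFDerivWithinAt) (injOn_chart hx)
  obtain ⟨J, hJ, h⟩ := hemb.exists_measurable_extend (hΨ.comp measurable_subtype_coe)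
    fun _ => ⟨0⟩
  exact ⟨J, hJ, fun c hc => congrFun h ⟨c, hc⟩⟩

variable {n : ℕ} {S S' : Finset (Fin (n - 1))} {p m : ℕ}

theorem FirstBlock.continuous_cornerX (h : FirstBlock S S' p m) (X : Fin n → ℝ) :
    Continuous fun y : Fin m → ℝ => h.cornerX X y := by
  refine continuous_pi fun i => ?_
  by_cases hi : InBlock p m i
  · obtain ⟨a, rfl⟩ := h.exists_emb hi
    simp only [h.cornerX_emb]
    refine Fin.cases ?_ (fun a => ?_) a
    · simp only [Fin.cons_zero]
      fun_prop
    · simp only [Fin.cons_succ]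
      fun_prop
  · simp only [h.cornerX_out _ _ hi]
    exact continuous_const

/-- One step of the recursion: average over K_{S'}, recognise the inner integral as a function of
the first row's squared moduli, insert their law, and pass to interlacing coordinates. -/
theorem FirstBlock.sphInt_eq (h : FirstBlock S S' p m) {X : Fin n → ℝ}
    (hX : StrictAnti fun i => X (h.emb i)) (l : Fin n → ℂ) :
    sphInt S l X = ∫ c in chartBox fun i => X (h.emb i),
      (|(chartJac (fun i => X (h.emb i)) c).det| * Real.exp (-c 0)) •
        sphInt S' (l + rhoShift p m) (h.cornerX X fun j => c j.succ) := by
  set x := fun i => X (h.emb i) with hx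
  set Ψ : (Fin (m + 1) → ℝ) → ℂ := fun c =>
    sphInt S' (l + rhoShift p m) (h.cornerX X fun j => c j.succ) with hΨ
  have hΨm : Measurable Ψ := by
    refine (continuous_sphInt S' continuous_const ?_).measurable
    exact (h.continuous_cornerX X).comp (by fun_prop)
  obtain ⟨J, hJm, hJ⟩ := exists_measurable_chart hX hΨm
  have hJw : ∀ c ∈ chartBox x, J (weight (fun i => Real.exp (2 * x i))
      fun j => Real.exp (2 * c j.succ)) = Ψ c := by
    intro c hc
    -- The weights are the chart at mass 1, and Ψ ignores the mass coordinate, so resetting it to 1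
    -- is harmless.
    have hc' : (Fin.cons 1 fun j => c j.succ : Fin (m + 1) → ℝ) ∈ chartBox x := by
      rw [mem_chartBox] at hc ⊢
      simpa using hc.2
    have h1 := hJ _ hc'
    simp only [hΨ, Fin.cons_succ] at h1
    refine Eq.trans ?_ h1
    congr 1
    ext i
    simp [chart]
  obtain ⟨hae, hint⟩ := ae_row_normSq_and_integral (haarK S)
    (fun k => (toMat k).submatrix h.emb h.emb)
    ((continuous_toMat S).matrix_submatrix _ _)
    (fun a b => by
      rw [toMat_mul]
      exact h.submatrix_mul (h.toMat_respects a) _)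
    (fun a => h.submatrix_mem_unitary (h.toMat_respects a) (toMat_unitary a)) h.exists_row
  have hcont : Continuous fun k : compactK S => Complex.exp (pairing (l + rho S)
      fun i => ((minorH (toMat k * expDiag fun i => (X i : ℂ)) i : ℝ) : ℂ)) :=
    continuous_sphInt_integrand S continuous_const continuous_const continuous_id
  rw [sphInt, integral_comp_inclusion h.compactK_le hcont]
  rw [setIntegral_congr_fun (measurableSet_chartBox x) (g := fun c =>
    (|(chartJac x c).det| * Real.exp (-c 0)) • J (weight (fun i => Real.exp (2 * x i))
      fun j => Real.exp (2 * c j.succ))) fun c hc => by simp only [hJw c hc]; rfl,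
    ← integral_positive_orthant hX J, ← hint J hJm]
  refine integral_congr_ae ?_
  filter_upwards [hae] with k hk
  obtain ⟨c, hc, hck⟩ : (fun i => Complex.normSq ((toMat k).submatrix h.emb h.emb 0 i))
      ∈ chart x '' chartBox x := by
    rw [image_chart hX]
    exact hk.1
  have hc0 : c 0 = 1 := by rw [← sum_chart hX c, hck, hk.2]
  rw [← hck, hJ c hc]
  refine h.inner_integral hX l k fun i => ?_
  have h1 := congrFun hck i
  rw [chart, hc0, one_mul] at h1
  exact h1.symm

end Recursion

end SphericalGL
namespace SphericalGL

open Matrix MeasureTheory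

section DeterminantFormula

variable {n : ℕ} {S S' : Finset (Fin (n - 1))} {p m : ℕ}

/-! ### The determinant formula -/

/-- The block diagonal matrix with entries `exp (l_j X_i)`. -/
noncomputable def blockExp (S : Finset (Fin (n - 1))) (l X : Fin n → ℂ) : Matrix (Fin n) (Fin n) ℂ :=
  of fun i j => if SameBlock S i j then Complex.exp (l j * X i) else 0

/-- The part of a matrix away from the first block. -/
def outBlock (p m : ℕ) (M : Matrix (Fin n) (Fin n) ℂ) :
    Matrix {i : Fin n // ¬ InBlock p m i} {i : Fin n // ¬ InBlock p m i} ℂ :=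
  toSquareBlockProp M fun i => ¬ InBlock p m i

theorem FirstBlock.det_eq (h : FirstBlock S S' p m) {M : Matrix (Fin n) (Fin n) ℂ}
    (hM : ∀ i, ¬ InBlock p m i → ∀ j, InBlock p m j → M i j = 0) :
    M.det = (M.submatrix h.emb h.emb).det * (outBlock p m M).det := by
  rw [twoBlockTriangular_det M (InBlock p m) hM, outBlock]
  congr 1
  let e : Fin (m + 1) ≃ {i : Fin n // InBlock p m i} :=
    Equiv.ofBijective (fun a => ⟨h.emb a, h.inBlock_emb a⟩)
      ⟨fun a b hab => h.emb_injective (congrArg Subtype.val hab), fun i => by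
        obtain ⟨a, ha⟩ := h.exists_emb i.2
        exact ⟨a, Subtype.ext ha⟩⟩
  rw [← det_submatrix_equiv_self e]
  rfl

theorem FirstBlock.rhoShift_zero (h : FirstBlock S S' p m) : rhoShift p m (h.emb 0) = m := by
  simp [rhoShift, h.val_emb]

theorem FirstBlock.rhoShift_succ (h : FirstBlock S S' p m) (j : Fin m) :
    rhoShift p m (h.emb j.succ) = -1 := by
  simp [rhoShift, h.val_emb, h.inBlock_emb]

theorem rhoShift_out {i : Fin n} (hi : ¬ InBlock p m i) : rhoShift p m i = 0 := by
  have : (i : ℕ) ≠ p := fun e => hi ⟨e.ge, by omega⟩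
  simp [rhoShift, this, hi]

theorem FirstBlock.det_blockExp (h : FirstBlock S S' p m) (l X : Fin n → ℂ) :
    (blockExp S l X).det = (of fun i j => Complex.exp (l (h.emb j) * X (h.emb i))).det *
      (outBlock p m (blockExp S l X)).det := by
  rw [h.det_eq]
  · congr 2
    ext i j
    simp [blockExp, h.sameBlock_emb]
  · intro i hi j hj
    simp [blockExp, h.not_sameBlock hi hj]

/-- The split-off index contributes a 1×1 block, the exponential in front; the shift of the
parameter is m there and −1 on the rest of the first block. -/
theorem FirstBlock.det_blockExp' (h : FirstBlock S S' p m) (l : Fin n → ℂ) (X : Fin n → ℝ)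
    (y : Fin m → ℝ) :
    (blockExp S' (l + rhoShift p m) fun i => (h.cornerX X y i : ℂ)).det
      = Complex.exp ((l (h.emb 0) + m) * ((∑ i, X (h.emb i) - ∑ j, y j : ℝ) : ℂ)) *
        (of fun i j : Fin m => Complex.exp ((l (h.emb j.succ) - 1) * (y i : ℝ))).det *
        (outBlock p m (blockExp S l fun i => (X i : ℂ))).det := by
  rw [h.det_eq]
  · congr 1
    · rw [det_succ_row_zero, Fin.sum_univ_succ, Finset.sum_eq_zero]
      · have h0 : SameBlock S' (h.emb 0) (h.emb 0) := SameBlock.rfl _ _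
        simp only [submatrix_apply, blockExp, of_apply, h0, if_true, Pi.add_apply, h.rhoShift_zero,
          h.cornerX_emb, Fin.cons_zero, Fin.val_zero, pow_zero, one_mul, add_zero]
        congr 2
        ext i j
        simp [h.sameBlock'_emb_succ, h.rhoShift_succ, h.cornerX_emb, sub_eq_add_neg]
      · intro j _
        simp [blockExp, h.not_sameBlock'_zero_succ]
    · congr 1
      ext ⟨i, hi⟩ ⟨j, hj⟩
      simp [outBlock, toSquareBlockProp, blockExp, h.sameBlock'_iff_of_not hi, rhoShift_out hj,
        h.cornerX_out _ _ hi]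
  · intro i hi j hj
    rw [blockExp, of_apply, if_neg fun hs => h.not_sameBlock hi hj (h.le hs)]

theorem sameBlock_empty {i j : Fin n} : SameBlock (∅ : Finset (Fin (n - 1))) i j ↔ i = j := by
  refine ⟨fun hs => ?_, fun e => e ▸ SameBlock.rfl _ _⟩
  by_contra hne
  have hlt : min (i : ℕ) j < max (i : ℕ) j := by
    have : (i : ℕ) ≠ j := fun e => hne (Fin.ext e)
    omega
  exact absurd (hs ⟨min (i : ℕ) j, by omega⟩ le_rfl hlt) (Finset.notMem_empty _)

theorem prod_posRoots_empty {M : Type*} [CommMonoid M] (f : Fin n × Fin n → M) :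
    ∏ q ∈ posRoots (∅ : Finset (Fin (n - 1))), f q = 1 := by
  refine Finset.prod_eq_one fun q hq => ?_
  obtain ⟨h1, h2⟩ := mem_posRoots.mp hq
  exact absurd (sameBlock_empty.mp h2) h1.ne

/-- Base case: the compact group is a torus, commutes with e^X, and so does not affect the Iwasawa
projection. -/
theorem sphInt_empty (l : Fin n → ℂ) (X : Fin n → ℝ) :
    sphInt ∅ l X = Complex.exp (pairing l fun i => (X i : ℂ)) := by
  have hrho : rho (∅ : Finset (Fin (n - 1))) = 0 := by
    rw [rho_eq]
    exact prod_posRoots_empty (M := Multiplicative (Fin n → ℂ)) rootVec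
  have hk : ∀ k : compactK (∅ : Finset (Fin (n - 1))),
      minorH (toMat k * expDiag fun i => (X i : ℂ)) = X := by
    intro k
    have hd : toMat k = diagonal (toMat k).diag := by
      ext i j
      by_cases hij : i = j
      · subst hij; simp
      · rw [diagonal_apply_ne _ hij]
        exact toMat_eq_zero k fun hs => hij (sameBlock_empty.mp hs)
    have hc : toMat k * expDiag (fun i => (X i : ℂ)) = expDiag (fun i => (X i : ℂ)) * toMat k := by
      rw [hd, expDiag, diagonal_mul_diagonal, diagonal_mul_diagonal]
      simp only [mul_comm]
    rw [hc, minorH_mul_unitary _ (toMat_unitary k), minorH_expDiag]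
  simp [sphInt, hk, hrho]

theorem det_blockExp_empty (l X : Fin n → ℂ) :
    (blockExp ∅ l X).det = Complex.exp (pairing l X) := by
  have : blockExp ∅ l X = diagonal fun i => Complex.exp (l i * X i) := by
    ext i j
    simp only [blockExp, of_apply, sameBlock_empty, diagonal_apply]
    split_ifs with hij
    · rw [hij]
    · rfl
  rw [this, det_diagonal, ← Complex.exp_sum, pairing]

/-- The determinant formula for the spherical integral at regular points of the chamber. -/
theorem prod_mul_sphInt (S : Finset (Fin (n - 1))) (l : Fin n → ℂ) {X : Fin n → ℝ}
    (hX : ∀ q ∈ posRoots S, X q.2 < X q.1) :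
    (∏ q ∈ posRoots S, (l q.1 - l q.2)) *
        (∏ q ∈ posRoots S, 2 * Complex.sinh ((X q.1 : ℂ) - X q.2)) * sphInt S l X
      = (∏ q ∈ posRoots S, 2 * ((q.2 : ℕ) - (q.1 : ℕ) : ℂ)) *
        (blockExp S l fun i => (X i : ℂ)).det := by
  induction hc : S.card using Nat.strong_induction_on generalizing S l X with
  | _ N ih =>
  rcases S.eq_empty_or_nonempty with rfl | hne
  · rw [prod_posRoots_empty, prod_posRoots_empty, prod_posRoots_empty, sphInt_empty,
      det_blockExp_empty, one_mul]
  obtain ⟨S', p, m, hcard, h⟩ := exists_firstBlock hne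
  have hanti : StrictAnti fun i => X (h.emb i) := by
    intro i j hij
    refine hX (h.emb i, h.emb j) (mem_posRoots.mpr ⟨?_, h.sameBlock_emb _ _⟩)
    rw [Fin.lt_def, h.val_emb, h.val_emb]
    rw [Fin.lt_def] at hij
    omega
  set x := fun i => X (h.emb i) with hx
  set O := ∏ q ∈ outRoots S p m, 2 * Complex.sinh ((X q.1 : ℂ) - X q.2) with hO
  set dO := (outBlock p m (blockExp S l fun i => (X i : ℂ))).det with hdO
  set A := ∏ q ∈ posRoots S', (l q.1 - l q.2) with hA
  set κ := ∏ q ∈ posRoots S', 2 * ((q.2 : ℕ) - (q.1 : ℕ) : ℂ) with hκ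
  have hsinh : ∀ {N : ℕ} (z : Fin N → ℝ), ∏ i, ∏ j ∈ Finset.Ioi i,
      2 * Complex.sinh ((z i : ℂ) - z j) = (sinhProd z : ℝ) := by
    intro N z
    simp [sinhProd]
  -- The induction hypothesis for S' at the corner parameters y, divided by ∏ 2 sinh(y_i − y_j),
  -- which is positive because interlacing parameters strictly decrease.
  have hstep : ∀ c ∈ chartBox x, A * O * sphInt S' (l + rhoShift p m) (h.cornerX X fun j => c j.succ)
      = κ * dO * (Complex.exp ((l (h.emb 0) + m) * ((∑ i, x i - ∑ j : Fin m, c j.succ : ℝ) : ℂ)) *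
        ((of fun i j : Fin m => Complex.exp ((l (h.emb j.succ) - 1) * (c i.succ : ℝ))).det /
          (sinhProd fun j : Fin m => c j.succ : ℝ))) := by
    intro c hcb
    set y : Fin m → ℝ := fun j => c j.succ with hy
    have hya : StrictAnti y := by
      intro i j hij
      have h1 := (mem_chartBox.mp hcb).2
      refine (h1 j).2.trans_le (le_trans ?_ (h1 i).1.le)
      exact hanti.antitone (Fin.le_def.mpr (by
        rw [Fin.val_succ, Fin.val_castSucc]
        exact hij))
    have hpos : (sinhProd y : ℂ) ≠ 0 := by
      exact_mod_cast (sinhProd_pos hya).ne'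
    have hX' : ∀ q ∈ posRoots S', h.cornerX X y q.2 < h.cornerX X y q.1 := by
      intro q hq
      obtain ⟨h1, h2⟩ := mem_posRoots.mp hq
      by_cases hb : InBlock p m q.1
      · obtain ⟨a, ha⟩ := h.exists_emb hb
        obtain ⟨b, hb'⟩ := h.exists_emb ((h.sameBlock_iff hb).mp (h.le h2))
        rw [← ha, ← hb', Fin.lt_def, h.val_emb, h.val_emb] at h1
        have h4 := ((h.erase _ _).mp h2).2
        rw [← ha, ← hb', h.val_emb, h.val_emb] at h4
        obtain ⟨a, rfl⟩ := Fin.exists_succ_eq.mpr (show a ≠ 0 by rintro rfl; simp at h1 h4; omega)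
        obtain ⟨b, rfl⟩ := Fin.exists_succ_eq.mpr (show b ≠ 0 by rintro rfl; simp at h1)
        rw [← ha, ← hb', h.cornerX_emb, h.cornerX_emb, Fin.cons_succ, Fin.cons_succ]
        refine hya ?_
        simp only [Fin.val_succ] at h1
        rw [Fin.lt_def]
        omega
      · have hb' : ¬ InBlock p m q.2 := fun hb' => h.not_sameBlock hb hb' (h.le h2)
        rw [h.cornerX_out _ _ hb, h.cornerX_out _ _ hb']
        exact hX q (mem_posRoots.mpr ⟨h1, h.le h2⟩)
    have h1 := ih S'.card (hc ▸ hcard) S' (l + rhoShift p m) hX' rfl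
    rw [h.det_blockExp', h.prod_posRoots' (fun q => 2 * Complex.sinh _)] at h1
    have e1 : ∏ q ∈ posRoots S', ((l + rhoShift p m : Fin n → ℂ) q.1 -
        (l + rhoShift p m : Fin n → ℂ) q.2) = A := by
      refine Finset.prod_congr rfl fun q hq => ?_
      rw [Pi.add_apply, Pi.add_apply, h.rhoShift_sub hq]
      ring
    have e2 : ∏ q ∈ outRoots S p m, 2 * Complex.sinh ((h.cornerX X y q.1 : ℂ) - h.cornerX X y q.2)
        = O := by
      refine Finset.prod_congr rfl fun q hq => ?_
      obtain ⟨hq1, hq2⟩ := Finset.mem_filter.mp hq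
      rw [h.cornerX_out _ _ hq2, h.cornerX_out _ _ fun hb =>
        h.not_sameBlock hq2 hb (mem_posRoots.mp hq1).2]
    simp only [h.cornerX_emb, Fin.cons_succ] at h1
    rw [e1, e2, hsinh y] at h1
    field_simp
    linear_combination h1
  -- The lost roots have heights 1, …, m and contribute 2^m m!, the constant produced by
  -- `mul_integral_chartBox`.
  have hκ' : ∏ q ∈ posRoots S, 2 * ((q.2 : ℕ) - (q.1 : ℕ) : ℂ) = κ * (m.factorial * 2 ^ m) := by
    rw [h.prod_posRoots_eq_mul]
    congr 1
    have : ∀ j : Fin m, 2 * (((h.emb j.succ : Fin n) : ℕ) - ((h.emb 0 : Fin n) : ℕ) : ℂ)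
        = ((j : ℕ) + 1 : ℕ) * 2 := by
      intro j
      rw [h.val_emb, h.val_emb]
      push_cast
      simp
      ring
    simp only [this, Finset.prod_mul_distrib]
    rw [← Nat.cast_prod, Fin.prod_univ_eq_prod_range (fun j => j + 1) m,
      Finset.prod_range_add_one_eq_factorial]
    simp
  have hxpos : (sinhProd x : ℂ) ≠ 0 := by exact_mod_cast (sinhProd_pos hanti).ne'
  have hint := mul_integral_chartBox hanti fun a => l (h.emb a)
  rw [hκ', h.det_blockExp, h.prod_posRoots_eq_mul fun q => l q.1 - l q.2,
    h.prod_posRoots (fun q => 2 * Complex.sinh ((X q.1 : ℂ) - X q.2)), hsinh x, h.sphInt_eq hanti]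
  have h2 : A * O * ∫ c in chartBox x, (|(chartJac x c).det| * Real.exp (-c 0)) •
        sphInt S' (l + rhoShift p m) (h.cornerX X fun j => c j.succ)
      = κ * dO * ∫ c in chartBox x, (|(chartJac x c).det| * Real.exp (-c 0)) •
        (Complex.exp ((l (h.emb 0) + m) * ((∑ i, x i - ∑ j : Fin m, c j.succ : ℝ) : ℂ)) *
        ((of fun i j : Fin m => Complex.exp ((l (h.emb j.succ) - 1) * (c i.succ : ℝ))).det /
          (sinhProd fun j : Fin m => c j.succ : ℝ))) := by
    rw [← integral_const_mul, ← integral_const_mul]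
    refine setIntegral_congr_fun (measurableSet_chartBox x) fun c hcb => ?_
    simp only [mul_smul_comm, hstep c hcb]
  rw [← mul_div_assoc, eq_div_iff hxpos] at hint
  linear_combination (∏ j : Fin m, (l (h.emb 0) - l (h.emb j.succ))) * (sinhProd x : ℝ) * h2 +
    κ * dO * hint

end DeterminantFormula

end SphericalGL
namespace SphericalGL

open MeasureTheory
open scoped ContDiff

section Division

/-! ### Division of smooth complex functions by linear forms -/

variable {V : Type} [NormedAddCommGroup V] [NormedSpace ℂ V] [ProperSpace V]

/-- Differentiation under the integral sign. The derivative takes values in V →L[ℂ] E and brings a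
factor t along B, so the induction must allow an arbitrary target and an arbitrary continuous weight
φ. -/
theorem contDiff_intervalIntegral (A B : V →L[ℂ] V) (k : ℕ) :
    ∀ {E : Type} [NormedAddCommGroup E] [NormedSpace ℂ E] [CompleteSpace E] {f : V → E}
      (_ : ContDiff ℂ k f) {φ : ℝ → ℂ} (_ : Continuous φ),
      ContDiff ℂ k fun x => ∫ t in (0 : ℝ)..1, φ t • f (A x + (t : ℂ) • B x) := by
  induction k with
  | zero =>
    intro E _ _ _ f hf φ hφ
    rw [Nat.cast_zero, contDiff_zero] at hf ⊢
    refine intervalIntegral.continuous_parametric_intervalIntegral_of_continuous' ?_ 0 1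
    exact (hφ.comp continuous_snd).smul (hf.comp (by fun_prop))
  | succ k ih =>
    intro E _ _ _ f hf φ hφ
    have hk1 : ((k + 1 : ℕ) : WithTop ℕ∞) = (k : WithTop ℕ∞) + 1 := by push_cast; rfl
    rw [hk1] at hf ⊢
    obtain ⟨f', hf'c, hf'⟩ := contDiff_succ_iff_hasFDerivAt.mp hf
    rw [contDiff_succ_iff_hasFDerivAt]
    have hc' : Continuous f' := hf'c.continuous
    have hc : Continuous f := hf.continuous
    have hF'c : Continuous fun q : V × ℝ => φ q.2 • (f' (A q.1 + (q.2 : ℂ) • B q.1)).comp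
        (A + (q.2 : ℂ) • B) := by
      refine (hφ.comp continuous_snd).smul (Continuous.clm_comp (hc'.comp (by fun_prop)) ?_)
      fun_prop
    refine ⟨fun x => (∫ t in (0 : ℝ)..1, φ t • f' (A x + (t : ℂ) • B x)).comp A +
      (∫ t in (0 : ℝ)..1, (φ t * t) • f' (A x + (t : ℂ) • B x)).comp B, ?_, fun x => ?_⟩
    · exact ((ih hf'c hφ).clm_comp contDiff_const).add
        ((ih hf'c (hφ.mul Complex.continuous_ofReal)).clm_comp contDiff_const)
    · obtain ⟨C, hC⟩ := ((isCompact_closedBall x 1).prod isCompact_Icc).exists_bound_of_continuousOn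
        (s := Metric.closedBall x 1 ×ˢ Set.Icc (0 : ℝ) 1) hF'c.continuousOn
      have h1 := intervalIntegral.hasFDerivAt_integral_of_dominated_of_fderiv_le
        (μ := volume) (a := 0) (b := 1) (x₀ := x) (s := Metric.closedBall x 1) (bound := fun _ => C)
        (F := fun x t => φ t • f (A x + (t : ℂ) • B x))
        (F' := fun x t => φ t • (f' (A x + (t : ℂ) • B x)).comp (A + (t : ℂ) • B))
        (Metric.closedBall_mem_nhds x one_pos) ?_ ?_ ?_ ?_ ?_ ?_
      · convert h1 using 1
        have hi1 : IntervalIntegrable (fun t => φ t • f' (A x + (t : ℂ) • B x)) volume 0 1 :=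
          (hφ.smul (hc'.comp (by fun_prop))).intervalIntegrable _ _
        have hi2 : IntervalIntegrable (fun t => (φ t * t) • f' (A x + (t : ℂ) • B x)) volume 0 1 :=
          ((hφ.mul Complex.continuous_ofReal).smul (hc'.comp (by fun_prop))).intervalIntegrable _ _
        have e1 := ((ContinuousLinearMap.compL ℂ V V E).flip A).intervalIntegral_comp_comm hi1
        have e2 := ((ContinuousLinearMap.compL ℂ V V E).flip B).intervalIntegral_comp_comm hi2
        simp only [ContinuousLinearMap.flip_apply, ContinuousLinearMap.compL_apply] at e1 e2
        beta_reduce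
        rw [← e1, ← e2, ← intervalIntegral.integral_add]
        · refine intervalIntegral.integral_congr fun t _ => ?_
          simp only [ContinuousLinearMap.comp_add, ContinuousLinearMap.comp_smul,
            ContinuousLinearMap.smul_comp, smul_add, mul_smul]
        · refine Continuous.intervalIntegrable ?_ _ _
          exact (hφ.smul (hc'.comp (by fun_prop))).clm_comp continuous_const
        · refine Continuous.intervalIntegrable ?_ _ _
          exact ((hφ.mul Complex.continuous_ofReal).smul (hc'.comp (by fun_prop))).clm_comp
            continuous_const
      · refine Filter.Eventually.of_forall fun y => Continuous.aestronglyMeasurable ?_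
        exact hφ.smul (hc.comp (by fun_prop))
      · exact (hφ.smul (hc.comp (by fun_prop))).intervalIntegrable _ _
      · exact (hF'c.comp (by fun_prop : Continuous fun t : ℝ => (x, t))).aestronglyMeasurable
      · refine Filter.Eventually.of_forall fun t ht y hy => ?_
        rw [Set.uIoc_of_le zero_le_one] at ht
        exact hC (y, t) ⟨hy, ht.1.le, ht.2⟩
      · exact intervalIntegrable_const
      · refine Filter.Eventually.of_forall fun t _ y _ => HasFDerivAt.const_smul ?_ _
        exact (hf' _).comp y (A + (t : ℂ) • B).hasFDerivAt

/-- A smooth function vanishing on the kernel of a linear form is divisible by it. -/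
theorem exists_eq_mul_of_ker {f : V → ℂ} (hf : ContDiff ℂ ∞ f) (ℓ : V →L[ℂ] ℂ) {v : V}
    (hv : ℓ v = 1) (h0 : ∀ x, ℓ x = 0 → f x = 0) :
    ∃ g : V → ℂ, ContDiff ℂ ∞ g ∧ ∀ x, f x = ℓ x * g x := by
  -- A projects onto ker ℓ along v, and A + B = id. Integrating d/dt f(Ax + tBx) = ℓ(x) Df(Ax +
  -- tBx)v from 0 to 1, with f(Ax) = 0, yields the quotient as an integral.
  set B : V →L[ℂ] V := ℓ.smulRight v with hB
  set A : V →L[ℂ] V := ContinuousLinearMap.id ℂ V - B with hA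
  have hf1 : Differentiable ℂ f := hf.differentiable (by simp)
  refine ⟨fun x => ∫ t in (0 : ℝ)..1, (1 : ℂ) • (fderiv ℂ f (A x + (t : ℂ) • B x)) v, ?_, fun x => ?_⟩
  · rw [contDiff_infty]
    intro k
    refine contDiff_intervalIntegral A B k (f := fun x => fderiv ℂ f x v) ?_ continuous_const
    refine ContDiff.clm_apply (hf.fderiv_right (m := k) ?_) contDiff_const
    exact_mod_cast le_top
  · have hc : Continuous fun x => fderiv ℂ f x v :=
      ((hf.continuous_fderiv (by simp)).clm_apply continuous_const)
    have hd : ∀ t : ℝ, HasDerivAt (fun t : ℝ => f (A x + (t : ℂ) • B x))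
        (ℓ x * fderiv ℂ f (A x + (t : ℂ) • B x) v) t := by
      intro t
      have h1 : HasDerivAt (fun z : ℂ => A x + z • B x) (B x) (t : ℂ) := by
        simpa using ((hasDerivAt_id (t : ℂ)).smul_const (B x)).const_add (A x)
      have h2 := ((hf1 _).hasFDerivAt.comp_hasDerivAt (t : ℂ) h1).comp_ofReal
      refine HasDerivAt.congr_deriv (f := fun t : ℝ => f (A x + (t : ℂ) • B x)) h2 ?_
      rw [hB, ContinuousLinearMap.smulRight_apply, map_smul, smul_eq_mul]
    have h1 := intervalIntegral.integral_eq_sub_of_hasDerivAt (a := 0) (b := 1)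
      (fun t _ => hd t) ((continuous_const.mul (hc.comp (by fun_prop))).intervalIntegrable _ _)
    have h2 : f (A x) = 0 := h0 _ (by simp [hA, hB, hv])
    simp only [one_smul]
    rw [← intervalIntegral.integral_const_mul, h1]
    simp only [Complex.ofReal_one, one_smul, Complex.ofReal_zero, zero_smul, add_zero, h2, sub_zero]
    congr 1
    simp [hA]

/-- Divide by one form after the other. After division by ℓ_i the quotient still vanishes on ker ℓ_j
where ℓ_i ≠ 0; since no two forms are proportional, these points are dense in ker ℓ_j. -/
theorem exists_eq_prod_mul_of_ker {ι : Type*} [DecidableEq ι] (s : Finset ι) (ℓ : ι → V →L[ℂ] ℂ)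
    (hne : ∀ i ∈ s, ∃ v, ℓ i v = 1) (hind : ∀ i ∈ s, ∀ j ∈ s, i ≠ j → ∃ v, ℓ i v ≠ 0 ∧ ℓ j v = 0)
    {f : V → ℂ} (hf : ContDiff ℂ ∞ f) (h0 : ∀ i ∈ s, ∀ x, ℓ i x = 0 → f x = 0) :
    ∃ g : V → ℂ, ContDiff ℂ ∞ g ∧ ∀ x, f x = (∏ i ∈ s, ℓ i x) * g x := by
  induction s using Finset.induction_on generalizing f with
  | empty => exact ⟨f, hf, by simp⟩
  | insert i s hi ih =>
    obtain ⟨v, hv⟩ := hne i (Finset.mem_insert_self _ _)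
    obtain ⟨g, hg, hfg⟩ := exists_eq_mul_of_ker hf (ℓ i) hv (h0 i (Finset.mem_insert_self _ _))
    have hg0 : ∀ j ∈ s, ∀ x, ℓ j x = 0 → g x = 0 := by
      intro j hj x hx
      obtain ⟨u, hu, hu0⟩ := hind i (Finset.mem_insert_self _ _) j (Finset.mem_insert_of_mem hj)
        fun e => hi (e ▸ hj)
      have hcont : Continuous fun z : ℂ => g (x + z • u) := hg.continuous.comp (by fun_prop)
      have hset : ∀ᶠ z in nhdsWithin (0 : ℂ) {0}ᶜ, g (x + z • u) = 0 := by
        have hlim : ∀ᶠ z in nhdsWithin (0 : ℂ) {0}ᶜ, ℓ i (x + z • u) ≠ 0 := by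
          by_cases hxi : ℓ i x = 0
          · filter_upwards [self_mem_nhdsWithin] with z hz
            simpa [hxi, hu] using hz
          · refine Filter.Eventually.filter_mono nhdsWithin_le_nhds ?_
            have : Continuous fun z : ℂ => ℓ i (x + z • u) := by fun_prop
            exact this.continuousAt.eventually_ne (by simpa using hxi)
        filter_upwards [hlim] with z hz
        have h1 := h0 j (Finset.mem_insert_of_mem hj) (x + z • u) (by simp [hx, hu0])
        rw [hfg] at h1
        exact (mul_eq_zero.mp h1).resolve_left hz
      have h2 : Filter.Tendsto (fun z : ℂ => g (x + z • u)) (nhdsWithin (0 : ℂ) {0}ᶜ) (nhds (g x)) := by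
        have := (hcont.tendsto 0).mono_left (nhdsWithin_le_nhds (s := {0}ᶜ))
        simpa using this
      exact tendsto_nhds_unique h2 ((Filter.tendsto_congr' hset).mpr tendsto_const_nhds)
    obtain ⟨g', hg', hgg'⟩ := ih (fun j hj => hne j (Finset.mem_insert_of_mem hj))
      (fun j hj k hk => hind j (Finset.mem_insert_of_mem hj) k (Finset.mem_insert_of_mem hk)) hg hg0
    refine ⟨g', hg', fun x => ?_⟩
    rw [hfg, hgg', Finset.prod_insert hi, mul_assoc]

end Division

end SphericalGL
namespace SphericalGL

open Matrix MeasureTheory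
open scoped ContDiff

section Symmetry

variable {n : ℕ} {S : Finset (Fin (n - 1))}

/-! ### Symmetry under the Weyl group -/

theorem mem_weyl {s : Equiv.Perm (Fin n)} : s ∈ weyl S ↔ ∀ i, SameBlock S (s i) i := by
  simp [weyl]

/-- Blocks are intervals, so the order of two indices in different blocks depends on the blocks
alone. -/
theorem lt_of_not_sameBlock {i j i' j' : Fin n} (hij : i < j) (hn : ¬ SameBlock S i j)
    (hi : SameBlock S i i') (hj : SameBlock S j j') : i' < j' := by
  rw [SameBlock] at hn
  push Not at hn
  obtain ⟨k, hk1, hk2, hk⟩ := hn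
  rw [Fin.lt_def] at hij ⊢
  have h1 : ¬ (min (i : ℕ) i' ≤ k ∧ (k : ℕ) < max (i : ℕ) i') := fun h => hk (hi k h.1 h.2)
  have h2 : ¬ (min (j : ℕ) j' ≤ k ∧ (k : ℕ) < max (j : ℕ) j') := fun h => hk (hj k h.1 h.2)
  omega

theorem sameBlock_comp {s : Equiv.Perm (Fin n)} (hs : s ∈ weyl S) (i j : Fin n) :
    SameBlock S (s i) (s j) ↔ SameBlock S i j :=
  ⟨fun h => (mem_weyl.mp hs i).symm.trans (h.trans (mem_weyl.mp hs j)),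
    fun h => (mem_weyl.mp hs i).trans (h.trans (mem_weyl.mp hs j).symm)⟩

theorem prod_Ioi_ite {M : Type*} [CommMonoid M] (S : Finset (Fin (n - 1))) (f : Fin n → Fin n → M) :
    ∏ i, ∏ j ∈ Finset.Ioi i, (if SameBlock S i j then f i j else 1)
      = ∏ q ∈ posRoots S, f q.1 q.2 := by
  rw [posRoots, Finset.prod_filter, Fintype.prod_prod_type]
  refine Finset.prod_congr rfl fun i _ => ?_
  rw [← Finset.filter_lt_eq_Ioi, Finset.prod_filter]
  refine Finset.prod_congr rfl fun j _ => ?_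
  split_ifs <;> simp_all

/-- Extend f by ±1, according to the order, to pairs in different blocks. The sign rule for the full
symmetric group applies, and elements of W̃ preserve the order between blocks, so the extra factors
are 1. -/
theorem prod_posRoots_comp {R : Type*} [CommRing R] {s : Equiv.Perm (Fin n)} (hs : s ∈ weyl S)
    {f : Fin n → Fin n → R} (hf : ∀ i j, f i j = -f j i) :
    ∏ q ∈ posRoots S, f (s q.1) (s q.2) = s.sign * ∏ q ∈ posRoots S, f q.1 q.2 := by
  have h := s.prod_Ioi_comp_eq_sign_mul_prod (R := R)
    (f := fun i j => if SameBlock S i j then f i j else if i < j then 1 else -1) fun i j => by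
      by_cases hij : SameBlock S i j
      · simp only [hij, hij.symm, if_true, hf i j]
      · have hji : ¬ SameBlock S j i := fun h => hij h.symm
        have hne : i ≠ j := by rintro rfl; exact hij (SameBlock.rfl _ _)
        rcases hne.lt_or_gt with h | h <;> simp [hij, hji, h, h.not_gt]
  rw [← prod_Ioi_ite S fun i j => f (s i) (s j), ← prod_Ioi_ite S]
  refine Eq.trans ?_ (h.trans (congrArg _ ?_))
  · refine Finset.prod_congr rfl fun i _ => Finset.prod_congr rfl fun j hj => ?_
    rw [Finset.mem_Ioi] at hj
    simp only [sameBlock_comp hs]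
    split_ifs with h1 h2
    · rfl
    · rfl
    · exact absurd (lt_of_not_sameBlock hj h1 (mem_weyl.mp hs i).symm (mem_weyl.mp hs j).symm) h2
  · refine Finset.prod_congr rfl fun i _ => Finset.prod_congr rfl fun j hj => ?_
    rw [Finset.mem_Ioi] at hj
    simp only [hj, if_true]

/-- Rearrangement: maximise −∑ i X(s i) over W̃. A pair in the wrong order could be swapped to
increase the sum. -/
theorem exists_weyl_antitone (S : Finset (Fin (n - 1))) (X : Fin n → ℝ) :
    ∃ s ∈ weyl S, ∀ q ∈ posRoots S, X (s q.2) ≤ X (s q.1) := by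
  have hne : (weyl S).Nonempty := ⟨1, mem_weyl.mpr fun i => SameBlock.rfl _ _⟩
  obtain ⟨s, hs, hmax⟩ := (weyl S).exists_max_image (fun s => ∑ i : Fin n, -((i : ℕ) : ℝ) * X (s i)) hne
  refine ⟨s, hs, fun q hq => ?_⟩
  obtain ⟨h1, h2⟩ := mem_posRoots.mp hq
  by_contra hlt
  push Not at hlt
  have hmem : s * Equiv.swap q.1 q.2 ∈ weyl S := by
    rw [mem_weyl]
    intro i
    refine (mem_weyl.mp hs _).trans ?_
    rcases eq_or_ne i q.1 with rfl | hi1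
    · rw [Equiv.swap_apply_left]
      exact h2.symm
    rcases eq_or_ne i q.2 with rfl | hi2
    · rw [Equiv.swap_apply_right]
      exact h2
    · rw [Equiv.swap_apply_of_ne_of_ne hi1 hi2]
      exact SameBlock.rfl _ _
  have h3 := hmax _ hmem
  have h4 : ∑ i : Fin n, -((i : ℕ) : ℝ) * X ((s * Equiv.swap q.1 q.2) i)
      - ∑ i : Fin n, -((i : ℕ) : ℝ) * X (s i)
      = (((q.2 : ℕ) : ℝ) - (q.1 : ℕ)) * (X (s q.2) - X (s q.1)) := by
    rw [← Finset.sum_sub_distrib, ← Finset.sum_subset (Finset.subset_univ {q.1, q.2})]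
    · rw [Finset.sum_pair h1.ne]
      simp only [Equiv.Perm.mul_apply, Equiv.swap_apply_left, Equiv.swap_apply_right]
      ring
    · intro i _ hi
      simp only [Finset.mem_insert, Finset.mem_singleton, not_or] at hi
      rw [Equiv.Perm.mul_apply, Equiv.swap_apply_of_ne_of_ne hi.1 hi.2, sub_self]
  have h5 : (0 : ℝ) < ((q.2 : ℕ) : ℝ) - (q.1 : ℕ) := by
    rw [sub_pos]
    exact_mod_cast h1
  have h6 := mul_pos h5 (sub_pos.mpr hlt)
  linarith

theorem blockExp_comp {s : Equiv.Perm (Fin n)} (hs : s ∈ weyl S) (l X : Fin n → ℂ) :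
    blockExp S l (fun i => X (s i)) = (blockExp S l X).submatrix s id := by
  ext i j
  have : SameBlock S (s i) j ↔ SameBlock S i j :=
    ⟨fun h => (mem_weyl.mp hs i).symm.trans h, fun h => (mem_weyl.mp hs i).trans h⟩
  simp [blockExp, this]

/-- The permutation matrix P lies in K_S and e^{sX} = P e^X P*. The right factor P* does not affect
the Iwasawa projection, and right invariance of Haar measure absorbs P. -/
theorem sphInt_comp {s : Equiv.Perm (Fin n)} (hs : s ∈ weyl S) (l : Fin n → ℂ) (X : Fin n → ℝ) :
    sphInt S l (fun i => X (s i)) = sphInt S l X := by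
  set P : Matrix (Fin n) (Fin n) ℂ := (1 : Matrix (Fin n) (Fin n) ℂ).submatrix s id with hP
  have hPs : star P = (1 : Matrix (Fin n) (Fin n) ℂ).submatrix id s := by
    rw [hP, star_eq_conjTranspose, conjTranspose_submatrix, conjTranspose_one]
  have hPu : P ∈ unitaryGroup (Fin n) ℂ := by
    rw [mem_unitaryGroup_iff, hPs, hP]
    ext i j
    simp [mul_apply, one_apply, s.injective.eq_iff]
  have hPm : (⟨P, hPu⟩ : unitaryGroup (Fin n) ℂ) ∈ compactK S := by
    intro i j hij
    change P i j = 0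
    rw [hP, submatrix_apply]
    refine one_apply_ne fun e => hij ?_
    rw [← show s i = j from e]
    exact (mem_weyl.mp hs i).symm
  have hconj : expDiag (fun i => (X (s i) : ℂ)) = P * expDiag (fun i => (X i : ℂ)) * star P := by
    have : P * expDiag (fun i => (X i : ℂ)) = (expDiag fun i => (X i : ℂ)).submatrix s id := by
      ext i j
      simp [hP, mul_apply, one_apply]
    rw [this, hPs]
    ext i j
    simp [mul_apply, one_apply, expDiag, diagonal_apply, s.injective.eq_iff]
  have hk : ∀ k : compactK S, minorH (toMat k * expDiag fun i => (X (s i) : ℂ))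
      = minorH (toMat (k * ⟨⟨P, hPu⟩, hPm⟩) * expDiag fun i => (X i : ℂ)) := by
    intro k
    rw [hconj, ← Matrix.mul_assoc, ← Matrix.mul_assoc,
      minorH_mul_unitary _ (Unitary.star_mem hPu), toMat_mul]
  unfold sphInt
  simp only [hk]
  exact integral_mul_right_eq_self (μ := haarK S) (fun k => Complex.exp (pairing (l + rho S)
    fun i => ((minorH (toMat k * expDiag fun i => (X i : ℂ)) i : ℝ) : ℂ))) _

/-- Move X into the chamber by an element of W̃: the spherical integral is invariant, while the sinh
product and the determinant both change by its sign. -/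
theorem prod_mul_sphInt_of_ne (S : Finset (Fin (n - 1))) (l : Fin n → ℂ) {X : Fin n → ℝ}
    (hX : ∀ q ∈ posRoots S, X q.1 ≠ X q.2) :
    (∏ q ∈ posRoots S, (l q.1 - l q.2)) *
        (∏ q ∈ posRoots S, 2 * Complex.sinh ((X q.1 : ℂ) - X q.2)) * sphInt S l X
      = (∏ q ∈ posRoots S, 2 * ((q.2 : ℕ) - (q.1 : ℕ) : ℂ)) *
        (blockExp S l fun i => (X i : ℂ)).det := by
  obtain ⟨s, hs, hanti⟩ := exists_weyl_antitone S X
  have hne : ∀ i j, i ≠ j → SameBlock S i j → X i ≠ X j := by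
    intro i j hij hb
    rcases hij.lt_or_gt with h | h
    · exact hX (i, j) (mem_posRoots.mpr ⟨h, hb⟩)
    · exact (hX (j, i) (mem_posRoots.mpr ⟨h, hb.symm⟩)).symm
  have h := prod_mul_sphInt S l (X := fun i => X (s i)) fun q hq => by
    obtain ⟨h1, h2⟩ := mem_posRoots.mp hq
    refine lt_of_le_of_ne (hanti q hq) (hne _ _ (fun e => h1.ne' (s.injective e)) ?_)
    exact ((sameBlock_comp hs _ _).mpr h2).symm
  rw [sphInt_comp hs, blockExp_comp hs l fun i => (X i : ℂ), det_permute,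
    prod_posRoots_comp hs (f := fun i j => 2 * Complex.sinh ((X i : ℂ) - X j)) fun i j => by
      rw [← neg_sub, Complex.sinh_neg, mul_neg]] at h
  have hsq : ((s.sign : ℤ) : ℂ) * ((s.sign : ℤ) : ℂ) = 1 := by
    rw [← Int.cast_mul, Int.units_coe_mul_self, Int.cast_one]
  linear_combination ((s.sign : ℤ) : ℂ) * h + ((∏ q ∈ posRoots S, 2 * ((q.2 : ℕ) - (q.1 : ℕ) : ℂ)) *
        (blockExp S l fun i => (X i : ℂ)).det - (∏ q ∈ posRoots S, (l q.1 - l q.2)) *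
        (∏ q ∈ posRoots S, 2 * Complex.sinh ((X q.1 : ℂ) - X q.2)) * sphInt S l X) * hsq

end Symmetry

end SphericalGL
namespace SphericalGL

open Matrix
open scoped ContDiff

section Continuation

variable {n : ℕ}

/-! ### The analytic continuation of spherical functions -/

/-- The entire function `sinh z / z`. -/
noncomputable def shc : ℂ → ℂ := dslope Complex.sinh 0

theorem differentiable_shc : Differentiable ℂ shc := by
  rw [← differentiableOn_univ, shc, Complex.differentiableOn_dslope Filter.univ_mem]
  exact Complex.differentiable_sinh.differentiableOn

theorem mul_shc (z : ℂ) : z * shc z = Complex.sinh z := by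
  simpa [shc] using sub_smul_dslope Complex.sinh 0 z

theorem shc_zero : shc 0 = 1 := by simp [shc, dslope_same]

theorem shc_ne_zero {z : ℂ} (hz : ∀ m : ℤ, m ≠ 0 → z ≠ m * Real.pi * Complex.I) : shc z ≠ 0 := by
  by_cases h0 : z = 0
  · rw [h0, shc_zero]
    exact one_ne_zero
  intro h
  have h1 := mul_shc z
  rw [h, mul_zero, ← mul_left_inj' Complex.I_ne_zero, zero_mul, ← Complex.sin_mul_I, eq_comm,
    Complex.sin_eq_zero_iff] at h1
  obtain ⟨k, hk⟩ := h1
  have hz' : z = (-k : ℤ) * Real.pi * Complex.I := by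
    have : z = -(z * Complex.I) * Complex.I := by
      rw [neg_mul, mul_assoc, Complex.I_mul_I]
      ring
    rw [this, hk]
    push_cast
    ring
  refine hz (-k) ?_ hz'
  rintro hk0
  rw [hk0] at hz'
  simp at hz'
  exact h0 hz'

theorem shc_ofReal_ne_zero (x : ℝ) : shc x ≠ 0 := by
  refine shc_ne_zero fun m hm h => ?_
  have := congrArg Complex.im h
  simp [Real.pi_ne_zero, hm] at this

theorem det_blockExp_eq_zero_left {S : Finset (Fin (n - 1))} {q : Fin n × Fin n}
    (hq : q ∈ posRoots S) {l : Fin n → ℂ} (hl : l q.1 = l q.2) (X : Fin n → ℂ) :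
    (blockExp S l X).det = 0 := by
  obtain ⟨h1, h2⟩ := mem_posRoots.mp hq
  refine det_zero_of_column_eq h1.ne fun i => ?_
  have : SameBlock S i q.1 ↔ SameBlock S i q.2 := ⟨fun h => h.trans h2, fun h => h.trans h2.symm⟩
  simp [blockExp, this, hl]

theorem det_blockExp_eq_zero_right {S : Finset (Fin (n - 1))} {q : Fin n × Fin n}
    (hq : q ∈ posRoots S) (l : Fin n → ℂ) {X : Fin n → ℂ} (hX : X q.1 = X q.2) :
    (blockExp S l X).det = 0 := by
  obtain ⟨h1, h2⟩ := mem_posRoots.mp hq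
  refine det_zero_of_row_eq h1.ne (funext fun j => ?_)
  have : SameBlock S q.1 j ↔ SameBlock S q.2 j := ⟨fun h => h2.symm.trans h, fun h => h2.trans h⟩
  simp [blockExp, this, hX]

theorem contDiff_det_blockExp (S : Finset (Fin (n - 1))) :
    ContDiff ℂ ∞ fun w : (Fin n → ℂ) × (Fin n → ℂ) => (blockExp S w.1 w.2).det := by
  simp only [det_apply', blockExp, of_apply]
  refine ContDiff.sum fun s _ => contDiff_const.mul (contDiff_prod fun i _ => ?_)
  split_ifs
  · fun_prop
  · exact contDiff_const

/-- Distinct positive roots are not proportional: one of the two indices of q does not occur in q',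
and its unit vector serves. -/
theorem exists_single_eq {q q' : Fin n × Fin n} (hq : q.1 < q.2) (hq' : q'.1 < q'.2)
    (hne : q ≠ q') : ∃ v : Fin n → ℂ, v q.1 - v q.2 ≠ 0 ∧ v q'.1 - v q'.2 = 0 := by
  by_cases h1 : q.1 = q'.1 ∨ q.1 = q'.2
  · have h2 : q.2 ≠ q'.1 ∧ q.2 ≠ q'.2 := by
      obtain ⟨a, b⟩ := q
      obtain ⟨a', b'⟩ := q'
      simp only [ne_eq, Prod.mk.injEq, Fin.ext_iff, Fin.lt_def] at *
      omega
    refine ⟨Pi.single q.2 1, ?_, ?_⟩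
    · simp [hq.ne]
    · simp [h2.1.symm, h2.2.symm]
  · push Not at h1
    refine ⟨Pi.single q.1 1, ?_, ?_⟩
    · simp [hq.ne']
    · simp [h1.1.symm, h1.2.symm]

/-- The determinant is divisible by the products of the positive roots in both variables. -/
theorem exists_det_blockExp_eq (S : Finset (Fin (n - 1))) :
    ∃ E : (Fin n → ℂ) × (Fin n → ℂ) → ℂ, ContDiff ℂ ∞ E ∧ ∀ l X, (blockExp S l X).det
      = (∏ q ∈ posRoots S, (l q.1 - l q.2)) * (∏ q ∈ posRoots S, (X q.1 - X q.2)) * E (l, X) := by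
  let r : Fin n × Fin n → (Fin n → ℂ) →L[ℂ] ℂ := fun q =>
    ContinuousLinearMap.proj (R := ℂ) (φ := fun _ : Fin n => ℂ) q.1 - ContinuousLinearMap.proj q.2
  have hr : ∀ q v, r q v = v q.1 - v q.2 := fun _ _ => rfl
  let ℓ : (Fin n × Fin n) ⊕ (Fin n × Fin n) → (Fin n → ℂ) × (Fin n → ℂ) →L[ℂ] ℂ :=
    Sum.elim (fun q => (r q).comp (ContinuousLinearMap.fst ℂ _ _))
      fun q => (r q).comp (ContinuousLinearMap.snd ℂ _ _)
  have hlt : ∀ q ∈ posRoots S, q.1 < q.2 := fun q hq => (mem_posRoots.mp hq).1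
  have hone : ∀ q ∈ posRoots S, r q (Pi.single q.1 1) = 1 := fun q hq => by
    simp [hr, (hlt q hq).ne']
  have hne : ∀ i ∈ (posRoots S).disjSum (posRoots S), ∃ v, ℓ i v = 1 := by
    intro i hi
    rcases Finset.mem_disjSum.mp hi with ⟨q, hq, rfl⟩ | ⟨q, hq, rfl⟩
    · exact ⟨(Pi.single q.1 1, 0), hone q hq⟩
    · exact ⟨(0, Pi.single q.1 1), hone q hq⟩
  have hind : ∀ i ∈ (posRoots S).disjSum (posRoots S), ∀ j ∈ (posRoots S).disjSum (posRoots S),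
      i ≠ j → ∃ v, ℓ i v ≠ 0 ∧ ℓ j v = 0 := by
    intro i hi j hj hij
    rcases Finset.mem_disjSum.mp hi with ⟨q, hq, rfl⟩ | ⟨q, hq, rfl⟩ <;>
      rcases Finset.mem_disjSum.mp hj with ⟨q', hq', rfl⟩ | ⟨q', hq', rfl⟩
    · obtain ⟨v, h1, h2⟩ := exists_single_eq (hlt q hq) (hlt q' hq') fun e => hij (by rw [e])
      exact ⟨(v, 0), h1, h2⟩
    · refine ⟨(Pi.single q.1 1, 0), ?_, map_zero (r q')⟩
      exact fun h => one_ne_zero ((hone q hq).symm.trans h)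
    · refine ⟨(0, Pi.single q.1 1), ?_, map_zero (r q')⟩
      exact fun h => one_ne_zero ((hone q hq).symm.trans h)
    · obtain ⟨v, h1, h2⟩ := exists_single_eq (hlt q hq) (hlt q' hq') fun e => hij (by rw [e])
      exact ⟨(0, v), h1, h2⟩
  have hker : ∀ i ∈ (posRoots S).disjSum (posRoots S), ∀ x, ℓ i x = 0 →
      (blockExp S x.1 x.2).det = 0 := by
    intro i hi x hx
    rcases Finset.mem_disjSum.mp hi with ⟨q, hq, rfl⟩ | ⟨q, hq, rfl⟩
    · exact det_blockExp_eq_zero_left hq (sub_eq_zero.mp hx) _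
    · exact det_blockExp_eq_zero_right hq _ (sub_eq_zero.mp hx)
  obtain ⟨E, hE, h⟩ := exists_eq_prod_mul_of_ker ((posRoots S).disjSum (posRoots S)) ℓ hne hind
    (contDiff_det_blockExp S) hker
  refine ⟨E, hE, fun l X => ?_⟩
  have h1 := h (l, X)
  rw [Finset.prod_disjSum] at h1
  exact h1

/-- The analytic continuation in both variables. -/
noncomputable def sphCont (S : Finset (Fin (n - 1))) (l X : Fin n → ℂ) : ℂ :=
  (∏ q ∈ posRoots S, 2 * ((q.2 : ℕ) - (q.1 : ℕ) : ℂ)) *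
    (exists_det_blockExp_eq S).choose (l, X) / ∏ q ∈ posRoots S, 2 * shc (X q.1 - X q.2)

theorem prod_mul_sphCont (S : Finset (Fin (n - 1))) (l : Fin n → ℂ) {X : Fin n → ℂ}
    (hX : ∀ q ∈ posRoots S, shc (X q.1 - X q.2) ≠ 0) :
    (∏ q ∈ posRoots S, (l q.1 - l q.2)) *
        (∏ q ∈ posRoots S, 2 * Complex.sinh (X q.1 - X q.2)) * sphCont S l X
      = (∏ q ∈ posRoots S, 2 * ((q.2 : ℕ) - (q.1 : ℕ) : ℂ)) * (blockExp S l X).det := by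
  have h1 : ∏ q ∈ posRoots S, 2 * Complex.sinh (X q.1 - X q.2)
      = (∏ q ∈ posRoots S, (X q.1 - X q.2)) * ∏ q ∈ posRoots S, 2 * shc (X q.1 - X q.2) := by
    rw [← Finset.prod_mul_distrib]
    refine Finset.prod_congr rfl fun q _ => ?_
    rw [← mul_shc]
    ring
  have h2 : ∏ q ∈ posRoots S, 2 * shc (X q.1 - X q.2) ≠ 0 :=
    Finset.prod_ne_zero_iff.mpr fun q hq => mul_ne_zero two_ne_zero (hX q hq)
  rw [h1, sphCont, (exists_det_blockExp_eq S).choose_spec.2]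
  field_simp

/-- The direction (0, 1, 2, …) is regular for every root, so small nonzero displacements along it
leave all root hyperplanes. All later passages to singular points use this direction. -/
theorem eventually_prod_ne_zero (S : Finset (Fin (n - 1))) (X : Fin n → ℂ) :
    ∀ᶠ t : ℝ in nhdsWithin 0 {0}ᶜ,
      ∀ q ∈ posRoots S, X q.1 + (t * (q.1 : ℕ) : ℝ) - (X q.2 + (t * (q.2 : ℕ) : ℝ)) ≠ 0 := by
  rw [Filter.eventually_all_finset]
  intro q hq
  have hlt : ((q.1 : ℕ) : ℝ) < (q.2 : ℕ) := by exact_mod_cast (mem_posRoots.mp hq).1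
  by_cases h : X q.1 - X q.2 = 0
  · filter_upwards [self_mem_nhdsWithin] with t ht h0
    have h1 : ((t * (((q.1 : ℕ) : ℝ) - (q.2 : ℕ)) : ℝ) : ℂ) = 0 := by
      rw [← h0]
      push_cast
      linear_combination -h
    rw [Complex.ofReal_eq_zero, mul_eq_zero] at h1
    rcases h1 with h1 | h1
    · exact ht h1
    · linarith
  · refine Filter.Eventually.filter_mono nhdsWithin_le_nhds ?_
    have : Continuous fun t : ℝ => X q.1 + (t * (q.1 : ℕ) : ℝ) - (X q.2 + (t * (q.2 : ℕ) : ℝ)) := by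
      fun_prop
    exact this.continuousAt.eventually_ne (by simpa using h)

/-- Both sides are continuous, and where parameter and point are regular the determinant formula
determines them; perturb both at once and take the limit. -/
theorem sphInt_eq_sphCont (S : Finset (Fin (n - 1))) (l : Fin n → ℂ) (X : Fin n → ℝ) :
    sphInt S l X = sphCont S l fun i => (X i : ℂ) := by
  set L : ℝ → Fin n → ℂ := fun t i => l i + (t * (i : ℕ) : ℝ) with hL
  set Y : ℝ → Fin n → ℝ := fun t i => X i + t * (i : ℕ) with hY
  have hc1 : Continuous fun t => sphInt S (L t) (Y t) :=
    continuous_sphInt S (by fun_prop) (by fun_prop)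
  have hc2 : Continuous fun t => sphCont S (L t) fun i => (Y t i : ℂ) := by
    unfold sphCont
    refine Continuous.div (continuous_const.mul
      ((exists_det_blockExp_eq S).choose_spec.1.continuous.comp (by fun_prop))) ?_ fun t => ?_
    · exact continuous_finsetProd _ fun q _ => continuous_const.mul
        (differentiable_shc.continuous.comp (by fun_prop))
    · refine Finset.prod_ne_zero_iff.mpr fun q _ => mul_ne_zero two_ne_zero ?_
      rw [← Complex.ofReal_sub]
      exact shc_ofReal_ne_zero _
  have hev : (fun t => sphInt S (L t) (Y t)) =ᶠ[nhdsWithin 0 {0}ᶜ]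
      fun t => sphCont S (L t) fun i => (Y t i : ℂ) := by
    filter_upwards [eventually_prod_ne_zero S l, eventually_prod_ne_zero S fun i => (X i : ℂ)]
      with t h1 h2
    have h3 : ∀ q ∈ posRoots S, ((Y t q.1 : ℝ) : ℂ) - Y t q.2 ≠ 0 := by
      intro q hq
      have := h2 q hq
      simpa [hY] using this
    have h4 := prod_mul_sphInt_of_ne S (L t) (X := Y t) fun q hq e => h3 q hq (by rw [e, sub_self])
    rw [← prod_mul_sphCont S (L t) (X := fun i => (Y t i : ℂ)) fun q _ => by
      rw [← Complex.ofReal_sub]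
      exact shc_ofReal_ne_zero _] at h4
    refine mul_left_cancel₀ (mul_ne_zero ?_ ?_) h4
    · exact Finset.prod_ne_zero_iff.mpr h1
    · refine Finset.prod_ne_zero_iff.mpr fun q hq => mul_ne_zero two_ne_zero ?_
      rw [← mul_shc]
      refine mul_ne_zero (h3 q hq) ?_
      rw [← Complex.ofReal_sub]
      exact shc_ofReal_ne_zero _
  have ht1 := (hc1.tendsto 0).mono_left (nhdsWithin_le_nhds (s := {0}ᶜ))
  have ht2 := (hc2.tendsto 0).mono_left (nhdsWithin_le_nhds (s := {0}ᶜ))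
  have h := tendsto_nhds_unique ht1 ((Filter.tendsto_congr' hev).mpr ht2)
  simpa [hL, hY] using h

/-- The numerator is entire, and the denominator ∏ 2 sinh(z)/z has no zeros on `contDomain`. -/
theorem isContinuation_sphCont (S : Finset (Fin (n - 1))) (μ : aSpace S) :
    IsContinuation S μ fun X => sphCont S μ X := by
  constructor
  · intro X hX
    refine DifferentiableAt.differentiableWithinAt ?_
    have hsub : Differentiable ℂ fun X : aSpace S => (X : Fin n → ℂ) :=
      (aSpace S).subtypeL.differentiable
    have h1 : Differentiable ℂ fun X : aSpace S =>
        (exists_det_blockExp_eq S).choose ((μ : Fin n → ℂ), (X : Fin n → ℂ)) :=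
      ((exists_det_blockExp_eq S).choose_spec.1.differentiable (by simp)).comp
        ((differentiable_const _).prodMk hsub)
    have h2 : Differentiable ℂ fun X : aSpace S => ∏ q ∈ posRoots S,
        2 * shc ((X : Fin n → ℂ) q.1 - (X : Fin n → ℂ) q.2) := by
      refine ContDiff.differentiable (n := 1) (contDiff_prod fun q _ => contDiff_const.mul ?_) (by simp)
      exact differentiable_shc.contDiff.comp ((ContinuousLinearMap.proj (R := ℂ)
        (φ := fun _ : Fin n => ℂ) q.1 - ContinuousLinearMap.proj q.2).contDiff.comp
          (aSpace S).subtypeL.contDiff)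
    have h4 : ∏ q ∈ posRoots S, 2 * shc ((X : Fin n → ℂ) q.1 - (X : Fin n → ℂ) q.2) ≠ 0 :=
      Finset.prod_ne_zero_iff.mpr fun q hq => mul_ne_zero two_ne_zero (shc_ne_zero (hX q hq))
    simp only [sphCont, div_eq_mul_inv]
    exact ((h1.const_mul _) X).mul ((h2 X).inv h4)
  · intro X hX
    have hre : (X : Fin n → ℂ) = fun i => (((X : Fin n → ℂ) i).re : ℂ) := by
      ext i
      exact Complex.ext (by simp) (by simp [hX i])
    beta_reduce
    rw [hre, sph_expDiag, sphInt_eq_sphCont]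

end Continuation

end SphericalGL
namespace SphericalGL

open Matrix

/-! ### Uniqueness of the analytic continuation. -/

section Uniqueness

variable {n : ℕ} {S : Finset (Fin (n - 1))}

theorem shc_eq_zero {m : ℤ} (hm : m ≠ 0) : shc (m * Real.pi * Complex.I) = 0 := by
  have h := mul_shc (m * Real.pi * Complex.I)
  rw [Complex.sinh_mul_I, Complex.sin_int_mul_pi, zero_mul] at h
  refine (mul_eq_zero.mp h).resolve_left ?_
  simp [hm, Real.pi_ne_zero]

theorem mem_contDomain_iff {X : aSpace S} :
    X ∈ contDomain S ↔ ∀ q ∈ posRoots S, shc ((X : Fin n → ℂ) q.1 - (X : Fin n → ℂ) q.2) ≠ 0 := by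
  constructor
  · exact fun hX q hq => shc_ne_zero (hX q hq)
  · intro hX q hq m hm h
    refine hX q hq ?_
    rw [show (X : Fin n → ℂ) q.1 - (X : Fin n → ℂ) q.2 = _ from h, shc_eq_zero hm]

theorem isOpen_contDomain (S : Finset (Fin (n - 1))) : IsOpen (contDomain S) := by
  have h : contDomain S = ⋂ q ∈ posRoots S,
      {X : aSpace S | shc ((X : Fin n → ℂ) q.1 - (X : Fin n → ℂ) q.2) ≠ 0} := by
    ext X
    simp [mem_contDomain_iff]
  rw [h]
  refine isOpen_biInter_finset fun q _ => isOpen_ne_fun ?_ continuous_const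
  exact differentiable_shc.continuous.comp
    (((continuous_apply q.1).comp continuous_subtype_val).sub
      ((continuous_apply q.2).comp continuous_subtype_val))

/-- A vector of the complexified space is `A + i B` with real `A` and `B`. -/
theorem exists_re_im (X : aSpace S) : ∃ A B : aSpace S, (∀ i, ((A : Fin n → ℂ) i).im = 0) ∧
    (∀ i, ((B : Fin n → ℂ) i).im = 0) ∧ X = A + Complex.I • B := by
  refine ⟨⟨fun i => (((X : Fin n → ℂ) i).re : ℂ), fun i => ?_⟩,
    ⟨fun i => (((X : Fin n → ℂ) i).im : ℂ), fun i => ?_⟩, fun i => Complex.ofReal_im _,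
    fun i => Complex.ofReal_im _, ?_⟩
  · have h := congrArg Complex.re (X.2 i)
    rw [Complex.re_sum] at h
    rw [← Complex.ofReal_sum, h]
    rfl
  · have h := congrArg Complex.im (X.2 i)
    rw [Complex.im_sum] at h
    rw [← Complex.ofReal_sum, h]
    rfl
  · ext i
    simp [mul_comm Complex.I, Complex.re_add_im]

/-- Write X = A + iB with A, B real and restrict to the complex line z ↦ A + zB. It meets the
complement of the domain in a countable set, so the remaining part is connected; both functions
agree at real z, and the identity theorem reaches z = i. -/
theorem IsContinuation.eqOn {μ : aSpace S} {F G : aSpace S → ℂ} (hF : IsContinuation S μ F)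
    (hG : IsContinuation S μ G) : Set.EqOn F G (contDomain S) := by
  intro X hX
  obtain ⟨A, B, hA, hB, rfl⟩ := exists_re_im X
  set γ : ℂ → aSpace S := fun z => A + z • B with hγ
  have hγd : Differentiable ℂ γ := (differentiable_id.smul_const B).const_add A
  set U := γ ⁻¹' contDomain S with hU
  have hUo : IsOpen U := (isOpen_contDomain S).preimage hγd.continuous
  have hcount : Uᶜ.Countable := by
    refine (Set.countable_range fun w : (Fin n × Fin n) × ℤ =>
      ((w.2 : ℂ) * Real.pi * Complex.I - rootVal w.1 A) / rootVal w.1 B).mono fun z hz => ?_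
    simp only [hU, contDomain, Set.mem_compl_iff, Set.mem_preimage, Set.mem_ofPred_eq] at hz
    push Not at hz
    obtain ⟨q, -, m, hm, h⟩ := hz
    refine ⟨(q, m), ?_⟩
    have h1 : rootVal q A + z * rootVal q B = m * Real.pi * Complex.I := by
      rw [← h]
      simp [rootVal, hγ]
      ring
    -- If the root vanished on B, its value along the line would be its real value on A, never a
    -- nonzero multiple of πi. So each root and each integer exclude at most one z.
    have h2 : rootVal q B ≠ 0 := by
      intro h0
      rw [h0, mul_zero, add_zero] at h1
      have h3 := congrArg Complex.im h1
      simp [rootVal, hA, Real.pi_ne_zero, hm] at h3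
    rw [div_eq_iff h2]
    linear_combination -h1
  have hpre : IsPreconnected U := by
    have h := hcount.isPathConnected_compl_of_one_lt_rank (by
      rw [Complex.rank_real_complex]
      exact Nat.one_lt_ofNat)
    rw [compl_compl] at h
    exact h.isConnected.isPreconnected
  have hreal : ∀ t : ℝ, F (γ t) = G (γ t) := by
    intro t
    have him : ∀ i, ((γ t : Fin n → ℂ) i).im = 0 := by
      intro i
      simp [hγ, hA, hB]
    rw [hF.2 _ him, hG.2 _ him]
  have h0 : (0 : ℂ) ∈ U := by
    change γ 0 ∈ contDomain S
    rw [mem_contDomain_iff]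
    intro q _
    have : ((γ 0 : Fin n → ℂ) q.1 - (γ 0 : Fin n → ℂ) q.2)
        = ((((A : Fin n → ℂ) q.1).re - ((A : Fin n → ℂ) q.2).re : ℝ) : ℂ) := by
      refine Complex.ext ?_ ?_ <;> simp [hγ, hA]
    rw [this]
    exact shc_ofReal_ne_zero _
  have hfreq : ∃ᶠ z in nhdsWithin (0 : ℂ) {0}ᶜ, (F ∘ γ) z = (G ∘ γ) z := by
    have ht : Filter.Tendsto (fun t : ℝ => (t : ℂ)) (nhdsWithin 0 {0}ᶜ)
        (nhdsWithin (0 : ℂ) {0}ᶜ) := by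
      refine tendsto_nhdsWithin_of_tendsto_nhds_of_eventually_within _ ?_ ?_
      · have := (Complex.continuous_ofReal.tendsto 0).mono_left (nhdsWithin_le_nhds (s := {0}ᶜ))
        simpa using this
      · filter_upwards [self_mem_nhdsWithin] with t ht
        simpa using ht
    exact ht.frequently (Filter.Eventually.frequently (Filter.Eventually.of_forall hreal))
  have hFd : AnalyticOnNhd ℂ (F ∘ γ) U :=
    (hF.1.comp hγd.differentiableOn fun z hz => hz).analyticOnNhd hUo
  have hGd : AnalyticOnNhd ℂ (G ∘ γ) U :=
    (hG.1.comp hγd.differentiableOn fun z hz => hz).analyticOnNhd hUo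
  exact hFd.eqOn_of_preconnected_of_frequently_eq hGd hpre h0 hfreq hX

theorem isContinuation_sphExp (S : Finset (Fin (n - 1))) (μ : aSpace S) :
    IsContinuation S μ (sphExp S μ) :=
  Classical.epsilon_spec (p := IsContinuation S μ) ⟨_, isContinuation_sphCont S μ⟩

theorem sphExp_eq_sphCont (μ : aSpace S) {X : aSpace S} (hX : X ∈ contDomain S) :
    sphExp S μ X = sphCont S μ X :=
  (isContinuation_sphExp S μ).eqOn (isContinuation_sphCont S μ) hX

end Uniqueness

end SphericalGL
namespace SphericalGL

open Matrix

section Expansion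

variable {n : ℕ} {S : Finset (Fin (n - 1))}

/-! ### Expansion of the spherical function along a Levi subgroup -/

theorem form_rootVec (q : Fin n × Fin n) (l : Fin n → ℂ) :
    form (rootVec q) l = (l q.1 - l q.2) / (2 * n) := by
  simp [form, rootVec, sub_mul, Finset.sum_sub_distrib, Pi.single_apply]

theorem posRoots_univ :
    posRoots (Finset.univ : Finset (Fin (n - 1))) = Finset.univ.filter fun q => q.1 < q.2 := by
  ext q
  simp [posRoots, SameBlock]

theorem posRoots_subset (S : Finset (Fin (n - 1))) : posRoots S ⊆ posRoots Finset.univ := by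
  intro q hq
  rw [posRoots_univ]
  simp [(mem_posRoots.mp hq).1]

theorem rho_univ (i : Fin n) :
    rho (Finset.univ : Finset (Fin (n - 1))) i = n - 1 - 2 * (i : ℕ) := by
  have h1 : ∀ i : Fin n, ∑ q ∈ posRoots (Finset.univ : Finset (Fin (n - 1))),
      (Pi.single q.1 1 : Fin n → ℂ) i = n - 1 - (i : ℕ) := by
    intro i
    rw [posRoots_univ, Finset.sum_filter, Fintype.sum_prod_type]
    simp only [Pi.single_apply]
    rw [Finset.sum_eq_single i]
    · simp only [if_true]
      rw [← Finset.sum_filter, Finset.filter_lt_eq_Ioi]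
      have := i.2
      rw [Finset.sum_const, Fin.card_Ioi, nsmul_eq_mul, mul_one, Nat.cast_sub (by omega),
        Nat.cast_sub (by omega), Nat.cast_one]
    · intro b _ hb
      simp [hb.symm]
    · simp
  have h2 : ∀ i : Fin n, ∑ q ∈ posRoots (Finset.univ : Finset (Fin (n - 1))),
      (Pi.single q.2 1 : Fin n → ℂ) i = (i : ℕ) := by
    intro i
    rw [posRoots_univ, Finset.sum_filter, Fintype.sum_prod_type_right]
    simp only [Pi.single_apply]
    rw [Finset.sum_eq_single i]
    · simp only [if_true]
      rw [← Finset.sum_filter, Finset.filter_gt_eq_Iio]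
      simp
    · intro b _ hb
      simp [hb.symm]
    · simp
  rw [rho_eq, Finset.sum_apply]
  simp only [rootVec, Pi.sub_apply, Finset.sum_sub_distrib, h1, h2]
  ring

/-- The product of the heights of the positive roots, up to powers of two. -/
noncomputable def heightProd (S : Finset (Fin (n - 1))) : ℂ :=
  ∏ q ∈ posRoots S, 2 * ((q.2 : ℕ) - (q.1 : ℕ) : ℂ)

theorem heightProd_ne_zero (S : Finset (Fin (n - 1))) : heightProd S ≠ 0 := by
  refine Finset.prod_ne_zero_iff.mpr fun q hq => mul_ne_zero two_ne_zero (sub_ne_zero.mpr ?_)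
  have := (mem_posRoots.mp hq).1
  rw [Fin.lt_def] at this
  exact_mod_cast this.ne'

/-- The factors 1/(2n) of the form cancel, and the root e_i − e_j takes the value 2(j − i) at ρ. It
is the ρ of the whole group, so this holds for every Levi subgroup. -/
theorem inv_cFn (S : Finset (Fin (n - 1))) (l : Fin n → ℂ) :
    (cFn S l)⁻¹ = (∏ q ∈ posRoots S, (l q.1 - l q.2)) / heightProd S := by
  rw [cFn, inv_div, piFn, piFn, heightProd, ← Finset.prod_div_distrib, ← Finset.prod_div_distrib]
  refine Finset.prod_congr rfl fun q _ => ?_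
  have hn : (n : ℂ) ≠ 0 := by
    rw [Nat.cast_ne_zero]
    rintro rfl
    exact q.1.elim0
  rw [form_rootVec, form_rootVec, rho_univ, rho_univ, div_div_div_cancel_right₀ (by simp [hn])]
  congr 1
  ring

/-- Block-constant vectors are orthogonal to vectors with vanishing block sums. Weighting by the
inverse block size collects the sum by blocks without having to index them. -/
theorem sum_mul_eq_zero {c Y : Fin n → ℂ} (hc : ∀ i j, SameBlock S i j → c j = c i)
    (hY : Y ∈ aSpace S) : ∑ i, c i * Y i = 0 := by
  classical
  set N : Fin n → ℂ := fun i => ((Finset.univ.filter fun j => SameBlock S i j).card : ℂ) with hN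
  have hN0 : ∀ i, N i ≠ 0 := by
    intro i
    rw [hN, Nat.cast_ne_zero, Finset.card_ne_zero]
    exact ⟨i, by simpa using SameBlock.rfl S i⟩
  have hNc : ∀ i j, SameBlock S i j → N i = N j := by
    intro i j h
    simp only [hN]
    congr 2
    ext k
    simp only [Finset.mem_filter, Finset.mem_univ, true_and]
    exact ⟨fun hk => h.symm.trans hk, fun hk => h.trans hk⟩
  have h1 : ∀ j, ∑ i, (if SameBlock S i j then (N i)⁻¹ else 0) = 1 := by
    intro j
    have : ∀ i, (if SameBlock S i j then (N i)⁻¹ else 0) = if SameBlock S j i then (N j)⁻¹ else 0 := by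
      intro i
      by_cases h : SameBlock S i j
      · rw [if_pos h, if_pos h.symm, hNc i j h]
      · rw [if_neg h, if_neg fun h' => h h'.symm]
    rw [Finset.sum_congr rfl fun i _ => this i, ← Finset.sum_filter, Finset.sum_const, nsmul_eq_mul]
    exact mul_inv_cancel₀ (hN0 j)
  calc ∑ j, c j * Y j = ∑ j, ∑ i, (if SameBlock S i j then (N i)⁻¹ else 0) * (c j * Y j) := by
        refine Finset.sum_congr rfl fun j _ => ?_
        rw [← Finset.sum_mul, h1, one_mul]
    _ = ∑ i, (N i)⁻¹ * c i * ∑ j ∈ Finset.univ.filter (fun j => SameBlock S i j), Y j := by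
        rw [Finset.sum_comm]
        refine Finset.sum_congr rfl fun i _ => ?_
        rw [Finset.mul_sum, Finset.sum_filter]
        refine Finset.sum_congr rfl fun j _ => ?_
        split_ifs with h
        · rw [hc i j h, mul_assoc]
        · rw [zero_mul]
    _ = 0 := Finset.sum_eq_zero fun i _ => by rw [hY i, mul_zero]

/-- Inside a block the components λ_1 and X_1 are constant, so the cross terms of λ_j X_i and the
term λ_1 X_1 split off as diagonal factors on the two sides. The cross factors have determinant 1 by
orthogonality. -/
theorem det_blockExp_proj (S : Finset (Fin (n - 1))) (l X : Fin n → ℂ) :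
    (blockExp S l X).det = Complex.exp (pairing (projOne S l) (projOne S X)) *
      (blockExp S (l - projOne S l) (X - projOne S X)).det := by
  set l1 := projOne S l with hl1
  set X1 := projOne S X with hX1
  have hl : l - l1 ∈ aSpace S := (projTilde S l).2
  have hX : X - X1 ∈ aSpace S := (projTilde S X).2
  have h : blockExp S l X = diagonal (fun i => Complex.exp (l1 i * (X - X1) i)) *
      blockExp S (l - l1) (X - X1) *
      diagonal fun j => Complex.exp (X1 j * (l - l1) j + l1 j * X1 j) := by
    ext i j
    rw [mul_diagonal, diagonal_mul]
    simp only [blockExp, of_apply]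
    split_ifs with hs
    · rw [← Complex.exp_add, ← Complex.exp_add]
      have e1 : l1 j = l1 i := projOne_eq S l hs
      have e2 : X1 j = X1 i := projOne_eq S X hs
      congr 1
      simp only [Pi.sub_apply]
      rw [e1, e2]
      ring
    · simp
  rw [h, det_mul, det_mul, det_diagonal, det_diagonal, ← Complex.exp_sum, ← Complex.exp_sum,
    Finset.sum_add_distrib, sum_mul_eq_zero (fun i j hs => projOne_eq S l hs) hX,
    sum_mul_eq_zero (fun i j hs => projOne_eq S X hs) hl, Complex.exp_zero, zero_add, pairing]
  ring

theorem blockExp_univ (l X : Fin n → ℂ) :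
    blockExp Finset.univ l X = of fun i j => Complex.exp (l j * X i) := by
  ext i j
  simp [blockExp, SameBlock]

theorem det_blockExp_eq_sum (S : Finset (Fin (n - 1))) (l X : Fin n → ℂ) :
    (blockExp S l X).det
      = ∑ t ∈ weyl S, ((t.sign : ℤ) : ℂ) * ∏ i, Complex.exp (l i * X (t i)) := by
  rw [det_apply', weyl, Finset.sum_filter]
  refine Finset.sum_congr rfl fun t _ => ?_
  split_ifs with h
  · congr 1
    refine Finset.prod_congr rfl fun i _ => ?_
    rw [blockExp, of_apply, if_pos (h i)]
  · push Not at h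
    obtain ⟨i, hi⟩ := h
    rw [Finset.prod_eq_zero (Finset.mem_univ i), mul_zero]
    rw [blockExp, of_apply, if_neg hi]

/-- Summing the determinants of the Levi subgroup over the Weyl group. -/
theorem sum_sign_mul_det_blockExp (S : Finset (Fin (n - 1))) (l X : Fin n → ℂ) :
    ∑ s : Equiv.Perm (Fin n), ((s.sign : ℤ) : ℂ) * (blockExp S (permAct s l) X).det
      = (weyl S).card * (blockExp Finset.univ l X).det := by
  simp only [det_blockExp_eq_sum S, Finset.mul_sum]
  rw [Finset.sum_comm, ← nsmul_eq_mul, ← Finset.sum_const]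
  refine Finset.sum_congr rfl fun t _ => ?_
  rw [blockExp_univ, det_apply']
  -- Substituting ts for s turns the contribution of each t in W̃ into the same Leibniz sum of the
  -- full determinant, whence the factor |W̃|.
  refine Fintype.sum_equiv (Equiv.mulLeft t) _ _ fun s => ?_
  rw [← mul_assoc, Equiv.coe_mulLeft, Equiv.Perm.sign_mul, mul_comm t.sign]
  congr 1
  · push_cast
    rfl
  · refine Fintype.prod_equiv s⁻¹ _ _ fun i => ?_
    simp [permAct]

end Expansion

end SphericalGL
namespace SphericalGL

open Matrix

/-! ### The expansion at regular points and its limit. -/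

section LeviFormula

variable {n : ℕ} {S : Finset (Fin (n - 1))}

theorem sub_projOne_sub {q : Fin n × Fin n} (hq : q ∈ posRoots S) (l : Fin n → ℂ) :
    (l - projOne S l) q.1 - (l - projOne S l) q.2 = l q.1 - l q.2 := by
  simp [projOne_eq S l (mem_posRoots.mp hq).2]

theorem mul_inv_cFn_mul_sphCont (S : Finset (Fin (n - 1))) (l : Fin n → ℂ) {X : Fin n → ℂ}
    (hX : ∀ q ∈ posRoots S, shc (X q.1 - X q.2) ≠ 0) :
    (∏ q ∈ posRoots S, 2 * Complex.sinh (X q.1 - X q.2)) * ((cFn S l)⁻¹ * sphCont S l X)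
      = (blockExp S l X).det := by
  have h := prod_mul_sphCont S l hX
  have h0 := heightProd_ne_zero S
  rw [inv_cFn]
  rw [← heightProd] at h
  field_simp
  linear_combination h

/-- The summands of the expansion along a Levi subgroup. -/
noncomputable def leviTerm (S : Finset (Fin (n - 1))) (l X : Fin n → ℂ) : ℂ :=
  Complex.exp (pairing (projOne S l) (projOne S X)) *
    sphCont S (l - projOne S l) (X - projOne S X) * (cFn S l)⁻¹

/-- Roots of the Levi subgroup do not see the components λ_1 and X_1, so the determinant formula at
the tilde components carries the original sinh product and c̃⁻¹. -/
theorem mul_leviTerm (S : Finset (Fin (n - 1))) (l : Fin n → ℂ) {X : Fin n → ℂ}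
    (hX : ∀ q ∈ posRoots S, shc (X q.1 - X q.2) ≠ 0) :
    (∏ q ∈ posRoots S, 2 * Complex.sinh (X q.1 - X q.2)) * leviTerm S l X
      = (blockExp S l X).det := by
  have h := mul_inv_cFn_mul_sphCont S (l - projOne S l) (X := X - projOne S X) fun q hq => by
    rw [sub_projOne_sub hq]
    exact hX q hq
  have e1 : ∏ q ∈ posRoots S, 2 * Complex.sinh ((X - projOne S X) q.1 - (X - projOne S X) q.2)
      = ∏ q ∈ posRoots S, 2 * Complex.sinh (X q.1 - X q.2) :=
    Finset.prod_congr rfl fun q hq => by rw [sub_projOne_sub hq]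
  have e2 : (cFn S (l - projOne S l))⁻¹ = (cFn S l)⁻¹ := by
    rw [inv_cFn, inv_cFn, Finset.prod_congr rfl fun q hq => sub_projOne_sub hq l]
  rw [e1, e2] at h
  rw [det_blockExp_proj, ← h, leviTerm]
  ring

theorem continuousAt_sphCont {l X : ℝ → Fin n → ℂ} (hl : Continuous l) (hX : Continuous X) {t : ℝ}
    (h : ∀ q ∈ posRoots S, shc (X t q.1 - X t q.2) ≠ 0) :
    ContinuousAt (fun t => sphCont S (l t) (X t)) t := by
  unfold sphCont
  refine ContinuousAt.div (continuous_const.mul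
    ((exists_det_blockExp_eq S).choose_spec.1.continuous.comp (by fun_prop))).continuousAt
    (continuous_finsetProd _ fun q _ => continuous_const.mul
      (differentiable_shc.continuous.comp (by fun_prop))).continuousAt ?_
  exact Finset.prod_ne_zero_iff.mpr fun q hq => mul_ne_zero two_ne_zero (h q hq)

theorem continuous_projOne (S : Finset (Fin (n - 1))) {X : ℝ → Fin n → ℂ} (hX : Continuous X) :
    Continuous fun t => projOne S (X t) := by
  unfold projOne
  fun_prop

/-- The expansion at points that are regular for the Levi subgroup. -/
theorem sphCont_eq_sum_of_regular (S : Finset (Fin (n - 1))) (l : Fin n → ℂ) {X : Fin n → ℂ}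
    (hX : ∀ q ∈ posRoots Finset.univ, shc (X q.1 - X q.2) ≠ 0)
    (hreg : ∀ q ∈ posRoots Finset.univ, X q.1 - X q.2 ≠ 0) :
    (cFn Finset.univ l)⁻¹ * sphCont Finset.univ l X
      = ((2 : ℂ) ^ (posRoots (n := n) Finset.univ \ posRoots S).card)⁻¹ / ((weyl S).card : ℂ) *
        (∏ q ∈ posRoots Finset.univ \ posRoots S, 1 / Complex.sinh (rootVal q X)) *
        ∑ s : Equiv.Perm (Fin n), ((s.sign : ℤ) : ℂ) * leviTerm S (permAct s l) X := by
  have hsinh : ∀ q ∈ posRoots Finset.univ, Complex.sinh (X q.1 - X q.2) ≠ 0 := by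
    intro q hq
    rw [← mul_shc]
    exact mul_ne_zero (hreg q hq) (hX q hq)
  have hD : ∀ T : Finset (Fin n × Fin n), T ⊆ posRoots Finset.univ →
      ∏ q ∈ T, 2 * Complex.sinh (X q.1 - X q.2) ≠ 0 := fun T hT =>
    Finset.prod_ne_zero_iff.mpr fun q hq => mul_ne_zero two_ne_zero (hsinh q (hT hq))
  have hW : ((weyl S).card : ℂ) ≠ 0 := by
    rw [Nat.cast_ne_zero, Finset.card_ne_zero]
    exact ⟨1, mem_weyl.mpr fun i => SameBlock.rfl _ _⟩
  have h1 := mul_inv_cFn_mul_sphCont Finset.univ l hX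
  have h2 : (∏ q ∈ posRoots S, 2 * Complex.sinh (X q.1 - X q.2)) *
      ∑ s : Equiv.Perm (Fin n), ((s.sign : ℤ) : ℂ) * leviTerm S (permAct s l) X
      = (weyl S).card * (blockExp Finset.univ l X).det := by
    rw [← sum_sign_mul_det_blockExp, Finset.mul_sum]
    refine Finset.sum_congr rfl fun s _ => ?_
    rw [← mul_leviTerm S _ fun q hq => hX q (posRoots_subset S hq)]
    ring
  have h3 : ((2 : ℂ) ^ (posRoots (n := n) Finset.univ \ posRoots S).card)⁻¹ *
      (∏ q ∈ posRoots Finset.univ \ posRoots S, 1 / Complex.sinh (rootVal q X)) *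
      ∏ q ∈ posRoots Finset.univ \ posRoots S, 2 * Complex.sinh (X q.1 - X q.2) = 1 := by
    rw [← Finset.prod_const, ← Finset.prod_inv_distrib, ← Finset.prod_mul_distrib,
      ← Finset.prod_mul_distrib]
    refine Finset.prod_eq_one fun q hq => ?_
    have := hsinh q (Finset.sdiff_subset hq)
    rw [rootVal]
    field_simp
  rw [← Finset.prod_sdiff (posRoots_subset S)] at h1
  -- After multiplication by all 2 sinh α(X), the factors with α in Φ₁⁺ cancel the prefactor, and
  -- those with α in Φ̃⁺ turn each summand into a block determinant.
  refine mul_left_cancel₀ (mul_ne_zero (hD (posRoots Finset.univ \ posRoots S) Finset.sdiff_subset)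
    (hD (posRoots S) (posRoots_subset S))) ?_
  rw [h1]
  set P := ∏ q ∈ posRoots Finset.univ \ posRoots S, 1 / Complex.sinh (rootVal q X)
  set D1 := ∏ q ∈ posRoots Finset.univ \ posRoots S, 2 * Complex.sinh (X q.1 - X q.2)
  set D2 := ∏ q ∈ posRoots S, 2 * Complex.sinh (X q.1 - X q.2)
  set R := ∑ s : Equiv.Perm (Fin n), ((s.sign : ℤ) : ℂ) * leviTerm S (permAct s l) X
  set c := ((2 : ℂ) ^ (posRoots (n := n) Finset.univ \ posRoots S).card)⁻¹
  have h4 : D1 * D2 * (c / (weyl S).card * P * R) = (c * P * D1) * (D2 * R) / (weyl S).card := by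
    ring
  rw [h4, h3, h2, one_mul, mul_div_cancel_left₀ _ hW]

/-- The expansion of the spherical function along a Levi subgroup. -/
theorem sphCont_eq_sum (S : Finset (Fin (n - 1))) (l : Fin n → ℂ) {X : Fin n → ℂ}
    (hX : ∀ q ∈ posRoots Finset.univ, shc (X q.1 - X q.2) ≠ 0)
    (hX1 : ∀ q ∈ posRoots Finset.univ \ posRoots S, rootVal q X ≠ 0) :
    (cFn Finset.univ l)⁻¹ * sphCont Finset.univ l X
      = ((2 : ℂ) ^ (posRoots (n := n) Finset.univ \ posRoots S).card)⁻¹ / ((weyl S).card : ℂ) *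
        (∏ q ∈ posRoots Finset.univ \ posRoots S, 1 / Complex.sinh (rootVal q X)) *
        ∑ s : Equiv.Perm (Fin n), ((s.sign : ℤ) : ℂ) * leviTerm S (permAct s l) X := by
  -- Only the roots of the Levi subgroup can vanish at X. Both sides stay continuous there, so the
  -- identity passes to the limit along this regular direction.
  set Y : ℝ → Fin n → ℂ := fun t i => X i + (t * (i : ℕ) : ℝ) with hY
  have hYc : Continuous Y := by fun_prop
  have hY0 : Y 0 = X := by
    ext i
    simp [hY]
  have hshc : ∀ q ∈ posRoots Finset.univ, shc (Y 0 q.1 - Y 0 q.2) ≠ 0 := by rwa [hY0]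
  have hev : ∀ᶠ t in nhdsWithin (0 : ℝ) {0}ᶜ, ∀ q ∈ posRoots Finset.univ,
      shc (Y t q.1 - Y t q.2) ≠ 0 := by
    refine Filter.Eventually.filter_mono nhdsWithin_le_nhds ?_
    rw [Filter.eventually_all_finset]
    intro q hq
    have : Continuous fun t => shc (Y t q.1 - Y t q.2) :=
      differentiable_shc.continuous.comp (by fun_prop)
    exact this.continuousAt.eventually_ne (hshc q hq)
  have hc1 : ContinuousAt (fun t => (cFn Finset.univ l)⁻¹ * sphCont Finset.univ l (Y t)) 0 :=
    continuousAt_const.mul (continuousAt_sphCont continuous_const hYc hshc)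
  have hc2 : ContinuousAt (fun t =>
      ((2 : ℂ) ^ (posRoots (n := n) Finset.univ \ posRoots S).card)⁻¹ / ((weyl S).card : ℂ) *
        (∏ q ∈ posRoots Finset.univ \ posRoots S, 1 / Complex.sinh (rootVal q (Y t))) *
        ∑ s : Equiv.Perm (Fin n), ((s.sign : ℤ) : ℂ) * leviTerm S (permAct s l) (Y t)) 0 := by
    refine ContinuousAt.mul (continuousAt_const.mul ?_) ?_
    · refine tendsto_finsetProd _ fun q hq => ?_
      refine ContinuousAt.div continuousAt_const (Continuous.continuousAt ?_) ?_
      · unfold rootVal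
        fun_prop
      · rw [hY0, rootVal, ← mul_shc]
        exact mul_ne_zero (hX1 q hq) (hX q (Finset.sdiff_subset hq))
    · refine tendsto_finsetSum _ fun s _ => ?_
      refine continuousAt_const.mul (ContinuousAt.mul (ContinuousAt.mul ?_ ?_) continuousAt_const)
      · have := continuous_projOne S hYc
        refine (Complex.continuous_exp.comp (continuous_finsetSum _ fun i _ => ?_)).continuousAt
        exact continuous_const.mul ((continuous_apply i).comp this)
      · refine continuousAt_sphCont continuous_const (hYc.sub (continuous_projOne S hYc)) ?_
        intro q hq
        change shc ((Y 0 - projOne S (Y 0)) q.1 - (Y 0 - projOne S (Y 0)) q.2) ≠ 0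
        rw [sub_projOne_sub hq]
        exact hshc q (posRoots_subset S hq)
  have heq : (fun t => (cFn Finset.univ l)⁻¹ * sphCont Finset.univ l (Y t))
      =ᶠ[nhdsWithin 0 {0}ᶜ] fun t =>
      ((2 : ℂ) ^ (posRoots (n := n) Finset.univ \ posRoots S).card)⁻¹ / ((weyl S).card : ℂ) *
        (∏ q ∈ posRoots Finset.univ \ posRoots S, 1 / Complex.sinh (rootVal q (Y t))) *
        ∑ s : Equiv.Perm (Fin n), ((s.sign : ℤ) : ℂ) * leviTerm S (permAct s l) (Y t) := by
    filter_upwards [hev, eventually_prod_ne_zero Finset.univ X] with t h1 h2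
    exact sphCont_eq_sum_of_regular S l h1 h2
  have h := tendsto_nhds_unique (hc1.tendsto.mono_left (nhdsWithin_le_nhds (s := {0}ᶜ)))
    ((Filter.tendsto_congr' heq).mpr (hc2.tendsto.mono_left (nhdsWithin_le_nhds (s := {0}ᶜ))))
  rwa [hY0] at h

end LeviFormula

end SphericalGL
namespace SphericalGL

open Matrix MeasureTheory

section Bound

variable {n : ℕ} {S : Finset (Fin (n - 1))}

/-! ### Bounds for imaginary parameters -/

/-- The determinant and the two root products are symmetric under exchange of λ and X, hence so is
their quotient, first at regular points and then in the limit. This symmetry turns φ_λ(1) = 1 into a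
formula for φ_0. -/
theorem choose_det_blockExp_symm (S : Finset (Fin (n - 1))) (l X : Fin n → ℂ) :
    (exists_det_blockExp_eq S).choose (l, X) = (exists_det_blockExp_eq S).choose (X, l) := by
  obtain ⟨hE, hdet⟩ := (exists_det_blockExp_eq S).choose_spec
  set E := (exists_det_blockExp_eq S).choose
  set L : ℝ → Fin n → ℂ := fun t i => l i + (t * (i : ℕ) : ℝ) with hL
  set Y : ℝ → Fin n → ℂ := fun t i => X i + (t * (i : ℕ) : ℝ) with hY
  have htr : ∀ l X : Fin n → ℂ, (blockExp S l X).det = (blockExp S X l).det := by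
    intro l X
    rw [← det_transpose]
    congr 1
    ext i j
    have : SameBlock S j i ↔ SameBlock S i j := ⟨SameBlock.symm, SameBlock.symm⟩
    simp [blockExp, this, mul_comm]
  have hc1 : Continuous fun t => E (L t, Y t) := hE.continuous.comp (by fun_prop)
  have hc2 : Continuous fun t => E (Y t, L t) := hE.continuous.comp (by fun_prop)
  have hev : (fun t => E (L t, Y t)) =ᶠ[nhdsWithin 0 {0}ᶜ] fun t => E (Y t, L t) := by
    filter_upwards [eventually_prod_ne_zero S l, eventually_prod_ne_zero S X] with t h1 h2
    have h3 := htr (L t) (Y t)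
    rw [hdet, hdet, mul_comm (∏ q ∈ posRoots S, (Y t q.1 - Y t q.2))] at h3
    exact mul_left_cancel₀ (mul_ne_zero (Finset.prod_ne_zero_iff.mpr h1)
      (Finset.prod_ne_zero_iff.mpr h2)) h3
  have h := tendsto_nhds_unique ((hc1.tendsto 0).mono_left (nhdsWithin_le_nhds (s := {0}ᶜ)))
    ((Filter.tendsto_congr' hev).mpr ((hc2.tendsto 0).mono_left (nhdsWithin_le_nhds (s := {0}ᶜ))))
  simpa [hL, hY] using h

/-- The elementary spherical function with parameter zero. -/
theorem sphInt_zero_left (S : Finset (Fin (n - 1))) (X : Fin n → ℝ) :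
    sphInt S 0 X = ∏ q ∈ posRoots S, (shc (X q.1 - X q.2 : ℝ))⁻¹ := by
  have h := sphInt_zero_arg S fun i => (X i : ℂ)
  rw [sphInt_eq_sphCont] at h
  simp only [sphCont, Pi.zero_apply, Complex.ofReal_zero, sub_self, shc_zero, mul_one] at h
  rw [div_eq_one_iff_eq (Finset.prod_ne_zero_iff.mpr fun _ _ => two_ne_zero)] at h
  have h0 : (fun _ : Fin n => (0 : ℂ)) = 0 := rfl
  rw [sphInt_eq_sphCont, sphCont, choose_det_blockExp_symm, ← h0, h, ← Finset.prod_div_distrib]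
  refine Finset.prod_congr rfl fun q _ => ?_
  have := shc_ofReal_ne_zero (X q.1 - X q.2)
  rw [← Complex.ofReal_sub]
  field_simp

/-- For real x this is |x| ≤ sinh |x|. -/
theorem one_le_norm_shc (x : ℝ) : 1 ≤ ‖shc x‖ := by
  rcases eq_or_ne x 0 with rfl | hx
  · simp [shc_zero]
  · have h := congrArg norm (mul_shc x)
    rw [norm_mul, ← Complex.ofReal_sinh, Complex.norm_real, Complex.norm_real, Real.norm_eq_abs,
      Real.norm_eq_abs, Real.abs_sinh] at h
    have h1 : |x| ≤ Real.sinh |x| := Real.self_le_sinh_iff.mpr (abs_nonneg x)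
    have h2 : 0 < |x| := abs_pos.mpr hx
    rw [← h] at h1
    exact le_of_mul_le_mul_left (by rwa [mul_one]) h2

/-- For imaginary λ the integrand has the modulus of the one at λ = 0, so |φ_λ| ≤ φ_0, and φ_0 is a
product of factors x / sinh x ≤ 1. -/
theorem norm_sphInt_le_one (S : Finset (Fin (n - 1))) {l : Fin n → ℂ} (hl : ∀ i, (l i).re = 0)
    (X : Fin n → ℝ) : ‖sphInt S l X‖ ≤ 1 := by
  have hrho : ∀ i, (rho S i).im = 0 := by
    intro i
    rw [rho_eq, Finset.sum_apply, Complex.im_sum]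
    refine Finset.sum_eq_zero fun q _ => ?_
    simp only [rootVec, Pi.sub_apply, Pi.single_apply]
    split_ifs <;> simp
  set H : compactK S → Fin n → ℝ := fun k => minorH (toMat k * expDiag fun i => (X i : ℂ)) with hH
  have h1 : ∀ (m : Fin n → ℂ) (_ : ∀ i, (m i).re = 0) (k : compactK S),
      ‖Complex.exp (pairing (m + rho S) fun i => (H k i : ℂ))‖
        = Real.exp (∑ i, (rho S i).re * H k i) := by
    intro m hm k
    rw [Complex.norm_exp, pairing, Complex.re_sum]
    simp [hm]
  have h0 : ∀ k, Complex.exp (pairing (0 + rho S) fun i => (H k i : ℂ))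
      = (Real.exp (∑ i, (rho S i).re * H k i) : ℝ) := by
    intro k
    rw [Complex.ofReal_exp, pairing, Complex.ofReal_sum]
    congr 1
    refine Finset.sum_congr rfl fun i _ => ?_
    refine Complex.ext ?_ ?_ <;> simp [hrho]
  have h2 : ‖sphInt S l X‖ ≤ ∫ k, Real.exp (∑ i, (rho S i).re * H k i) ∂haarK S := by
    refine (norm_integral_le_integral_norm _).trans_eq ?_
    exact integral_congr_ae (Filter.Eventually.of_forall fun k => h1 l hl k)
  have h3 : sphInt S 0 X = (∫ k, Real.exp (∑ i, (rho S i).re * H k i) ∂haarK S : ℝ) := by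
    exact (integral_congr_ae (Filter.Eventually.of_forall h0)).trans integral_complex_ofReal
  have h4 : ∫ k, Real.exp (∑ i, (rho S i).re * H k i) ∂haarK S = ‖sphInt S 0 X‖ := by
    rw [h3, Complex.norm_real, Real.norm_of_nonneg]
    exact integral_nonneg fun k => (Real.exp_pos _).le
  rw [h4, sphInt_zero_left, norm_prod] at h2
  refine h2.trans (Finset.prod_le_one (fun _ _ => norm_nonneg _) fun q _ => ?_)
  rw [norm_inv]
  exact inv_le_one_of_one_le₀ (one_le_norm_shc _)

theorem two_mul_card_posRoots_univ :
    2 * ((posRoots (Finset.univ : Finset (Fin (n - 1)))).card : ℤ) = (n : ℤ) ^ 2 - n := by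
  have h1 : (posRoots (Finset.univ : Finset (Fin (n - 1)))).card = ∑ i ∈ Finset.range n, i := by
    rw [posRoots_univ, Finset.card_filter, Fintype.sum_prod_type_right,
      ← Fin.sum_univ_eq_sum_range (fun i => i) n]
    refine Finset.sum_congr rfl fun i _ => ?_
    rw [← Finset.card_filter, Finset.filter_gt_eq_Iio, Fin.card_Iio]
  have h2 := Finset.sum_range_id_mul_two n
  rw [h1]
  rcases Nat.eq_zero_or_pos n with rfl | hn
  · simp
  · zify [hn] at h2 ⊢
    linarith

theorem norm_apply_le_dualNorm (l : Fin n → ℂ) (i : Fin n) :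
    ‖l i‖ ≤ Real.sqrt (2 * n) * dualNorm l := by
  have hn : (0 : ℝ) < 2 * n := by
    have : 0 < n := i.pos
    positivity
  rw [dualNorm, ← Real.sqrt_mul hn.le, ← add_div, mul_div_cancel₀ _ hn.ne']
  refine Real.le_sqrt_of_sq_le ?_
  rw [Complex.sq_norm, Complex.normSq_apply]
  exact add_le_add
    (Finset.single_le_sum (f := fun i => (l i).re * (l i).re) (fun j _ => mul_self_nonneg _)
      (Finset.mem_univ i))
    (Finset.single_le_sum (f := fun i => (l i).im * (l i).im) (fun j _ => mul_self_nonneg _)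
      (Finset.mem_univ i))

/-- There is one linear factor |λ_i − λ_j| ≤ R per positive root, while every factor of the
denominator is at least 2. -/
theorem norm_inv_cFn_le (S : Finset (Fin (n - 1))) {l : Fin n → ℂ} {R : ℝ}
    (hl : ∀ i, ‖l i‖ ≤ R / 2) : ‖(cFn S l)⁻¹‖ ≤ R ^ (posRoots S).card := by
  rw [inv_cFn, norm_div, heightProd, norm_prod, norm_prod, ← Finset.prod_div_distrib,
    ← Finset.prod_const]
  refine Finset.prod_le_prod (fun _ _ => by positivity) fun q hq => ?_
  have h1 : (1 : ℝ) ≤ ‖2 * (((q.2 : ℕ) : ℂ) - (q.1 : ℕ))‖ := by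
    have h := (mem_posRoots.mp hq).1
    rw [Fin.lt_def] at h
    have h2 : (2 * (((q.2 : ℕ) : ℂ) - (q.1 : ℕ))) = ((2 * (q.2 - q.1 : ℕ) : ℕ) : ℂ) := by
      push_cast [h.le]
      ring
    rw [h2, Complex.norm_natCast]
    exact_mod_cast (by omega : 1 ≤ 2 * ((q.2 : ℕ) - q.1))
  refine div_le_of_le_mul₀ (norm_nonneg _) ?_ ?_
  · linarith [norm_nonneg (l q.1), hl q.1]
  · have h2 : ‖l q.1 - l q.2‖ ≤ R := by
      linarith [norm_sub_le (l q.1) (l q.2), hl q.1, hl q.2]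
    have h3 : 0 ≤ R := (norm_nonneg _).trans h2
    nlinarith

/-- At imaginary λ and real X the exponential has modulus 1 and the spherical function at most 1, so
only c̃⁻¹ contributes. -/
theorem norm_leviTerm_le (S : Finset (Fin (n - 1))) {l X : Fin n → ℂ} {R : ℝ}
    (hR : ∀ i, ‖l i‖ ≤ R / 2) (hl : ∀ i, (l i).re = 0) (hX : ∀ i, (X i).im = 0) :
    ‖leviTerm S l X‖ ≤ R ^ (posRoots S).card := by
  have hl1 : ∀ i, (projOne S l i).re = 0 := by
    intro i
    rw [projOne, Complex.div_natCast_re, Complex.re_sum, Finset.sum_eq_zero fun j _ => hl j, zero_div]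
  have hX1 : ∀ i, (projOne S X i).im = 0 := by
    intro i
    rw [projOne, Complex.div_natCast_im, Complex.im_sum, Finset.sum_eq_zero fun j _ => hX j, zero_div]
  have h1 : ‖Complex.exp (pairing (projOne S l) (projOne S X))‖ = 1 := by
    rw [Complex.norm_exp, pairing, Complex.re_sum, Finset.sum_eq_zero, Real.exp_zero]
    intro i _
    simp [hl1, hX1]
  have h2 : X - projOne S X = fun i => ((((X - projOne S X) i).re : ℝ) : ℂ) := by
    ext i
    exact Complex.ext (by simp) (by simp [hX, hX1])
  have h3 : ‖sphCont S (l - projOne S l) (X - projOne S X)‖ ≤ 1 := by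
    rw [h2, ← sphInt_eq_sphCont]
    exact norm_sphInt_le_one S (fun i => by simp [hl, hl1]) _
  rw [leviTerm, norm_mul, norm_mul, h1, one_mul]
  calc _ ≤ 1 * ‖(cFn S l)⁻¹‖ := by gcongr
    _ ≤ _ := by
      rw [one_mul]
      exact norm_inv_cFn_le S hR

end Bound

end SphericalGL
namespace SphericalGL

/-! ### The continued expansion and the estimate. -/

section Main

variable {n : ℕ}

theorem mem_contDomain_projTilde {S : Finset (Fin (n - 1))} {X : aSpace (n := n) Finset.univ}
    (hX : X ∈ contDomain Finset.univ) : projTilde S (X : Fin n → ℂ) ∈ contDomain S := by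
  rw [mem_contDomain_iff] at hX ⊢
  intro q hq
  change shc (((X : Fin n → ℂ) - projOne S X) q.1 - ((X : Fin n → ℂ) - projOne S X) q.2) ≠ 0
  rw [sub_projOne_sub hq]
  exact hX q (posRoots_subset S hq)

/-- The expansion along a Levi subgroup for the continued spherical functions. -/
theorem sphExp_eq_sum (S : Finset (Fin (n - 1))) {X : aSpace (n := n) Finset.univ}
    (hX : X ∈ contDomain Finset.univ)
    (hX1 : ∀ p ∈ posRoots Finset.univ \ posRoots S, rootVal p X ≠ 0)
    (l : aSpace (n := n) Finset.univ) :
    (cFn Finset.univ (l : Fin n → ℂ))⁻¹ * sphExp Finset.univ l X =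
      ((2 : ℂ) ^ (posRoots (n := n) Finset.univ \ posRoots S).card)⁻¹ / ((weyl S).card : ℂ) *
        (∏ p ∈ posRoots Finset.univ \ posRoots S, 1 / Complex.sinh (rootVal p X)) *
        ∑ s : Equiv.Perm (Fin n), ((Equiv.Perm.sign s : ℤ) : ℂ) *
          Complex.exp (pairing (projOne S (permAct s l)) (projOne S X)) *
          sphExp S (projTilde S (permAct s l)) (projTilde S X) * (cFn S (permAct s l))⁻¹ := by
  rw [sphExp_eq_sphCont l hX, sphCont_eq_sum S l (mem_contDomain_iff.mp hX) hX1]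
  congr 1
  refine Finset.sum_congr rfl fun s _ => ?_
  rw [sphExp_eq_sphCont _ (mem_contDomain_projTilde hX), leviTerm, mul_assoc, mul_assoc, mul_assoc]
  rfl

theorem projTilde_eq_zero {S : Finset (Fin (n - 1))} {X : Fin n → ℂ}
    (hX : ∀ p ∈ posRoots S, rootVal p X = 0) : projTilde S X = 0 := by
  have h : ∀ i j, SameBlock S i j → X j = X i := by
    intro i j hij
    rcases lt_trichotomy i j with hlt | rfl | hlt
    · exact (sub_eq_zero.mp (hX (i, j) (mem_posRoots.mpr ⟨hlt, hij⟩))).symm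
    · rfl
    · exact sub_eq_zero.mp (hX (j, i) (mem_posRoots.mpr ⟨hlt, hij.symm⟩))
  refine Subtype.ext (funext fun i => ?_)
  change X i - projOne S X i = 0
  have hc : ((Finset.univ.filter fun j => SameBlock S i j).card : ℂ) ≠ 0 := by
    rw [Nat.cast_ne_zero, Finset.card_ne_zero]
    exact ⟨i, by simpa using SameBlock.rfl S i⟩
  rw [projOne, Finset.sum_congr rfl fun j hj => h i j (Finset.mem_filter.mp hj).2, Finset.sum_const,
    nsmul_eq_mul, mul_div_cancel_left₀ _ hc, sub_self]

theorem sphExp_zero (S : Finset (Fin (n - 1))) (μ : aSpace S) : sphExp S μ 0 = 1 := by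
  rw [(isContinuation_sphExp S μ).2 0 fun i => by simp, ← sphInt_zero_arg S μ, ← sph_expDiag]
  congr 2

/-- One factor c⁻¹ is bounded by its degree |Φ⁺|. The other is absorbed in the expansion, whose n!
summands are each of degree |Φ̃⁺| in R. -/
theorem norm_inv_cFn_sq_mul_sph_le (S : Finset (Fin (n - 1))) {X l : aSpace (n := n) Finset.univ}
    (hX : ∀ i, ((X : Fin n → ℂ) i).im = 0)
    (hX1 : ∀ p ∈ posRoots Finset.univ \ posRoots S, rootVal p X ≠ 0)
    (hl : ∀ i, ((l : Fin n → ℂ) i).re = 0) {R : ℝ} (hR : ∀ i, ‖(l : Fin n → ℂ) i‖ ≤ R / 2) :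
    ‖(cFn Finset.univ (l : Fin n → ℂ))⁻¹ ^ 2 * sph Finset.univ l (expDiag X)‖
      ≤ n.factorial * R ^ ((posRoots (Finset.univ : Finset (Fin (n - 1)))).card + (posRoots S).card) *
        ∏ p ∈ posRoots Finset.univ \ posRoots S, ‖Complex.sinh (rootVal p X)‖⁻¹ := by
  have hre : (X : Fin n → ℂ) = fun i => (((X : Fin n → ℂ) i).re : ℂ) := by
    ext i
    exact Complex.ext (by simp) (by simp [hX i])
  have hshc : ∀ q ∈ posRoots Finset.univ,
      shc ((X : Fin n → ℂ) q.1 - (X : Fin n → ℂ) q.2) ≠ 0 := by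
    intro q _
    rw [hre, ← Complex.ofReal_sub]
    exact shc_ofReal_ne_zero _
  have hsph : sph Finset.univ l (expDiag X) = sphCont Finset.univ (l : Fin n → ℂ) (X : Fin n → ℂ) := by
    rw [hre, sph_expDiag, sphInt_eq_sphCont]
  have h1 : ‖∑ s : Equiv.Perm (Fin n), ((s.sign : ℤ) : ℂ) * leviTerm S (permAct s l) X‖
      ≤ n.factorial * R ^ (posRoots S).card := by
    refine (norm_sum_le_of_le Finset.univ (f := fun s : Equiv.Perm (Fin n) =>
      ((s.sign : ℤ) : ℂ) * leviTerm S (permAct s l) X) (n := fun _ => R ^ (posRoots S).card)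
      fun s _ => ?_).trans_eq ?_
    · have h2 : ‖((s.sign : ℤ) : ℂ)‖ = 1 := by
        rcases Int.units_eq_one_or s.sign with h | h <;> simp [h]
      rw [norm_mul, h2, one_mul]
      exact norm_leviTerm_le S (fun i => hR _) (fun i => hl _) hX
    · rw [Finset.sum_const, Finset.card_univ, Fintype.card_perm, Fintype.card_fin, nsmul_eq_mul]
  have h3 : ‖((2 : ℂ) ^ (posRoots (n := n) Finset.univ \ posRoots S).card)⁻¹ /
      ((weyl S).card : ℂ)‖ ≤ 1 := by
    rw [norm_div, norm_inv, norm_pow, Complex.norm_ofNat, Complex.norm_natCast]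
    refine div_le_one_of_le₀ ((inv_le_one_of_one_le₀ (one_le_pow₀ one_le_two)).trans ?_)
      (Nat.cast_nonneg _)
    have : (weyl S).card ≠ 0 :=
      Finset.card_ne_zero.mpr ⟨1, mem_weyl.mpr fun i => SameBlock.rfl _ _⟩
    exact_mod_cast Nat.one_le_iff_ne_zero.mpr this
  have h4 : ‖∏ p ∈ posRoots Finset.univ \ posRoots S, 1 / Complex.sinh (rootVal p X)‖
      = ∏ p ∈ posRoots Finset.univ \ posRoots S, ‖Complex.sinh (rootVal p X)‖⁻¹ := by
    rw [norm_prod]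
    exact Finset.prod_congr rfl fun p _ => by rw [one_div, norm_inv]
  have h5 := norm_inv_cFn_le Finset.univ hR
  rw [hsph, sq, mul_assoc, sphCont_eq_sum S l hshc hX1, norm_mul, norm_mul, norm_mul, h4]
  set Q := ∏ p ∈ posRoots Finset.univ \ posRoots S, ‖Complex.sinh (rootVal p X)‖⁻¹
  have hQ : 0 ≤ Q := Finset.prod_nonneg fun _ _ => inv_nonneg.mpr (norm_nonneg _)
  calc _ ≤ R ^ (posRoots (Finset.univ : Finset (Fin (n - 1)))).card *
        (1 * Q * (n.factorial * R ^ (posRoots S).card)) := by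
        gcongr
        exact (norm_nonneg _).trans h5
    _ = _ := by ring

end Main

end SphericalGL

theorem mainTheorem9 (n : ℕ) (hn : 2 ≤ n) :
    -- the analytic continuation of `X ↦ φ_μ(e^X)` exists and is unique, for every Levi subgroup
    (∀ (S : Finset (Fin (n - 1))) (μ : SphericalGL.aSpace S),
      SphericalGL.IsContinuation S μ (SphericalGL.sphExp S μ) ∧
      ∀ F : SphericalGL.aSpace S → ℂ, SphericalGL.IsContinuation S μ F →
        Set.EqOn F (SphericalGL.sphExp S μ) (SphericalGL.contDomain S)) ∧
    -- first part
    (∀ (S : Finset (Fin (n - 1))) (X : SphericalGL.aSpace (n := n) Finset.univ),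
      X ∈ SphericalGL.contDomain Finset.univ →
      (∀ p ∈ SphericalGL.posRoots Finset.univ \ SphericalGL.posRoots S,
        SphericalGL.rootVal p X ≠ 0) →
      ∀ l : SphericalGL.aSpace (n := n) Finset.univ,
        (SphericalGL.cFn Finset.univ (l : Fin n → ℂ))⁻¹ * SphericalGL.sphExp Finset.univ l X =
          ((2 : ℂ) ^ (SphericalGL.posRoots (n := n) Finset.univ \ SphericalGL.posRoots S).card)⁻¹ /
              ((SphericalGL.weyl S).card : ℂ) *
            (∏ p ∈ SphericalGL.posRoots Finset.univ \ SphericalGL.posRoots S,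
              1 / Complex.sinh (SphericalGL.rootVal p X)) *
            ∑ s : Equiv.Perm (Fin n),
              ((Equiv.Perm.sign s : ℤ) : ℂ) *
                Complex.exp (SphericalGL.pairing
                  (SphericalGL.projOne S (SphericalGL.permAct s l)) (SphericalGL.projOne S X)) *
                SphericalGL.sphExp S (SphericalGL.projTilde S (SphericalGL.permAct s l))
                  (SphericalGL.projTilde S X) *
                (SphericalGL.cFn S (SphericalGL.permAct s l))⁻¹) ∧
    -- second part
    (∀ (S : Finset (Fin (n - 1))) (X : SphericalGL.aSpace (n := n) Finset.univ),
      X ∈ SphericalGL.contDomain Finset.univ →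
      (∀ p ∈ SphericalGL.posRoots Finset.univ \ SphericalGL.posRoots S,
        SphericalGL.rootVal p X ≠ 0) →
      (∀ p ∈ SphericalGL.posRoots S, SphericalGL.rootVal p X = 0) →
      ∀ l : SphericalGL.aSpace (n := n) Finset.univ,
        (SphericalGL.cFn Finset.univ (l : Fin n → ℂ))⁻¹ * SphericalGL.sphExp Finset.univ l X =
          ((2 : ℂ) ^ (SphericalGL.posRoots (n := n) Finset.univ \ SphericalGL.posRoots S).card)⁻¹ /
              ((SphericalGL.weyl S).card : ℂ) *
            (∏ p ∈ SphericalGL.posRoots Finset.univ \ SphericalGL.posRoots S,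
              1 / Complex.sinh (SphericalGL.rootVal p X)) *
            ∑ s : Equiv.Perm (Fin n),
              ((Equiv.Perm.sign s : ℤ) : ℂ) *
                Complex.exp (SphericalGL.pairing
                  (SphericalGL.projOne S (SphericalGL.permAct s l)) (SphericalGL.projOne S X)) *
                (SphericalGL.cFn S (SphericalGL.permAct s l))⁻¹) ∧
    -- the bound, for the spherical function on the group, real `X` and purely imaginary `l`
    (∃ C : ℝ, 0 < C ∧
      ∀ (S : Finset (Fin (n - 1))) (X : SphericalGL.aSpace (n := n) Finset.univ),
        (∀ i, ((X : Fin n → ℂ) i).im = 0) →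
        (∀ p ∈ SphericalGL.posRoots Finset.univ \ SphericalGL.posRoots S,
          SphericalGL.rootVal p X ≠ 0) →
        ∀ l : SphericalGL.aSpace (n := n) Finset.univ, (∀ i, ((l : Fin n → ℂ) i).re = 0) →
          ‖(SphericalGL.cFn Finset.univ (l : Fin n → ℂ))⁻¹ ^ 2 *
              SphericalGL.sph Finset.univ l (SphericalGL.expDiag X)‖ ≤
            C * (1 + SphericalGL.dualNorm (l : Fin n → ℂ)) ^
                (((n : ℤ) ^ 2 - 1) - ((n : ℤ) - 1) -
                  ((SphericalGL.posRoots (n := n) Finset.univ \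
                    SphericalGL.posRoots S).card : ℤ)) *
              ∏ p ∈ SphericalGL.posRoots Finset.univ \ SphericalGL.posRoots S,
                ‖Complex.sinh (SphericalGL.rootVal p X)‖⁻¹) := by
  open SphericalGL in
  refine ⟨fun S μ => ⟨isContinuation_sphExp S μ, fun F hF => hF.eqOn (isContinuation_sphExp S μ)⟩,
    fun S X hX hX1 l => sphExp_eq_sum S hX hX1 l, fun S X hX hX1 hX0 l => ?_, ?_⟩
  · rw [sphExp_eq_sum S hX hX1 l, projTilde_eq_zero hX0]
    simp only [sphExp_zero, mul_one]
  · set N := (posRoots (Finset.univ : Finset (Fin (n - 1)))).card with hN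
    -- With R = c(1 + ‖λ‖) every coordinate satisfies |λ_i| ≤ √(2n) ‖λ‖ ≤ R/2.
    set c := 2 * Real.sqrt (2 * n) with hc
    have hn' : (2 : ℝ) ≤ n := by exact_mod_cast hn
    have hc1 : 1 ≤ c := by
      have : 1 ≤ Real.sqrt (2 * n) := Real.one_le_sqrt.mpr (by linarith)
      linarith
    -- Since c ≥ 1 and |Φ⁺| + |Φ̃⁺| ≤ 2N, the exponent 2N serves for all S at once.
    refine ⟨n.factorial * c ^ (2 * N), by positivity, fun S X hX hX1 l hl => ?_⟩
    set D := dualNorm (l : Fin n → ℂ) with hD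
    have hD0 : 0 ≤ D := Real.sqrt_nonneg _
    refine (norm_inv_cFn_sq_mul_sph_le S hX hX1 hl (R := c * (1 + D)) fun i => ?_).trans ?_
    · refine (norm_apply_le_dualNorm _ i).trans ?_
      have h0 := Real.sqrt_nonneg (2 * (n : ℝ))
      rw [← hD, hc]
      nlinarith
    · have hsub := posRoots_subset S
      have hcard := Finset.card_sdiff_add_card_eq_card hsub
      -- Here d − r = n² − n = 2|Φ⁺|, and subtracting |Φ₁⁺| leaves |Φ⁺| + |Φ̃⁺|.
      have hexp : ((n : ℤ) ^ 2 - 1) - ((n : ℤ) - 1) -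
          ((posRoots (n := n) Finset.univ \ posRoots S).card : ℤ) = (N + (posRoots S).card : ℕ) := by
        have h1 := two_mul_card_posRoots_univ (n := n)
        rw [← hcard] at h1 hN
        push_cast at h1 hN ⊢
        rw [hN]
        push_cast
        linarith
      rw [hexp, zpow_natCast, mul_pow]
      refine mul_le_mul_of_nonneg_right ?_
        (Finset.prod_nonneg fun _ _ => inv_nonneg.mpr (norm_nonneg _))
      rw [mul_assoc]
      refine mul_le_mul_of_nonneg_left ?_ (Nat.cast_nonneg _)
      refine mul_le_mul_of_nonneg_right ?_ (by positivity)
      refine pow_le_pow_right₀ hc1 ?_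
      have := Finset.card_le_card hsub
      omega
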